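/- Work in the two-sorted language of second-order arithmetic (number variables and set variables). $\mathrm{RCA}_0$ consists of the basic axioms for $0,1,+,\cdot,<$, induction for $\Sigma^0_1$ formulas, and $\Delta^0_1$ comprehension; $\mathrm{ACA}_0$ is $\mathrm{RCA}_0$ together with comprehension for all arithmetical formulas (formulas without set quantifiers). In $\mathrm{RCA}_0$, integers and rationals are coded by numbers via the pairing function $(m,n)\mapsto (m+n)^2+m$; a real number is a sequence $\langle q_k\rangle$ of rationals with $|q_k-q_{k+i}|\le 2^{-k}$ for all $k,i$; and for reals $\langle q_k\rangle\le\langle r_k\rangle$ means that $q_k\le r_k+2^{-k+1}$ for all $k$, equality being $\le$ in both directions. A rational is also regarded as a real (a constant sequence). For sequences of real numbers $(a_n)_{n\in\mathbb N}$ and $(x_n)_{n\in\mathbb N}$, let $P(a,x)$ be the conjunction of: - $0<a_n\le a_{n+1}$ for all $n$; - for every $m\in\mathbb N$ there is $k\in\mathbb N$ with $a_k\ge m$; - the sequence of partial sums $s_n=\sum_{i=0}^n x_i$ is Cauchy: for every $k$ there is $N$ such that $|s_m-s_n|\le 2^{-k}$ for all $m,n\ge N$. Let $u_n=\frac1{a_n}\sum_{i=0}^n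 a_ix_i$, and define $$\mathrm{KRON}(a,x):\equiv\; P(a,x)\to \forall k\,\exists N\,\forall n\ge N\;\; |u_n|\le 2^{-k},$$ $$\mathrm{RKRON}(a,x):\equiv\; P(a,x)\to \exists g:\mathbb N\to\mathbb N\;\forall k\,\forall n\,\bigl(n\ge g(k)\to |u_n|\le 2^{-k}\bigr),$$ where the conclusion in both cases includes the existence of $(u_n)$ as a sequence of reals. **Theorem.** The following are provable in $\mathrm{RCA}_0$, that is (by Gödel's completeness theorem), they hold in every model of $\mathrm{RCA}_0$, where a model may have nonstandard numbers and any collection of sets of its numbers as its second-order part. (i) For all sequences of reals $a$ and $x$, $\mathrm{KRON}(a,x)$. (ii) $\mathrm{ACA}_0$ implies that $\mathrm{RKRON}(a,x)$ holds for all sequences of reals $a$ and $x$. (iii) If $\mathrm{RKRON}(\langle n+1\rangle,x)$ holds for all sequences $x$ of positive rationals, then $\mathrm{ACA}_0$ holds. Consequently, over $\mathrm{RCA}_0$, $\mathrm{ACA}_0$ is equivalent to the statement that $\mathrm{RKRON}(a,x)$ holds for all sequences of reals $a$ and $x$. -/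

import Mathlib

/-! ### The language of second-order arithmetic -/

universe u

/-- A structure for the language of second-order arithmetic: a set of numbers with `0, 1, +, ·, <`,
and a nonempty collection of sets of numbers, over which the set variables range (so "Henkin"
structures; the numbers may be nonstandard). -/
structure L2Structure where
  Num : Type u
  zero : Num
  one : Num
  add : Num → Num → Num
  mul : Num → Num → Num
  lt : Num → Num → Prop
  sets : Set (Set Num)
  sets_nonempty : sets.Nonempty

/-- Numerical terms; number variables are de Bruijn indices. -/
inductive L2Term where
  | var (i : ℕ)
  | zero
  | one
  | add (s t : L2Term)
  | mul (s t : L2Term)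

/-- Formulas of second-order arithmetic; number variables and set variables are two separate
families of de Bruijn indices. -/
inductive L2Formula where
  | eq (s t : L2Term)
  | lt (s t : L2Term)
  | mem (t : L2Term) (X : ℕ)
  | neg (φ : L2Formula)
  | and (φ ψ : L2Formula)
  | or (φ ψ : L2Formula)
  | imp (φ ψ : L2Formula)
  | allNum (φ : L2Formula)
  | exNum (φ : L2Formula)
  | allSet (φ : L2Formula)
  | exSet (φ : L2Formula)

/-- Rename the variables of a term so that variable `0` does not occur in it. -/
def L2Term.lift : L2Term → L2Term
  | .var i => .var (i + 1)
  | .zero => .zero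
  | .one => .one
  | .add s t => .add s.lift t.lift
  | .mul s t => .mul s.lift t.lift

namespace L2Formula

/-- Arithmetical formulas: no set quantifiers (free set variables are allowed). -/
def IsArithmetical : L2Formula → Prop
  | eq _ _ => True
  | lt _ _ => True
  | mem _ _ => True
  | neg φ => φ.IsArithmetical
  | and φ ψ => φ.IsArithmetical ∧ ψ.IsArithmetical
  | or φ ψ => φ.IsArithmetical ∧ ψ.IsArithmetical
  | imp φ ψ => φ.IsArithmetical ∧ ψ.IsArithmetical
  | allNum φ => φ.IsArithmetical
  | exNum φ => φ.IsArithmetical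
  | allSet _ => False
  | exSet _ => False

/-- Bounded-quantifier formulas: built from atomic formulas by connectives and the quantifiers
`∀ n < t` and `∃ n < t`, where `n` does not occur in the term `t`. -/
inductive IsBounded : L2Formula → Prop
  | eq (s t : L2Term) : IsBounded (eq s t)
  | lt (s t : L2Term) : IsBounded (lt s t)
  | mem (t : L2Term) (X : ℕ) : IsBounded (mem t X)
  | neg {φ : L2Formula} : IsBounded φ → IsBounded (neg φ)
  | and {φ ψ : L2Formula} : IsBounded φ → IsBounded ψ → IsBounded (and φ ψ)
  | or {φ ψ : L2Formula} : IsBounded φ → IsBounded ψ → IsBounded (or φ ψ)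
  | imp {φ ψ : L2Formula} : IsBounded φ → IsBounded ψ → IsBounded (imp φ ψ)
  | ball (t : L2Term) {φ : L2Formula} : IsBounded φ →
      IsBounded (allNum (imp (lt (.var 0) t.lift) φ))
  | bex (t : L2Term) {φ : L2Formula} : IsBounded φ →
      IsBounded (exNum (and (lt (.var 0) t.lift) φ))

/-- `Σ⁰₁` formulas: `∃ n θ` with `θ` bounded. -/
def IsSigma1 (φ : L2Formula) : Prop := ∃ θ : L2Formula, θ.IsBounded ∧ φ = exNum θ

/-- `Π⁰₁` formulas: `∀ n θ` with `θ` bounded. -/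
def IsPi1 (φ : L2Formula) : Prop := ∃ θ : L2Formula, θ.IsBounded ∧ φ = allNum θ

end L2Formula

/-- Extend an assignment: variable `0` gets the value `a`, the others are shifted. -/
def assignCons {α : Type u} (a : α) (v : ℕ → α) : ℕ → α
  | 0 => a
  | i + 1 => v i

namespace L2Structure

instance (M : L2Structure.{u}) : Zero M.Num := ⟨M.zero⟩
instance (M : L2Structure.{u}) : One M.Num := ⟨M.one⟩
instance (M : L2Structure.{u}) : Add M.Num := ⟨M.add⟩
instance (M : L2Structure.{u}) : Mul M.Num := ⟨M.mul⟩
instance (M : L2Structure.{u}) : LT M.Num := ⟨M.lt⟩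
instance (M : L2Structure.{u}) : LE M.Num := ⟨fun m n => m < n ∨ m = n⟩

/-- The value of a term. -/
def termVal (M : L2Structure.{u}) (v : ℕ → M.Num) : L2Term → M.Num
  | .var i => v i
  | .zero => 0
  | .one => 1
  | .add s t => M.termVal v s + M.termVal v t
  | .mul s t => M.termVal v s * M.termVal v t

/-- Satisfaction of a formula under an assignment of numbers and of sets of the structure. -/
def Sat (M : L2Structure.{u}) : L2Formula → (ℕ → M.Num) → (ℕ → M.sets) → Prop
  | .eq s t, v, _ => M.termVal v s = M.termVal v t
  | .lt s t, v, _ => M.termVal v s < M.termVal v t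
  | .mem t X, v, V => M.termVal v t ∈ (V X).1
  | .neg φ, v, V => ¬ M.Sat φ v V
  | .and φ ψ, v, V => M.Sat φ v V ∧ M.Sat ψ v V
  | .or φ ψ, v, V => M.Sat φ v V ∨ M.Sat ψ v V
  | .imp φ ψ, v, V => M.Sat φ v V → M.Sat ψ v V
  | .allNum φ, v, V => ∀ n : M.Num, M.Sat φ (assignCons n v) V
  | .exNum φ, v, V => ∃ n : M.Num, M.Sat φ (assignCons n v) V
  | .allSet φ, v, V => ∀ X : M.sets, M.Sat φ v (assignCons X V)
  | .exSet φ, v, V => ∃ X : M.sets, M.Sat φ v (assignCons X V)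

/-! ### The systems `RCA₀` and `ACA₀` -/

variable (M : L2Structure.{u})

/-- `M` is a model of `RCA₀`: the basic axioms of arithmetic, `Σ⁰₁` induction, and `Δ⁰₁`
comprehension. In both schemes the distinguished variable is number variable `0`, and all other
free variables are parameters. -/
structure ModelsRCA0 : Prop where
  succ_ne_zero : ∀ n : M.Num, n + 1 ≠ 0
  succ_inj : ∀ m n : M.Num, m + 1 = n + 1 → m = n
  add_zero : ∀ m : M.Num, m + 0 = m
  add_succ : ∀ m n : M.Num, m + (n + 1) = (m + n) + 1
  mul_zero : ∀ m : M.Num, m * 0 = 0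
  mul_succ : ∀ m n : M.Num, m * (n + 1) = m * n + m
  not_lt_zero : ∀ m : M.Num, ¬ m < 0
  lt_succ : ∀ m n : M.Num, m < n + 1 ↔ (m < n ∨ m = n)
  sigma1_induction : ∀ φ : L2Formula, φ.IsSigma1 → ∀ (v : ℕ → M.Num) (V : ℕ → M.sets),
    M.Sat φ (assignCons 0 v) V →
    (∀ n : M.Num, M.Sat φ (assignCons n v) V → M.Sat φ (assignCons (n + 1) v) V) →
    ∀ n : M.Num, M.Sat φ (assignCons n v) V
  delta1_comprehension : ∀ φ ψ : L2Formula, φ.IsSigma1 → ψ.IsPi1 →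
    ∀ (v : ℕ → M.Num) (V : ℕ → M.sets),
    (∀ n : M.Num, M.Sat φ (assignCons n v) V ↔ M.Sat ψ (assignCons n v) V) →
    ∃ X ∈ M.sets, ∀ n : M.Num, n ∈ X ↔ M.Sat φ (assignCons n v) V

/-- `M` is a model of `ACA₀`: `RCA₀` and comprehension for arithmetical formulas. -/
structure ModelsACA0 : Prop where
  rca0 : M.ModelsRCA0
  arithmetical_comprehension : ∀ φ : L2Formula, φ.IsArithmetical →
    ∀ (v : ℕ → M.Num) (V : ℕ → M.sets),
    ∃ X ∈ M.sets, ∀ n : M.Num, n ∈ X ↔ M.Sat φ (assignCons n v) V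

/-! ### Analysis inside a structure

Everything below is the interpretation in `M` of a notion expressible in the language of
second-order arithmetic: quantifiers range only over numbers of `M`, over triples of numbers of
`M` (fractions), and over the sets in `M.sets`. -/

variable {M}

/-- The pairing function `(m, n) := (m + n)² + m`. -/
def pair (m n : M.Num) : M.Num := (m + n) * (m + n) + m

/-- `f` is (the graph of) a total function from numbers to numbers. -/
def IsFun (f : Set M.Num) : Prop :=
  (∀ z ∈ f, ∃ n m : M.Num, z = pair n m) ∧ ∀ n : M.Num, ∃! m : M.Num, pair n m ∈ f

/-- `y = 2 ^ k`, by primitive recursion: some function `f` of the structure has `f 0 = 1`,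
`f (n + 1) = f n + f n` and `f k = y`. -/
def IsPow2 (k y : M.Num) : Prop :=
  ∃ f ∈ M.sets, IsFun f ∧ pair 0 1 ∈ f ∧
    (∀ n m : M.Num, pair n m ∈ f → pair (n + 1) (m + m) ∈ f) ∧ pair k y ∈ f

/-- The number `2 ^ k` (in models of `RCA₀` there is exactly one `y` with `IsPow2 k y`). -/
noncomputable def pow2 (k : M.Num) : M.Num :=
  @Classical.epsilon M.Num ⟨M.zero⟩ fun y => IsPow2 k y

variable (M) in
/-- Three numbers of `M` standing for the rational number `(pos - neg) / den`. -/
@[ext] structure Fraction where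
  pos : M.Num
  neg : M.Num
  den : M.Num

namespace Fraction

/-- The denominator is not zero, so that the fraction is a rational number. -/
def IsRat (q : M.Fraction) : Prop := 0 < q.den

/-- The number coding a fraction. -/
def code (q : M.Fraction) : M.Num := pair (pair q.pos q.neg) q.den

/-- The natural number `n` as a rational. -/
def ofNum (n : M.Num) : M.Fraction := ⟨n, 0, 1⟩

instance : Add M.Fraction :=
  ⟨fun q r => ⟨q.pos * r.den + r.pos * q.den, q.neg * r.den + r.neg * q.den, q.den * r.den⟩⟩

instance : Sub M.Fraction :=
  ⟨fun q r => ⟨q.pos * r.den + r.neg * q.den, q.neg * r.den + r.pos * q.den, q.den * r.den⟩⟩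

instance : Mul M.Fraction :=
  ⟨fun q r => ⟨q.pos * r.pos + q.neg * r.neg, q.pos * r.neg + q.neg * r.pos, q.den * r.den⟩⟩

/-- The order of the rationals, by cross-multiplication. -/
instance : LE M.Fraction :=
  ⟨fun q r => q.pos * r.den + r.neg * q.den ≤ r.pos * q.den + q.neg * r.den⟩

/-- The absolute value. -/
noncomputable def abs (q : M.Fraction) : M.Fraction :=
  open Classical in if q.pos < q.neg then ⟨q.neg, q.pos, q.den⟩ else q

/-- `2 ^ (-k)`. -/
noncomputable def twoNeg (k : M.Num) : M.Fraction := ⟨1, 0, pow2 k⟩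

/-- `2 ^ (-k + 1)`. -/
noncomputable def twoNegSucc (k : M.Num) : M.Fraction := ⟨1 + 1, 0, pow2 k⟩

end Fraction

variable (M) in
/-- A (definable) sequence of rationals `⟨q k⟩` that presents a real number, given as the relation
`q k = r`. A real is a sequence with `|q k - q (k + i)| ≤ 2 ^ (-k)` for all `k`, `i`. -/
abbrev Presentation := M.Num → M.Fraction → Prop

namespace Presentation

/-- A rational as a real: the constant sequence. -/
def const (q : M.Fraction) : M.Presentation := fun _ p => p = q

/-- `⟨q k⟩ + ⟨r k⟩ = ⟨q (k + 1) + r (k + 1)⟩`. -/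
def add (α β : M.Presentation) : M.Presentation := fun k p =>
  ∃ q r : M.Fraction, α (k + 1) q ∧ β (k + 1) r ∧ p = q + r

/-- `⟨q k⟩ - ⟨r k⟩ = ⟨q (k + 1) - r (k + 1)⟩`. -/
def sub (α β : M.Presentation) : M.Presentation := fun k p =>
  ∃ q r : M.Fraction, α (k + 1) q ∧ β (k + 1) r ∧ p = q - r

/-- `⟨q k⟩ · ⟨r k⟩ = ⟨q (n + k) · r (n + k)⟩`, where `n` is least such that
`|q 0| + |r 0| + 2 ≤ 2 ^ n`. -/
def mul (α β : M.Presentation) : M.Presentation := fun k p =>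
  ∃ (q₀ r₀ : M.Fraction) (n : M.Num), α 0 q₀ ∧ β 0 r₀ ∧
    q₀.abs + r₀.abs + Fraction.ofNum (1 + 1) ≤ Fraction.ofNum (pow2 n) ∧
    (∀ m : M.Num, m < n →
      ¬ q₀.abs + r₀.abs + Fraction.ofNum (1 + 1) ≤ Fraction.ofNum (pow2 m)) ∧
    ∃ q r : M.Fraction, α (n + k) q ∧ β (n + k) r ∧ p = q * r

/-- `|⟨q k⟩| = ⟨|q k|⟩`. -/
def abs (α : M.Presentation) : M.Presentation := fun k p =>
  ∃ q : M.Fraction, α k q ∧ p = q.abs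

/-- `⟨q k⟩ ≤ ⟨r k⟩` as reals: `q k ≤ r k + 2 ^ (-k + 1)` for all `k`. -/
def le (α β : M.Presentation) : Prop :=
  ∀ (k : M.Num) (q r : M.Fraction), α k q → β k r → q ≤ r + Fraction.twoNegSucc k

/-- Strict order of the reals. -/
def lt (α β : M.Presentation) : Prop := ¬ le β α

/-- Equality of reals. -/
def equal (α β : M.Presentation) : Prop := le α β ∧ le β α

end Presentation

/-- The `n`-th term of a sequence of reals: `x` is the graph of a function sending a pair `(n, k)`
to the (code of the) `k`-th rational approximation of the `n`-th real. -/
def term (x : Set M.Num) (n : M.Num) : M.Presentation :=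
  fun k q => q.IsRat ∧ pair (pair n k) q.code ∈ x

/-- `x` codes a sequence of real numbers. -/
def IsRealSeq (x : Set M.Num) : Prop :=
  (∀ z ∈ x, ∃ (n k : M.Num) (q : M.Fraction), q.IsRat ∧ z = pair (pair n k) q.code) ∧
  (∀ n k : M.Num, ∃! q : M.Fraction, term x n k q) ∧
  ∀ (n k i : M.Num) (q r : M.Fraction), term x n k q → term x n (k + i) r →
    (q - r).abs ≤ Fraction.twoNeg k

/-- `y` codes a sequence of positive rational numbers. -/
def IsPosRatSeq (y : Set M.Num) : Prop :=
  IsFun y ∧ ∀ n m : M.Num, pair n m ∈ y →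
    ∃ q : M.Fraction, q.IsRat ∧ q.neg < q.pos ∧ m = q.code

/-- The sequence of reals `x` is the sequence of rationals `y`, each rational being regarded as a
real (a constant sequence of rationals). -/
def IsRatSeqAsReal (y x : Set M.Num) : Prop :=
  ∀ (n k : M.Num) (q : M.Fraction), term x n k q ↔ q.IsRat ∧ pair n q.code ∈ y

/-- The sequence of reals `a` is the sequence `⟨n + 1⟩`. -/
def IsSuccSeq (a : Set M.Num) : Prop :=
  ∀ (n k : M.Num) (q : M.Fraction), term a n k q ↔ q = Fraction.ofNum (n + 1)

/-- `s n = ∑ i ≤ n, x i` for all `n`. -/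
def IsPartialSums (x s : Set M.Num) : Prop :=
  (term s 0).equal (term x 0) ∧
  ∀ n : M.Num, (term s (n + 1)).equal ((term s n).add (term x (n + 1)))

/-- `t n = ∑ i ≤ n, a i * x i` for all `n`. -/
def IsWeightedSums (a x t : Set M.Num) : Prop :=
  (term t 0).equal ((term a 0).mul (term x 0)) ∧
  ∀ n : M.Num,
    (term t (n + 1)).equal ((term t n).add ((term a (n + 1)).mul (term x (n + 1))))

/-- `u n = (1 / a n) * ∑ i ≤ n, a i * x i` for all `n` (where all `a n` are positive):
`a n * u n` is the weighted sum. -/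
def IsWeightedMeans (a x u : Set M.Num) : Prop :=
  ∃ t ∈ M.sets, IsRealSeq t ∧ IsWeightedSums a x t ∧
    ∀ n : M.Num, ((term a n).mul (term u n)).equal (term t n)

/-- The sequence of reals `s` is Cauchy. -/
def IsCauchySeq (s : Set M.Num) : Prop :=
  ∀ k : M.Num, ∃ N : M.Num, ∀ m n : M.Num, N ≤ m → N ≤ n →
    ((term s m).sub (term s n)).abs.le (.const (Fraction.twoNeg k))

/-- The sequence of reals `u` converges to zero. -/
def ConvergesToZero (u : Set M.Num) : Prop :=
  ∀ k : M.Num, ∃ N : M.Num, ∀ n : M.Num, N ≤ n →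
    (term u n).abs.le (.const (Fraction.twoNeg k))

/-- The function `g` is a rate of convergence to zero for `u`:
`|u n| ≤ 2 ^ (-k)` whenever `g k ≤ n`. -/
def IsRateToZero (g u : Set M.Num) : Prop :=
  ∀ k m n : M.Num, pair k m ∈ g → m ≤ n →
    (term u n).abs.le (.const (Fraction.twoNeg k))

/-- The premise of Kronecker's lemma: `0 < a n ≤ a (n + 1)` for all `n`, `a` is unbounded, and the
partial sums of `x` form a Cauchy sequence. -/
def KronPremise (a x : Set M.Num) : Prop :=
  (∀ n : M.Num, (Presentation.const (Fraction.ofNum 0)).lt (term a n) ∧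
    (term a n).le (term a (n + 1))) ∧
  (∀ m : M.Num, ∃ k : M.Num, (Presentation.const (Fraction.ofNum m)).le (term a k)) ∧
  ∃ s ∈ M.sets, IsRealSeq s ∧ IsPartialSums x s ∧ IsCauchySeq s

/-- `KRON(a, x)`. -/
def KRON (a x : Set M.Num) : Prop :=
  KronPremise a x →
    ∃ u ∈ M.sets, IsRealSeq u ∧ IsWeightedMeans a x u ∧ ConvergesToZero u

/-- `RKRON(a, x)`. -/
def RKRON (a x : Set M.Num) : Prop :=
  KronPremise a x →
    ∃ u ∈ M.sets, IsRealSeq u ∧ IsWeightedMeans a x u ∧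
      ∃ g ∈ M.sets, IsFun g ∧ IsRateToZero g u

variable (M)

/-- `M` satisfies: `KRON(a, x)` for all sequences of reals `a` and `x`. -/
def SatKRON : Prop :=
  ∀ a ∈ M.sets, ∀ x ∈ M.sets, IsRealSeq a → IsRealSeq x → KRON a x

/-- `M` satisfies: `RKRON(a, x)` for all sequences of reals `a` and `x`. -/
def SatRKRON : Prop :=
  ∀ a ∈ M.sets, ∀ x ∈ M.sets, IsRealSeq a → IsRealSeq x → RKRON a x

/-- `M` satisfies: `RKRON(⟨n + 1⟩, y)` for all sequences of positive rationals `y`. -/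
def SatRKRONPosRat : Prop :=
  ∀ y ∈ M.sets, IsPosRatSeq y →
    ∀ a ∈ M.sets, ∀ x ∈ M.sets, IsRealSeq a → IsRealSeq x →
      IsSuccSeq a → IsRatSeqAsReal y x → RKRON a x

end L2Structure

/-! ### Renaming of variables -/

namespace L2Term

/-- Rename the variables of a term. -/
def rename (f : ℕ → ℕ) : L2Term → L2Term
  | .var i => .var (f i)
  | .zero => .zero
  | .one => .one
  | .add s t => .add (s.rename f) (t.rename f)
  | .mul s t => .mul (s.rename f) (t.rename f)

/-- Extend a renaming under a binder. -/
def up (f : ℕ → ℕ) : ℕ → ℕ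
  | 0 => 0
  | i + 1 => f i + 1

/-- Keeps the bound of a bounded quantifier free of the quantified variable, which is why bounded
formulas stay bounded under renaming. -/
theorem rename_lift (f : ℕ → ℕ) (t : L2Term) : t.lift.rename (up f) = (t.rename f).lift := by
  induction t <;> simp_all [lift, rename, up]

/-- A term has finitely many variables. -/
theorem exists_bound (M : L2Structure.{u}) (t : L2Term) :
    ∃ k, ∀ v w : ℕ → M.Num, (∀ i < k, v i = w i) → M.termVal v t = M.termVal w t := by
  induction t with
  | var i => exact ⟨i + 1, fun v w h => h i (Nat.lt_succ_self i)⟩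
  | zero => exact ⟨0, fun _ _ _ => rfl⟩
  | one => exact ⟨0, fun _ _ _ => rfl⟩
  | add s t hs ht =>
    obtain ⟨k, hk⟩ := hs
    obtain ⟨l, hl⟩ := ht
    refine ⟨max k l, fun v w h => ?_⟩
    simp only [L2Structure.termVal]
    rw [hk v w fun i hi => h i (lt_max_of_lt_left hi), hl v w fun i hi => h i (lt_max_of_lt_right hi)]
  | mul s t hs ht =>
    obtain ⟨k, hk⟩ := hs
    obtain ⟨l, hl⟩ := ht
    refine ⟨max k l, fun v w h => ?_⟩
    simp only [L2Structure.termVal]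
    rw [hk v w fun i hi => h i (lt_max_of_lt_left hi), hl v w fun i hi => h i (lt_max_of_lt_right hi)]

end L2Term

namespace L2Formula

/-- Rename the free variables of a formula. -/
def rename : (ℕ → ℕ) → (ℕ → ℕ) → L2Formula → L2Formula
  | f, _, .eq s t => .eq (s.rename f) (t.rename f)
  | f, _, .lt s t => .lt (s.rename f) (t.rename f)
  | f, g, .mem t X => .mem (t.rename f) (g X)
  | f, g, .neg φ => .neg (φ.rename f g)
  | f, g, .and φ ψ => .and (φ.rename f g) (ψ.rename f g)
  | f, g, .or φ ψ => .or (φ.rename f g) (ψ.rename f g)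
  | f, g, .imp φ ψ => .imp (φ.rename f g) (ψ.rename f g)
  | f, g, .allNum φ => .allNum (φ.rename (L2Term.up f) g)
  | f, g, .exNum φ => .exNum (φ.rename (L2Term.up f) g)
  | f, g, .allSet φ => .allSet (φ.rename f (L2Term.up g))
  | f, g, .exSet φ => .exSet (φ.rename f (L2Term.up g))

theorem IsBounded.rename {φ : L2Formula} (h : φ.IsBounded) (f g : ℕ → ℕ) :
    (φ.rename f g).IsBounded := by
  induction h generalizing f with
  | eq s t => exact .eq _ _
  | lt s t => exact .lt _ _
  | mem t X => exact .mem _ _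
  | neg _ ih => exact .neg (ih f)
  | and _ _ ih₁ ih₂ => exact .and (ih₁ f) (ih₂ f)
  | or _ _ ih₁ ih₂ => exact .or (ih₁ f) (ih₂ f)
  | imp _ _ ih₁ ih₂ => exact .imp (ih₁ f) (ih₂ f)
  | ball t _ ih =>
    simp only [L2Formula.rename, L2Term.rename_lift]
    exact .ball _ (ih _)
  | bex t _ ih =>
    simp only [L2Formula.rename, L2Term.rename_lift]
    exact .bex _ (ih _)

theorem IsBounded.isArithmetical {φ : L2Formula} (h : φ.IsBounded) : φ.IsArithmetical := by
  induction h <;> simp_all [IsArithmetical]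

end L2Formula

theorem assignCons_comp_up {α : Type u} (a : α) (v : ℕ → α) (f : ℕ → ℕ) :
    assignCons a v ∘ L2Term.up f = assignCons a (v ∘ f) := by
  funext i
  cases i <;> rfl

namespace L2Structure

variable {M : L2Structure.{u}}

theorem termVal_rename (f : ℕ → ℕ) (t : L2Term) (v : ℕ → M.Num) :
    M.termVal v (t.rename f) = M.termVal (v ∘ f) t := by
  induction t <;> simp_all [termVal, L2Term.rename]

theorem termVal_lift (t : L2Term) (n : M.Num) (v : ℕ → M.Num) :
    M.termVal (assignCons n v) t.lift = M.termVal v t := by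
  induction t <;> simp_all [termVal, L2Term.lift, assignCons]

theorem sat_rename (φ : L2Formula) (f g : ℕ → ℕ) (v : ℕ → M.Num) (V : ℕ → M.sets) :
    M.Sat (φ.rename f g) v V ↔ M.Sat φ (v ∘ f) (V ∘ g) := by
  induction φ generalizing f g v V <;>
    simp_all [Sat, L2Formula.rename, termVal_rename, assignCons_comp_up]

/-- The value of a formula depends on finitely many number variables. -/
theorem sat_exists_bound (φ : L2Formula) :
    ∃ k, ∀ (v w : ℕ → M.Num) (V : ℕ → M.sets), (∀ i < k, v i = w i) →
      (M.Sat φ v V ↔ M.Sat φ w V) := by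
  have quant : ∀ (k : ℕ) (v w : ℕ → M.Num), (∀ i < k, v i = w i) → ∀ n : M.Num, ∀ i < k,
      assignCons n v i = assignCons n w i := by
    rintro k v w h n (_ | i) hi
    · rfl
    · exact h i (by omega)
  induction φ with
  | eq s t =>
    obtain ⟨k, hk⟩ := s.exists_bound M
    obtain ⟨l, hl⟩ := t.exists_bound M
    refine ⟨max k l, fun v w V h => ?_⟩
    simp only [Sat]
    rw [hk v w fun i hi => h i (lt_max_of_lt_left hi), hl v w fun i hi => h i (lt_max_of_lt_right hi)]
  | lt s t =>
    obtain ⟨k, hk⟩ := s.exists_bound M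
    obtain ⟨l, hl⟩ := t.exists_bound M
    refine ⟨max k l, fun v w V h => ?_⟩
    simp only [Sat]
    rw [hk v w fun i hi => h i (lt_max_of_lt_left hi), hl v w fun i hi => h i (lt_max_of_lt_right hi)]
  | mem t X =>
    obtain ⟨k, hk⟩ := t.exists_bound M
    refine ⟨k, fun v w V h => ?_⟩
    simp only [Sat]
    rw [hk v w h]
  | neg φ ih =>
    obtain ⟨k, hk⟩ := ih
    exact ⟨k, fun v w V h => not_congr (hk v w V h)⟩
  | and φ ψ ih₁ ih₂ =>
    obtain ⟨k, hk⟩ := ih₁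
    obtain ⟨l, hl⟩ := ih₂
    exact ⟨max k l, fun v w V h => and_congr (hk v w V fun i hi => h i (lt_max_of_lt_left hi))
      (hl v w V fun i hi => h i (lt_max_of_lt_right hi))⟩
  | or φ ψ ih₁ ih₂ =>
    obtain ⟨k, hk⟩ := ih₁
    obtain ⟨l, hl⟩ := ih₂
    exact ⟨max k l, fun v w V h => or_congr (hk v w V fun i hi => h i (lt_max_of_lt_left hi))
      (hl v w V fun i hi => h i (lt_max_of_lt_right hi))⟩
  | imp φ ψ ih₁ ih₂ =>
    obtain ⟨k, hk⟩ := ih₁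
    obtain ⟨l, hl⟩ := ih₂
    exact ⟨max k l, fun v w V h => imp_congr (hk v w V fun i hi => h i (lt_max_of_lt_left hi))
      (hl v w V fun i hi => h i (lt_max_of_lt_right hi))⟩
  | allNum φ ih =>
    obtain ⟨k, hk⟩ := ih
    exact ⟨k, fun v w V h => forall_congr' fun n => hk _ _ V (quant k v w h n)⟩
  | exNum φ ih =>
    obtain ⟨k, hk⟩ := ih
    exact ⟨k, fun v w V h => exists_congr fun n => hk _ _ V (quant k v w h n)⟩
  | allSet φ ih =>
    obtain ⟨k, hk⟩ := ih
    exact ⟨k, fun v w V h => forall_congr' fun X => hk v w _ h⟩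
  | exSet φ ih =>
    obtain ⟨k, hk⟩ := ih
    exact ⟨k, fun v w V h => exists_congr fun X => hk v w _ h⟩

/-! ### Definability by bounded formulas with parameters -/

/-- The assignment in which variable `i` gets the value of a variable or of a parameter. -/
def subst (ρ : ℕ → ℕ ⊕ M.Num) (v : ℕ → M.Num) : ℕ → M.Num := fun i => Sum.elim v id (ρ i)

/-- Interleave two sequences. -/
def interleave {α : Type*} (a b : ℕ → α) (i : ℕ) : α := if i % 2 = 0 then a (i / 2) else b (i / 2)

theorem interleave_comp_even {α : Type*} (a b : ℕ → α) : interleave a b ∘ (fun i => 2 * i) = a := by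
  funext i
  simp [interleave]

theorem interleave_comp_odd {α : Type*} (a b : ℕ → α) :
    interleave a b ∘ (fun i => 2 * i + 1) = b := by
  funext i
  simp [interleave, Nat.add_mod, show (2 * i + 1) / 2 = i by omega]

theorem subst_comp (ρ : ℕ → ℕ ⊕ M.Num) (v : ℕ → M.Num) (f : ℕ → ℕ) :
    subst ρ v ∘ f = subst (ρ ∘ f) v := rfl

/-- `t` is given by a term with parameters. -/
class IsPoly (t : (ℕ → M.Num) → M.Num) : Prop where
  out : ∃ (τ : L2Term) (ρ : ℕ → ℕ ⊕ M.Num), ∀ v, t v = M.termVal (subst ρ v) τ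

/-- Two terms share one assignment once the variables of the first are moved to the even indices and
those of the second to the odd ones. -/
theorem IsPoly.merge (s t : (ℕ → M.Num) → M.Num) [hs : IsPoly s] [ht : IsPoly t] :
    ∃ (σ τ : L2Term) (ρ : ℕ → ℕ ⊕ M.Num),
      (∀ v, s v = M.termVal (subst ρ v) σ) ∧ ∀ v, t v = M.termVal (subst ρ v) τ := by
  obtain ⟨σ, ρ₁, h₁⟩ := hs.out
  obtain ⟨τ, ρ₂, h₂⟩ := ht.out
  refine ⟨σ.rename (fun i => 2 * i), τ.rename (fun i => 2 * i + 1), interleave ρ₁ ρ₂,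
    fun v => ?_, fun v => ?_⟩
  · rw [h₁, termVal_rename, subst_comp, interleave_comp_even]
  · rw [h₂, termVal_rename, subst_comp, interleave_comp_odd]

instance IsPoly.var (i : ℕ) : IsPoly fun v : ℕ → M.Num => v i :=
  ⟨.var 0, fun _ => .inl i, fun _ => rfl⟩

instance (priority := low) IsPoly.const (c : M.Num) : IsPoly fun _ : ℕ → M.Num => c :=
  ⟨.var 0, fun _ => .inr c, fun _ => rfl⟩

instance IsPoly.add (s t : (ℕ → M.Num) → M.Num) [IsPoly s] [IsPoly t] :
    IsPoly fun v => s v + t v := by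
  obtain ⟨σ, τ, ρ, h₁, h₂⟩ := IsPoly.merge s t
  exact ⟨.add σ τ, ρ, fun v => by rw [h₁, h₂]; rfl⟩

instance IsPoly.mul (s t : (ℕ → M.Num) → M.Num) [IsPoly s] [IsPoly t] :
    IsPoly fun v => s v * t v := by
  obtain ⟨σ, τ, ρ, h₁, h₂⟩ := IsPoly.merge s t
  exact ⟨.mul σ τ, ρ, fun v => by rw [h₁, h₂]; rfl⟩

/-- `P` is defined by a bounded formula with parameters. -/
class IsBdd (P : (ℕ → M.Num) → Prop) : Prop where
  out : ∃ θ : L2Formula, θ.IsBounded ∧ ∃ (ρ : ℕ → ℕ ⊕ M.Num) (V : ℕ → M.sets),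
    ∀ v, P v ↔ M.Sat θ (subst ρ v) V

theorem IsBdd.congr {P Q : (ℕ → M.Num) → Prop} (hP : IsBdd P) (h : ∀ v, Q v ↔ P v) : IsBdd Q :=
  (funext fun v => propext (h v) : Q = P) ▸ hP

theorem IsBdd.merge (P Q : (ℕ → M.Num) → Prop) [hP : IsBdd P] [hQ : IsBdd Q] :
    ∃ θ η : L2Formula, θ.IsBounded ∧ η.IsBounded ∧ ∃ (ρ : ℕ → ℕ ⊕ M.Num) (V : ℕ → M.sets),
      (∀ v, P v ↔ M.Sat θ (subst ρ v) V) ∧ ∀ v, Q v ↔ M.Sat η (subst ρ v) V := by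
  obtain ⟨θ, hθ, ρ₁, V₁, h₁⟩ := hP.out
  obtain ⟨η, hη, ρ₂, V₂, h₂⟩ := hQ.out
  refine ⟨θ.rename (fun i => 2 * i) (fun i => 2 * i),
    η.rename (fun i => 2 * i + 1) (fun i => 2 * i + 1), hθ.rename _ _, hη.rename _ _,
    interleave ρ₁ ρ₂, interleave V₁ V₂, fun v => ?_, fun v => ?_⟩
  · rw [h₁, sat_rename, subst_comp, interleave_comp_even, interleave_comp_even]
  · rw [h₂, sat_rename, subst_comp, interleave_comp_odd, interleave_comp_odd]

instance IsBdd.eq (s t : (ℕ → M.Num) → M.Num) [IsPoly s] [IsPoly t] :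
    IsBdd fun v => s v = t v := by
  obtain ⟨σ, τ, ρ, h₁, h₂⟩ := IsPoly.merge s t
  -- No set variable occurs, so any member of the nonempty second-order part serves as its value.
  exact ⟨.eq σ τ, .eq _ _, ρ, fun _ => ⟨_, M.sets_nonempty.some_mem⟩,
    fun v => by rw [h₁, h₂]; rfl⟩

instance IsBdd.lt (s t : (ℕ → M.Num) → M.Num) [IsPoly s] [IsPoly t] :
    IsBdd fun v => s v < t v := by
  obtain ⟨σ, τ, ρ, h₁, h₂⟩ := IsPoly.merge s t
  exact ⟨.lt σ τ, .lt _ _, ρ, fun _ => ⟨_, M.sets_nonempty.some_mem⟩,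
    fun v => by rw [h₁, h₂]; rfl⟩

instance IsBdd.mem (t : (ℕ → M.Num) → M.Num) [ht : IsPoly t] (X : M.sets) :
    IsBdd fun v => t v ∈ X.1 := by
  obtain ⟨τ, ρ, h⟩ := ht.out
  exact ⟨.mem τ 0, .mem _ _, ρ, fun _ => X, fun v => by rw [h]; rfl⟩

instance IsBdd.not (P : (ℕ → M.Num) → Prop) [hP : IsBdd P] : IsBdd fun v => ¬ P v := by
  obtain ⟨θ, hθ, ρ, V, h⟩ := hP.out
  exact ⟨.neg θ, .neg hθ, ρ, V, fun v => not_congr (h v)⟩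

instance IsBdd.and (P Q : (ℕ → M.Num) → Prop) [IsBdd P] [IsBdd Q] : IsBdd fun v => P v ∧ Q v := by
  obtain ⟨θ, η, hθ, hη, ρ, V, h₁, h₂⟩ := IsBdd.merge P Q
  exact ⟨.and θ η, .and hθ hη, ρ, V, fun v => and_congr (h₁ v) (h₂ v)⟩

instance IsBdd.or (P Q : (ℕ → M.Num) → Prop) [IsBdd P] [IsBdd Q] : IsBdd fun v => P v ∨ Q v := by
  obtain ⟨θ, η, hθ, hη, ρ, V, h₁, h₂⟩ := IsBdd.merge P Q
  exact ⟨.or θ η, .or hθ hη, ρ, V, fun v => or_congr (h₁ v) (h₂ v)⟩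

instance IsBdd.imp (P Q : (ℕ → M.Num) → Prop) [IsBdd P] [IsBdd Q] : IsBdd fun v => P v → Q v := by
  obtain ⟨θ, η, hθ, hη, ρ, V, h₁, h₂⟩ := IsBdd.merge P Q
  exact ⟨.imp θ η, .imp hθ hη, ρ, V, fun v => imp_congr (h₁ v) (h₂ v)⟩

instance IsBdd.le (s t : (ℕ → M.Num) → M.Num) [IsPoly s] [IsPoly t] :
    IsBdd fun v => s v ≤ t v :=
  inferInstanceAs (IsBdd fun v => s v < t v ∨ s v = t v)

/-- Variables and parameters may be substituted. -/
theorem IsBdd.substitute {P : (ℕ → M.Num) → Prop} (hP : IsBdd P) (ρ : ℕ → ℕ ⊕ M.Num) :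
    IsBdd fun v => P (subst ρ v) := by
  obtain ⟨θ, hθ, ρ', V, h⟩ := hP.out
  refine ⟨θ, hθ, fun i => Sum.elim ρ .inr (ρ' i), V, fun v => ?_⟩
  rw [h]
  have : subst ρ' (subst ρ v) = subst (fun i => Sum.elim ρ .inr (ρ' i)) v := by
    funext i
    rcases h' : ρ' i <;> simp [subst, h']
  rw [this]

/-- Under a binder, the bound variable and the parameters are renumbered. -/
theorem exists_subst_assignCons (ρ : ℕ → ℕ ⊕ M.Num) :
    ∃ (f : ℕ → ℕ) (ρ' : ℕ → ℕ ⊕ M.Num), ∀ n v,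
      subst ρ (assignCons n v) = assignCons n (subst ρ' v) ∘ f := by
  classical
  -- Indices that `ρ` sends to the bound variable all read position `0`; any other index `i` reads
  -- position `i + 1`, and its target variable drops by one.
  refine ⟨fun i => if ρ i = .inl 0 then 0 else i + 1,
    fun i => Sum.map (fun j => j - 1) id (ρ i), fun n v => funext fun i => ?_⟩
  rcases h : ρ i with (_ | j) | c <;> simp [subst, h, assignCons]

instance IsBdd.ball (t : (ℕ → M.Num) → M.Num) (P : (ℕ → M.Num) → M.Num → Prop) [ht : IsPoly t]
    [hP : IsBdd fun v => P (fun i => v (i + 1)) (v 0)] :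
    IsBdd fun v => ∀ n, n < t v → P v n := by
  obtain ⟨θ, hθ, ρ₁, V, h₁⟩ := hP.out
  obtain ⟨τ, ρ₂, h₂⟩ := ht.out
  obtain ⟨f, ρ', hf⟩ := exists_subst_assignCons ρ₁
  refine ⟨.allNum (.imp (.lt (.var 0) (τ.rename fun i => 2 * i).lift)
    (θ.rename (L2Term.up (fun i => 2 * i + 1) ∘ f) id)), .ball _ (hθ.rename _ _),
    interleave ρ₂ ρ', V, fun v => ?_⟩
  simp only [Sat, termVal_lift, termVal_rename, sat_rename, subst_comp, interleave_comp_even,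
    ← h₂, ← Function.comp_assoc, assignCons_comp_up, interleave_comp_odd, ← hf]
  exact forall_congr' fun n => imp_congr Iff.rfl (h₁ (assignCons n v))

instance IsBdd.bex (t : (ℕ → M.Num) → M.Num) (P : (ℕ → M.Num) → M.Num → Prop) [ht : IsPoly t]
    [hP : IsBdd fun v => P (fun i => v (i + 1)) (v 0)] :
    IsBdd fun v => ∃ n, n < t v ∧ P v n :=
  have h : IsBdd fun v => ¬ ∀ n, n < t v → ¬ P v n := inferInstance
  h.congr fun v => by
    push Not
    rfl

/-! ### Σ⁰₁ relations and the two axiom schemes -/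

/-- `P` is defined by a `Σ⁰₁` formula with parameters. -/
class IsSig (P : (ℕ → M.Num) → Prop) : Prop where
  out : ∃ Q : (ℕ → M.Num) → Prop, IsBdd Q ∧ ∀ v, P v ↔ ∃ n, Q (assignCons n v)

theorem IsSig.congr {P Q : (ℕ → M.Num) → Prop} (hP : IsSig P) (h : ∀ v, Q v ↔ P v) : IsSig Q :=
  (funext fun v => propext (h v) : Q = P) ▸ hP

theorem IsSig.exBdd (P : (ℕ → M.Num) → M.Num → Prop)
    (hP : IsBdd fun v => P (fun i => v (i + 1)) (v 0)) : IsSig fun v => ∃ n, P v n :=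
  ⟨_, hP, fun _ => Iff.rfl⟩

instance (priority := low) IsSig.ofBdd (P : (ℕ → M.Num) → Prop) [hP : IsBdd P] : IsSig P :=
  (IsSig.exBdd (fun v _ => P v) (hP.substitute fun i => .inl (i + 1))).congr fun _ =>
    ⟨fun h => ⟨0, h⟩, fun ⟨_, h⟩ => h⟩

/-- Turns parameters into values of an assignment, the form in which the schemes take them: position
`0` is the witness, position `1` the distinguished variable, and the irrelevant remaining variables
are set to `0`. -/
theorem exists_subst_closed (ρ : ℕ → ℕ ⊕ M.Num) :
    ∃ (f : ℕ → ℕ) (w : ℕ → M.Num), ∀ m n,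
      subst ρ (assignCons m (assignCons n fun _ => 0)) = assignCons m (assignCons n w) ∘ f := by
  classical
  refine ⟨fun i => if ρ i = .inl 0 then 0 else if ρ i = .inl 1 then 1 else i + 2,
    fun i => Sum.elim (fun _ => 0) id (ρ i), fun m n => funext fun i => ?_⟩
  rcases h : ρ i with (_ | _ | j) | c <;> simp [subst, h, assignCons]

variable [hM : Fact M.ModelsRCA0]

/-- `Σ⁰₁` induction. -/
theorem sig_induction (P : M.Num → Prop) [hP : IsSig fun v => P (v 0)] (zero : P 0)
    (succ : ∀ n, P n → P (n + 1)) (n : M.Num) : P n := by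
  obtain ⟨Q, ⟨θ, hθ, ρ, V, h₁⟩, h₂⟩ := hP.out
  obtain ⟨f, w, hf⟩ := exists_subst_closed ρ
  have key : ∀ n, P n ↔ M.Sat (.exNum (θ.rename f id)) (assignCons n w) V := fun n => by
    refine (h₂ (assignCons n fun _ => 0)).trans (exists_congr fun m => ?_)
    rw [h₁, hf, sat_rename]
    rfl
  rw [key]
  apply hM.out.sigma1_induction _ ⟨_, hθ.rename _ _, rfl⟩
  · rwa [← key]
  · intro n hn
    rw [← key] at hn ⊢
    exact succ n hn

/-- `Δ⁰₁` comprehension. -/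
theorem delta_comprehension (P : M.Num → Prop) [hP : IsSig fun v => P (v 0)]
    [hP' : IsSig fun v => ¬ P (v 0)] : {n | P n} ∈ M.sets := by
  obtain ⟨Q, hQ, h₁⟩ := hP.out
  obtain ⟨R, hR, h₂⟩ := hP'.out
  obtain ⟨θ, η, hθ, hη, ρ, V, h₃, h₄⟩ := IsBdd.merge Q R
  obtain ⟨f, w, hf⟩ := exists_subst_closed ρ
  have key₁ : ∀ n, P n ↔ M.Sat (.exNum (θ.rename f id)) (assignCons n w) V := fun n => by
    refine (h₁ (assignCons n fun _ => 0)).trans (exists_congr fun m => ?_)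
    rw [h₃, hf, sat_rename]
    rfl
  -- The Σ⁰₁ definition of the complement, negated, is the Π⁰₁ form that the scheme asks for.
  have key₂ : ∀ n, P n ↔ M.Sat (.allNum (.neg (η.rename f id))) (assignCons n w) V := fun n => by
    rw [← not_iff_not]
    refine (h₂ (assignCons n fun _ => 0)).trans ?_
    simp only [Sat, not_forall, not_not]
    refine exists_congr fun m => ?_
    rw [h₄, hf, sat_rename]
    rfl
  obtain ⟨X, hX, h⟩ := hM.out.delta1_comprehension _ _ ⟨_, hθ.rename f id, rfl⟩
    ⟨_, .neg (hη.rename f id), rfl⟩ w V fun n => (key₁ n).symm.trans (key₂ n)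
  rwa [show {n | P n} = X from Set.ext fun n => (key₁ n).trans (h n).symm]

/-! ### Arithmetic in models of `RCA₀` -/

namespace Num

theorem add_zero' (a : M.Num) : a + 0 = a := hM.out.add_zero a

theorem add_succ' (a b : M.Num) : a + (b + 1) = a + b + 1 := hM.out.add_succ a b

theorem mul_zero' (a : M.Num) : a * 0 = 0 := hM.out.mul_zero a

theorem mul_succ' (a b : M.Num) : a * (b + 1) = a * b + a := hM.out.mul_succ a b

theorem add_assoc' (a b c : M.Num) : a + b + c = a + (b + c) := by
  refine sig_induction (fun c => a + b + c = a + (b + c)) ?_ (fun c hc => ?_) c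
  · simp only [add_zero']
  · simp only [add_succ', hc]

theorem zero_add' (a : M.Num) : 0 + a = a := by
  refine sig_induction (fun a => 0 + a = a) (add_zero' 0) (fun a ha => ?_) a
  simp only [add_succ', ha]

theorem one_add' (a : M.Num) : 1 + a = a + 1 := by
  refine sig_induction (fun a => 1 + a = a + 1) ?_ (fun a ha => ?_) a
  · rw [add_zero', zero_add']
  · simp only [add_succ', ha]

theorem add_comm' (a b : M.Num) : a + b = b + a := by
  refine sig_induction (fun b => a + b = b + a) ?_ (fun b hb => ?_) b
  · rw [add_zero', zero_add']
  · show a + (b + 1) = b + 1 + a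
    rw [add_succ', hb, add_assoc', add_assoc', one_add']

theorem zero_mul' (a : M.Num) : 0 * a = 0 := by
  refine sig_induction (fun a => 0 * a = 0) (mul_zero' 0) (fun a ha => ?_) a
  simp only [mul_succ', ha, add_zero']

theorem mul_add' (a b c : M.Num) : a * (b + c) = a * b + a * c := by
  refine sig_induction (fun c => a * (b + c) = a * b + a * c) ?_ (fun c hc => ?_) c
  · simp only [add_zero', mul_zero']
  · show a * (b + (c + 1)) = a * b + a * (c + 1)
    rw [add_succ', mul_succ', hc, mul_succ', add_assoc']

theorem succ_mul' (a b : M.Num) : (a + 1) * b = a * b + b := by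
  refine sig_induction (fun b => (a + 1) * b = a * b + b) ?_ (fun b hb => ?_) b
  · simp only [mul_zero', add_zero']
  · show (a + 1) * (b + 1) = a * (b + 1) + (b + 1)
    rw [mul_succ', hb, mul_succ', add_assoc', add_assoc', ← add_assoc' b, ← add_assoc' a,
      add_comm' b a]

theorem mul_comm' (a b : M.Num) : a * b = b * a := by
  refine sig_induction (fun b => a * b = b * a) ?_ (fun b hb => ?_) b
  · rw [mul_zero', zero_mul']
  · show a * (b + 1) = (b + 1) * a
    rw [mul_succ', hb, succ_mul']

theorem mul_assoc' (a b c : M.Num) : a * b * c = a * (b * c) := by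
  refine sig_induction (fun c => a * b * c = a * (b * c)) ?_ (fun c hc => ?_) c
  · simp only [mul_zero']
  · show a * b * (c + 1) = a * (b * (c + 1))
    rw [mul_succ', hc, mul_succ', mul_add']

theorem mul_one' (a : M.Num) : a * 1 = a := by
  rw [← zero_add' (1 : M.Num), mul_succ', mul_zero', zero_add']

theorem lt_succ' {a b : M.Num} : a < b + 1 ↔ a ≤ b := hM.out.lt_succ a b

theorem lt_succ_self' (a : M.Num) : a < a + 1 := lt_succ'.2 (.inr rfl)

theorem not_lt_zero' (a : M.Num) : ¬ a < 0 := hM.out.not_lt_zero a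

theorem lt_trans' {a b c : M.Num} (hab : a < b) : b < c → a < c := by
  refine sig_induction (fun c => b < c → a < c) (fun h => (not_lt_zero' _ h).elim)
    (fun c hc h => lt_succ'.2 (.inl ?_)) c
  rcases lt_succ'.1 h with h | rfl
  exacts [hc h, hab]

theorem lt_irrefl' (a : M.Num) : ¬ a < a := by
  refine sig_induction (fun a => ¬ a < a) (not_lt_zero' _) (fun a ha h => ha ?_) a
  rcases lt_succ'.1 h with h | h
  · exact lt_trans' (lt_succ_self' a) h
  · nth_rewrite 2 [← h]
    exact lt_succ_self' a

theorem zero_le' (a : M.Num) : 0 ≤ a := by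
  refine sig_induction (fun a => 0 ≤ a) (.inr rfl) (fun a ha => .inl (lt_succ'.2 ha)) a

theorem succ_le' {a b : M.Num} : a < b → a + 1 ≤ b := by
  refine sig_induction (fun b => a < b → a + 1 ≤ b) (fun h => (not_lt_zero' _ h).elim)
    (fun b hb h => ?_) b
  rcases lt_succ'.1 h with h | rfl
  · exact .inl (lt_succ'.2 (hb h))
  · exact .inr rfl

theorem le_total' (a b : M.Num) : a ≤ b ∨ b ≤ a := by
  refine sig_induction (fun a => a ≤ b ∨ b ≤ a) (.inl (zero_le' b)) (fun a ha => ?_) a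
  rcases ha with (h | rfl) | h
  · exact .inl (succ_le' h)
  · exact .inr (.inl (lt_succ_self' _))
  · exact .inr (.inl (lt_succ'.2 h))

theorem le_trans' {a b c : M.Num} (hab : a ≤ b) (hbc : b ≤ c) : a ≤ c := by
  rcases hab with hab | rfl
  · rcases hbc with hbc | rfl
    exacts [.inl (lt_trans' hab hbc), .inl hab]
  · exact hbc

theorem le_antisymm' {a b : M.Num} (hab : a ≤ b) (hba : b ≤ a) : a = b := by
  rcases hab with hab | rfl
  · rcases hba with hba | rfl
    exacts [(lt_irrefl' _ (lt_trans' hab hba)).elim, rfl]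
  · rfl

theorem lt_iff' {a b : M.Num} : a < b ↔ a ≤ b ∧ ¬ b ≤ a := by
  refine ⟨fun h => ⟨.inl h, fun h' => ?_⟩, fun ⟨h, h'⟩ => ?_⟩
  · rcases h' with h' | rfl
    exacts [lt_irrefl' _ (lt_trans' h h'), lt_irrefl' _ h]
  · rcases h with h | rfl
    exacts [h, (h' (.inr rfl)).elim]

theorem add_lt_add_right' {a b : M.Num} (h : a < b) (c : M.Num) : a + c < b + c := by
  refine sig_induction (fun c => a + c < b + c) ?_ (fun c hc => ?_) c
  · simpa only [add_zero'] using h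
  · simp only [add_succ']
    rcases succ_le' hc with h | h
    · exact lt_trans' h (lt_succ_self' _)
    · rw [h]
      exact lt_succ_self' _

/-- The case `b < a` stands under the quantifier so that the induction formula is literally one
existential quantifier before a bounded relation. -/
theorem exists_add' (a b : M.Num) : ∃ c, b < a ∨ b = a + c := by
  have : IsSig fun v : ℕ → M.Num => ∃ c, v 0 < a ∨ v 0 = a + c :=
    IsSig.exBdd (fun v c => v 0 < a ∨ v 0 = a + c) inferInstance
  refine sig_induction (fun b => ∃ c, b < a ∨ b = a + c) ?_ (fun b hb => ?_) b
  · rcases zero_le' a with h | h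
    · exact ⟨0, .inl h⟩
    · exact ⟨0, .inr (by rw [← h, add_zero'])⟩
  · obtain ⟨c, h | h⟩ := hb
    · rcases succ_le' h with h | h
      · exact ⟨0, .inl h⟩
      · exact ⟨0, .inr (by rw [h, add_zero'])⟩
    · exact ⟨c + 1, .inr (by rw [h, add_succ'])⟩

theorem pos_of_ne_zero {a : M.Num} (h : a ≠ 0) : 0 < a := by
  rcases zero_le' a with h' | h'
  exacts [h', (h h'.symm).elim]

theorem mul_pos' {a b : M.Num} (ha : 0 < a) (hb : 0 < b) : 0 < a * b := by
  obtain ⟨c, h | rfl⟩ := exists_add' 1 b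
  · rw [← zero_add' (1 : M.Num), lt_succ'] at h
    rcases h with h | rfl
    exacts [(not_lt_zero' _ h).elim, (lt_irrefl' _ hb).elim]
  · rw [one_add', mul_succ']
    have := add_lt_add_right' ha (a * c)
    rw [zero_add', add_comm' a] at this
    rcases zero_le' (a * c) with h | h
    · exact lt_trans' h this
    · rwa [← h, zero_add'] at this ⊢

noncomputable instance : CommSemiring M.Num where
  add_assoc := add_assoc'
  zero_add := zero_add'
  add_zero := add_zero'
  add_comm := add_comm'
  mul_assoc := mul_assoc'
  one_mul a := by rw [mul_comm', mul_one']
  mul_one := mul_one'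
  zero_mul := zero_mul'
  mul_zero := mul_zero'
  left_distrib := mul_add'
  right_distrib a b c := by rw [mul_comm', mul_add', mul_comm' c, mul_comm' c]
  mul_comm := mul_comm'
  nsmul := nsmulRec
  npow := npowRec
  natCast := Nat.unaryCast

noncomputable instance : LinearOrder M.Num where
  le_refl _ := .inr rfl
  le_trans _ _ _ := le_trans'
  le_antisymm _ _ := le_antisymm'
  le_total := le_total'
  lt_iff_le_not_ge _ _ := lt_iff'
  toDecidableLE := Classical.decRel _

instance : CanonicallyOrderedAdd M.Num where
  exists_add_of_le {a b} h := by
    obtain ⟨c, h' | h'⟩ := exists_add' a b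
    exacts [(not_lt_of_ge h h').elim, ⟨c, h'⟩]
  le_add_self a b := by
    have := (zero_le' b).imp (fun h => add_lt_add_right' h a) (fun h => congrArg (· + a) h)
    simpa only [zero_add] using! this
  le_self_add a b := by
    have := (zero_le' b).imp (fun h => add_lt_add_right' h a) (fun h => congrArg (· + a) h)
    rw [add_comm a b]
    simpa only [zero_add] using! this

instance : IsStrictOrderedRing M.Num := by
  have h1 : (0 : M.Num) < 1 := by
    simpa only [zero_add] using lt_succ_self' (0 : M.Num)
  have key : ∀ {a b c : M.Num}, 0 < c → a < b → a * c < b * c := fun {a b c} hc hab => by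
    obtain ⟨d, rfl⟩ := exists_add_of_le hab.le
    have hd : 0 < d := pos_of_ne_zero fun h => by simp [h] at hab
    have := add_lt_add_right' (mul_pos' hd hc) (a * c)
    rwa [zero_add, ← add_mul, add_comm d a] at this
  have : Nontrivial M.Num := ⟨0, 1, h1.ne⟩
  exact
  { add_le_add_left := fun a b h c => by
      rcases h with h | rfl
      exacts [.inl (add_lt_add_right' h c), le_rfl]
    le_of_add_le_add_left := fun a b c h => by
      rw [← not_lt] at h ⊢
      rw [add_comm a b, add_comm a c] at h
      exact fun h' => h (add_lt_add_right' h' a)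
    zero_le_one := h1.le
    mul_lt_mul_of_pos_left := fun c hc a b hab => by
      simpa only [mul_comm] using! key hc hab
    mul_lt_mul_of_pos_right := fun c hc a b hab => key hc hab }

theorem lt_add_one_iff {a b : M.Num} : a < b + 1 ↔ a ≤ b := lt_succ'

theorem add_one_le_iff {a b : M.Num} : a + 1 ≤ b ↔ a < b :=
  ⟨fun h => (lt_succ_self' a).trans_le h, succ_le'⟩

end Num

end L2Structure

/-! ### The ordered field of fractions of an ordered semiring -/

/-- A formal fraction `(pos - neg) / den` over an ordered semiring. -/
structure PreFrac (N : Type u) [CommSemiring N] [LinearOrder N] where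
  pos : N
  neg : N
  den : N
  den_pos : 0 < den

section FracField

variable (N : Type u) [CommSemiring N] [LinearOrder N] [IsStrictOrderedRing N] [ExistsAddOfLE N]

/-- Equality of fractions by cross-multiplication. -/
instance PreFrac.setoid : Setoid (PreFrac N) where
  r x y := x.pos * y.den + y.neg * x.den = y.pos * x.den + x.neg * y.den
  iseqv :=
    { refl := fun _ => rfl
      symm := fun h => h.symm
      trans := fun {x y z} h₁ h₂ => by
        refine mul_right_cancel₀ y.den_pos.ne' ?_
        linear_combination h₁ * z.den + h₂ * x.den }

/-- The ordered field of fractions of an ordered semiring. -/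
def FracField : Type u := Quotient (PreFrac.setoid N)

namespace FracField

variable {N}

/-- The class of a formal fraction. -/
def mk (x : PreFrac N) : FracField N := Quotient.mk _ x

theorem ind {p : FracField N → Prop} (h : ∀ x, p (mk x)) (x : FracField N) : p x :=
  Quotient.ind h x

theorem sound {x y : PreFrac N}
    (h : x.pos * y.den + y.neg * x.den = y.pos * x.den + x.neg * y.den) : mk x = mk y :=
  Quotient.sound h

instance : Zero (FracField N) := ⟨mk ⟨0, 0, 1, one_pos⟩⟩

instance : One (FracField N) := ⟨mk ⟨1, 0, 1, one_pos⟩⟩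

instance : Add (FracField N) :=
  ⟨Quotient.map₂ (fun x y => ⟨x.pos * y.den + y.pos * x.den, x.neg * y.den + y.neg * x.den,
    x.den * y.den, mul_pos x.den_pos y.den_pos⟩) fun x x' (h : _ = _) y y' (h' : _ = _) => by
      show _ = _
      dsimp only
      linear_combination h * y.den * y'.den + h' * x.den * x'.den⟩

instance : Neg (FracField N) :=
  ⟨Quotient.map (fun x => ⟨x.neg, x.pos, x.den, x.den_pos⟩) fun x x' (h : _ = _) => by
    show _ = _
    dsimp only
    linear_combination h.symm⟩

instance : Mul (FracField N) :=
  ⟨Quotient.map₂ (fun x y => ⟨x.pos * y.pos + x.neg * y.neg, x.pos * y.neg + x.neg * y.pos,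
    x.den * y.den, mul_pos x.den_pos y.den_pos⟩) fun x x' (h : _ = _) y y' (h' : _ = _) => by
      show _ = _
      dsimp only
      linear_combination h * y.pos * y'.den + h.symm * y.neg * y'.den +
        x'.pos * x.den * h' + x'.neg * x.den * h'.symm⟩

noncomputable instance : CommRing (FracField N) where
  add_assoc x y z := by
    induction x using ind with | _ x
    induction y using ind with | _ y
    induction z using ind with | _ z
    refine sound ?_
    dsimp only
    ring
  zero_add x := by
    induction x using ind with | _ x
    refine sound ?_
    dsimp only
    ring
  add_zero x := by
    induction x using ind with | _ x
    refine sound ?_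
    dsimp only
    ring
  add_comm x y := by
    induction x using ind with | _ x
    induction y using ind with | _ y
    refine sound ?_
    dsimp only
    ring
  mul_assoc x y z := by
    induction x using ind with | _ x
    induction y using ind with | _ y
    induction z using ind with | _ z
    refine sound ?_
    dsimp only
    ring
  one_mul x := by
    induction x using ind with | _ x
    refine sound ?_
    dsimp only
    ring
  mul_one x := by
    induction x using ind with | _ x
    refine sound ?_
    dsimp only
    ring
  zero_mul x := by
    induction x using ind with | _ x
    refine sound ?_
    dsimp only
    ring
  mul_zero x := by
    induction x using ind with | _ x
    refine sound ?_
    dsimp only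
    ring
  left_distrib x y z := by
    induction x using ind with | _ x
    induction y using ind with | _ y
    induction z using ind with | _ z
    refine sound ?_
    dsimp only
    ring
  right_distrib x y z := by
    induction x using ind with | _ x
    induction y using ind with | _ y
    induction z using ind with | _ z
    refine sound ?_
    dsimp only
    ring
  mul_comm x y := by
    induction x using ind with | _ x
    induction y using ind with | _ y
    refine sound ?_
    dsimp only
    ring
  neg_add_cancel x := by
    induction x using ind with | _ x
    refine sound ?_
    dsimp only
    ring
  nsmul := nsmulRec
  zsmul := zsmulRec
  npow := npowRec
  natCast := Nat.unaryCast

instance : LE (FracField N) :=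
  ⟨Quotient.lift₂ (fun x y => x.pos * y.den + y.neg * x.den ≤ y.pos * x.den + x.neg * y.den) <| by
    intro x y x' y' (h : _ = _) (h' : _ = _)
    have hx := x.den_pos
    have hy := y.den_pos
    have hx' := x'.den_pos
    have hy' := y'.den_pos
    have e : (x.pos * y.den + y.neg * x.den) * (x'.den * y'.den) +
        (y'.pos * x'.den + x'.neg * y'.den) * (x.den * y.den) =
        (y.pos * x.den + x.neg * y.den) * (x'.den * y'.den) +
        (x'.pos * y'.den + y'.neg * x'.den) * (x.den * y.den) := by
      linear_combination h * y.den * y'.den + h'.symm * x.den * x'.den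
    rw [eq_iff_iff, ← mul_le_mul_iff_left₀ (mul_pos hx' hy'),
      ← mul_le_mul_iff_left₀ (b := x'.pos * y'.den + y'.neg * x'.den) (mul_pos hx hy),
      ← add_le_add_iff_right ((y'.pos * x'.den + x'.neg * y'.den) * (x.den * y.den)), e,
      add_le_add_iff_left]⟩

theorem mk_le_mk {x y : PreFrac N} : mk x ≤ mk y ↔
    x.pos * y.den + y.neg * x.den ≤ y.pos * x.den + x.neg * y.den := Iff.rfl

noncomputable instance : LinearOrder (FracField N) where
  le_refl x := by
    induction x using ind with | _ x
    exact mk_le_mk.2 le_rfl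
  le_trans x y z h h' := by
    induction x using ind with | _ x
    induction y using ind with | _ y
    induction z using ind with | _ z
    rw [mk_le_mk] at h h' ⊢
    have h₁ := mul_le_mul_of_nonneg_right h z.den_pos.le
    have h₂ := mul_le_mul_of_nonneg_right h' x.den_pos.le
    refine le_of_mul_le_mul_right ?_ y.den_pos
    -- Terms in `y` cannot be subtracted in `N`; adding this summand to both sides makes the
    -- inequality the sum of `h₁` and `h₂`.
    refine le_of_add_le_add_right (a := (y.pos + y.neg) * x.den * z.den) ?_
    convert! add_le_add h₁ h₂ using 1 <;> ring
  le_antisymm x y h h' := by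
    induction x using ind with | _ x
    induction y using ind with | _ y
    exact sound (le_antisymm (mk_le_mk.1 h) (mk_le_mk.1 h'))
  le_total x y := by
    induction x using ind with | _ x
    induction y using ind with | _ y
    exact le_total _ _
  toDecidableLE := Classical.decRel _

theorem mk_pos {x : PreFrac N} : (0 : FracField N) < mk x ↔ x.neg < x.pos := by
  rw [← not_le, ← not_le, not_iff_not]
  refine mk_le_mk.trans ?_
  simp

instance : IsStrictOrderedRing (FracField N) := by
  have hadd : ∀ x y : FracField N, x ≤ y → ∀ z, x + z ≤ y + z := fun x y h z => by
    induction x using ind with | _ x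
    induction y using ind with | _ y
    induction z using ind with | _ z
    replace h := mk_le_mk.1 h
    have h₁ := mul_le_mul_of_nonneg_right h (mul_pos z.den_pos z.den_pos).le
    refine mk_le_mk.2 ?_
    dsimp only
    convert! add_le_add_left h₁ ((z.pos + z.neg) * z.den * (x.den * y.den)) using 1 <;> ring
  have hmul : ∀ x y : FracField N, 0 < x → 0 < y → 0 < x * y := fun x y hx hy => by
    induction x using ind with | _ x
    induction y using ind with | _ y
    rw [mk_pos] at hx hy
    refine mk_pos.2 ?_
    dsimp only
    rw [add_comm, add_comm (x.pos * y.pos)]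
    exact mul_add_mul_lt_mul_add_mul hx hy
  have hnt : Nontrivial (FracField N) := ⟨0, 1, (mk_pos.2 one_pos).ne⟩
  have : IsOrderedAddMonoid (FracField N) := { add_le_add_left := hadd }
  have : ZeroLEOneClass (FracField N) := ⟨(mk_pos.2 one_pos).le⟩
  exact .of_mul_pos hmul

theorem exists_mul_eq_one {x : FracField N} (hx : x ≠ 0) : ∃ y, x * y = 1 := by
  induction x using ind with | _ x
  rcases lt_trichotomy x.neg x.pos with h | h | h
  · obtain ⟨c, hc⟩ := exists_add_of_le h.le
    have hc0 : 0 < c := by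
      rw [hc] at h
      exact pos_of_lt_add_right h
    refine ⟨mk ⟨x.den, 0, c, hc0⟩, sound ?_⟩
    dsimp only
    rw [hc]
    ring
  · refine (hx (sound ?_)).elim
    dsimp only
    rw [h]
    ring
  · obtain ⟨c, hc⟩ := exists_add_of_le h.le
    have hc0 : 0 < c := by
      rw [hc] at h
      exact pos_of_lt_add_right h
    refine ⟨mk ⟨0, x.den, c, hc0⟩, sound ?_⟩
    dsimp only
    rw [hc]
    ring

noncomputable instance : Field (FracField N) :=
  { (inferInstance : CommRing (FracField N)) with
    toNontrivial := IsStrictOrderedRing.toNontrivial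
    inv := fun x => open Classical in if h : x ≠ 0 then (exists_mul_eq_one h).choose else 0
    mul_inv_cancel := fun x hx => by
      show x * dite _ _ _ = 1
      rw [dif_pos hx]
      exact (exists_mul_eq_one hx).choose_spec
    inv_zero := dif_neg (by simp)
    nnqsmul := _
    nnqsmul_def := fun _ _ => rfl
    qsmul := _
    qsmul_def := fun _ _ => rfl }

instance : IsOrderedRing (FracField N) := IsStrictOrderedRing.toIsOrderedRing

instance : IsOrderedAddMonoid (FracField N) := IsOrderedRing.toIsOrderedAddMonoid

instance : IsOrderedCancelAddMonoid (FracField N) :=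
  IsStrictOrderedRing.toIsOrderedCancelAddMonoid

instance : ZeroLEOneClass (FracField N) := inferInstance

instance : PosMulStrictMono (FracField N) := inferInstance

instance : MulPosStrictMono (FracField N) := inferInstance

instance : PosMulMono (FracField N) := inferInstance

instance : MulPosMono (FracField N) := inferInstance

instance : AddLeftMono (FracField N) := inferInstance

instance : AddRightMono (FracField N) := inferInstance

instance : AddLeftStrictMono (FracField N) := inferInstance

instance : AddRightStrictMono (FracField N) := inferInstance

variable (N) in
/-- The embedding of a semiring into its field of fractions. -/
def of : N →+* FracField N where
  toFun n := mk ⟨n, 0, 1, one_pos⟩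
  map_zero' := rfl
  map_one' := rfl
  map_add' x y := sound (by dsimp only; ring)
  map_mul' x y := sound (by dsimp only; ring)

theorem of_le_of {m n : N} : of N m ≤ of N n ↔ m ≤ n := by
  refine mk_le_mk.trans ?_
  simp

theorem of_lt_of {m n : N} : of N m < of N n ↔ m < n := lt_iff_lt_of_le_iff_le of_le_of

theorem of_inj {m n : N} : of N m = of N n ↔ m = n := by
  simp only [le_antisymm_iff, of_le_of]

theorem exists_eq_div (x : FracField N) :
    ∃ p n d : N, 0 < d ∧ x = (of N p - of N n) / of N d := by
  induction x using ind with | _ x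
  refine ⟨x.pos, x.neg, x.den, x.den_pos, ?_⟩
  have hd : of N x.den ≠ 0 := by
    rw [← map_zero (of N), Ne, of_inj]
    exact x.den_pos.ne'
  rw [eq_div_iff hd, sub_eq_add_neg]
  refine sound ?_
  dsimp only
  ring

end FracField

end FracField

/-! ### Closure properties of Σ⁰₁ and Δ⁰₁ relations -/

namespace L2Structure

variable {M : L2Structure.{u}} [hM : Fact M.ModelsRCA0]

omit hM in
theorem IsBdd.comp_subst {P : (ℕ → M.Num) → Prop} (hP : IsBdd P)
    (F : (ℕ → M.Num) → (ℕ → M.Num)) (ρ : ℕ → ℕ ⊕ M.Num)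
    (hF : ∀ v i, F v i = Sum.elim v id (ρ i)) : IsBdd fun v => P (F v) :=
  (hP.substitute ρ).congr fun v => by rw [show F v = subst ρ v from funext (hF v)]

omit hM in
theorem IsSig.substitute {P : (ℕ → M.Num) → Prop} (hP : IsSig P) (ρ : ℕ → ℕ ⊕ M.Num) :
    IsSig fun v => P (subst ρ v) := by
  obtain ⟨Q, hQ, h⟩ := hP.out
  refine (IsSig.exBdd (fun v n => Q (assignCons n (subst ρ v))) ?_).congr fun v => h _
  refine hQ.comp_subst _ (fun i => match i with
    | 0 => .inl 0
    | i + 1 => Sum.map (· + 1) id (ρ i)) fun v i => ?_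
  rcases i with _ | i
  · rfl
  · rcases h : ρ i <;> simp [assignCons, subst, h]

omit hM in
theorem IsSig.comp_subst {P : (ℕ → M.Num) → Prop} (hP : IsSig P)
    (F : (ℕ → M.Num) → (ℕ → M.Num)) (ρ : ℕ → ℕ ⊕ M.Num)
    (hF : ∀ v i, F v i = Sum.elim v id (ρ i)) : IsSig fun v => P (F v) :=
  (hP.substitute ρ).congr fun v => by rw [show F v = subst ρ v from funext (hF v)]

instance IsSig.or (P Q : (ℕ → M.Num) → Prop) [hP : IsSig P] [hQ : IsSig Q] :
    IsSig fun v => P v ∨ Q v := by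
  obtain ⟨P', hP', h₁⟩ := hP.out
  obtain ⟨Q', hQ', h₂⟩ := hQ.out
  exact ⟨_, IsBdd.or P' Q', fun v => by rw [h₁, h₂, exists_or]⟩

/-- Two existential quantifiers contract to one, over a common strict bound of both witnesses; no
pairing function is needed. -/
instance IsSig.ex (P : (ℕ → M.Num) → M.Num → Prop)
    [hP : IsSig fun v => P (fun i => v (i + 1)) (v 0)] : IsSig fun v => ∃ n, P v n := by
  obtain ⟨Q, hQ, h⟩ := hP.out
  have h' : ∀ v n, P v n ↔ ∃ m, Q (assignCons m (assignCons n v)) := fun v n =>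
    h (assignCons n v)
  have : IsBdd fun v : ℕ → M.Num => Q (assignCons (v 0) (assignCons (v 1) fun i => v (i + 3))) :=
    hQ.comp_subst _ (fun i => match i with
      | 0 => .inl 0
      | 1 => .inl 1
      | i + 2 => .inl (i + 3)) fun v i => by rcases i with _ | _ | i <;> rfl
  refine (IsSig.exBdd
    (fun v N => ∃ n, n < N ∧ ∃ m, m < N ∧ Q (assignCons m (assignCons n v)))
    inferInstance).congr fun v => ?_
  constructor
  · rintro ⟨n, hn⟩
    obtain ⟨m, hm⟩ := (h' v n).1 hn
    exact ⟨max n m + 1, n, Num.lt_add_one_iff.2 (le_max_left _ _), m,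
      Num.lt_add_one_iff.2 (le_max_right _ _), hm⟩
  · rintro ⟨N, n, -, m, -, hm⟩
    exact ⟨n, (h' v n).2 ⟨m, hm⟩⟩

instance IsSig.and (P Q : (ℕ → M.Num) → Prop) [hP : IsSig P] [hQ : IsSig Q] :
    IsSig fun v => P v ∧ Q v := by
  obtain ⟨P', hP', h₁⟩ := hP.out
  obtain ⟨Q', hQ', h₂⟩ := hQ.out
  have hP'' : IsBdd fun v : ℕ → M.Num => P' (assignCons (v 0) fun i => v (i + 2)) :=
    hP'.comp_subst _ (fun i => match i with
      | 0 => .inl 0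
      | i + 1 => .inl (i + 2)) fun v i => by rcases i with _ | i <;> rfl
  have hQ'' : IsBdd fun v : ℕ → M.Num => Q' (assignCons (v 0) fun i => v (i + 2)) :=
    hQ'.comp_subst _ (fun i => match i with
      | 0 => .inl 0
      | i + 1 => .inl (i + 2)) fun v i => by rcases i with _ | i <;> rfl
  refine (IsSig.exBdd (fun v N => (∃ n, n < N ∧ P' (assignCons n v)) ∧
    ∃ n, n < N ∧ Q' (assignCons n v)) inferInstance).congr fun v => ?_
  rw [h₁, h₂]
  constructor
  · rintro ⟨⟨n, hn⟩, m, hm⟩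
    exact ⟨max n m + 1, ⟨n, Num.lt_add_one_iff.2 (le_max_left _ _), hn⟩, m,
      Num.lt_add_one_iff.2 (le_max_right _ _), hm⟩
  · rintro ⟨N, ⟨n, -, hn⟩, m, -, hm⟩
    exact ⟨⟨n, hn⟩, m, hm⟩

/-- `Σ⁰₁` collection. -/
theorem sig_collection (Q : M.Num → M.Num → Prop) [hQ : IsBdd fun v => Q (v 0) (v 1)] (t : M.Num)
    (h : ∀ n < t, ∃ m, Q n m) : ∃ N, ∀ n < t, ∃ m < N, Q n m := by
  have hQ' : IsBdd fun v : ℕ → M.Num => Q (v 1) (v 0) :=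
    hQ.comp_subst (fun v i => v (if i = 0 then 1 else 0))
      (fun i => .inl (if i = 0 then 1 else 0)) fun v i => rfl
  -- The clause `t ≤ n` makes the claim trivial beyond `t`, where no witness is known to exist.
  have key := sig_induction (fun k => ∃ N, ∀ n, n < k → (t ≤ n ∨ ∃ m, m < N ∧ Q n m))
    (hP := IsSig.exBdd (fun v N => ∀ n, n < v 0 → (t ≤ n ∨ ∃ m, m < N ∧ Q n m)) inferInstance)
    ⟨0, fun n hn => (not_lt_zero hn).elim⟩ (fun k hk => ?_) t
  · obtain ⟨N, hN⟩ := key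
    exact ⟨N, fun n hn => (hN n hn).resolve_left (not_le.2 hn)⟩
  · obtain ⟨N, hN⟩ := hk
    rcases le_or_gt t k with htk | htk
    · refine ⟨N, fun n hn => ?_⟩
      rcases (Num.lt_add_one_iff.1 hn).eq_or_lt with rfl | hn
      exacts [.inl htk, hN n hn]
    · obtain ⟨m, hm⟩ := h k htk
      refine ⟨max N (m + 1), fun n hn => ?_⟩
      rcases (Num.lt_add_one_iff.1 hn).eq_or_lt with rfl | hn
      · exact .inr ⟨m, lt_max_of_lt_right (Num.lt_add_one_iff.2 le_rfl), hm⟩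
      · exact (hN n hn).imp id fun ⟨m, hm, hm'⟩ => ⟨m, lt_max_of_lt_left hm, hm'⟩

/-- Collection bounds the witnesses uniformly, so the bounded universal quantifier can be moved
inside the existential one. -/
theorem IsSig.ballPoly (t : (ℕ → M.Num) → M.Num) (P : (ℕ → M.Num) → M.Num → Prop) [IsPoly t]
    [hP : IsSig fun v => P (fun i => v (i + 1)) (v 0)] :
    IsSig fun v => ∀ n, n < t v → P v n := by
  obtain ⟨Q, hQ, h⟩ := hP.out
  have h' : ∀ v n, P v n ↔ ∃ m, Q (assignCons m (assignCons n v)) := fun v n =>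
    h (assignCons n v)
  have : IsBdd fun v : ℕ → M.Num => Q (assignCons (v 0) (assignCons (v 1) fun i => v (i + 3))) :=
    hQ.comp_subst _ (fun i => match i with
      | 0 => .inl 0
      | 1 => .inl 1
      | i + 2 => .inl (i + 3)) fun v i => by rcases i with _ | _ | i <;> rfl
  have ht : IsPoly fun v : ℕ → M.Num => t fun i => v (i + 1) := by
    obtain ⟨τ, ρ, hτ⟩ := IsPoly.out (t := t)
    refine ⟨τ, fun i => Sum.map (· + 1) id (ρ i), fun v => ?_⟩
    rw [hτ]
    congr 1
    funext i
    rcases h : ρ i <;> simp [subst, h]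
  refine (IsSig.exBdd
    (fun v N => ∀ n, n < t v → ∃ m, m < N ∧ Q (assignCons m (assignCons n v)))
    inferInstance).congr fun v => ?_
  constructor
  · intro hv
    have : IsBdd fun w : ℕ → M.Num => Q (assignCons (w 1) (assignCons (w 0) v)) :=
      hQ.comp_subst _ (fun i => match i with
        | 0 => .inl 1
        | 1 => .inl 0
        | i + 2 => .inr (v i)) fun v i => by rcases i with _ | _ | i <;> rfl
    exact sig_collection (fun n m => Q (assignCons m (assignCons n v))) (t v)
      fun n hn => (h' v n).1 (hv n hn)
  · rintro ⟨N, hN⟩ n hn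
    obtain ⟨m, -, hm⟩ := hN n hn
    exact (h' v n).2 ⟨m, hm⟩

/-- `P` is `Δ⁰₁` with parameters. -/
class IsDel (P : (ℕ → M.Num) → Prop) : Prop where
  sig : IsSig P
  co : IsSig fun v => ¬ P v

instance (priority := low) IsSig.ofDel (P : (ℕ → M.Num) → Prop) [h : IsDel P] : IsSig P := h.sig

omit hM in
theorem IsDel.congr {P Q : (ℕ → M.Num) → Prop} (hP : IsDel P) (h : ∀ v, Q v ↔ P v) : IsDel Q :=
  (funext fun v => propext (h v) : Q = P) ▸ hP

omit hM in
theorem IsDel.ofBdd (P : (ℕ → M.Num) → Prop) [IsBdd P] : IsDel P :=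
  ⟨inferInstance, inferInstance⟩

omit hM in
theorem IsDel.comp_subst {P : (ℕ → M.Num) → Prop} (hP : IsDel P)
    (F : (ℕ → M.Num) → (ℕ → M.Num)) (ρ : ℕ → ℕ ⊕ M.Num)
    (hF : ∀ v i, F v i = Sum.elim v id (ρ i)) : IsDel fun v => P (F v) :=
  ⟨hP.sig.comp_subst F ρ hF, hP.co.comp_subst F ρ hF⟩

instance IsDel.not (P : (ℕ → M.Num) → Prop) [hP : IsDel P] : IsDel fun v => ¬ P v :=
  ⟨hP.co, hP.sig.congr fun _ => not_not⟩

instance IsDel.and (P Q : (ℕ → M.Num) → Prop) [hP : IsDel P] [hQ : IsDel Q] :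
    IsDel fun v => P v ∧ Q v :=
  have := hP.co
  have := hQ.co
  ⟨inferInstance, (IsSig.or (fun v => ¬ P v) (fun v => ¬ Q v)).congr fun _ => not_and_or⟩

instance IsDel.or (P Q : (ℕ → M.Num) → Prop) [hP : IsDel P] [hQ : IsDel Q] :
    IsDel fun v => P v ∨ Q v :=
  have := hP.co
  have := hQ.co
  ⟨inferInstance, (IsSig.and (fun v => ¬ P v) (fun v => ¬ Q v)).congr fun _ => not_or⟩

instance IsDel.imp (P Q : (ℕ → M.Num) → Prop) [hP : IsDel P] [hQ : IsDel Q] :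
    IsDel fun v => P v → Q v :=
  (IsDel.or (fun v => ¬ P v) Q).congr fun _ => imp_iff_not_or

instance IsDel.iff (P Q : (ℕ → M.Num) → Prop) [hP : IsDel P] [hQ : IsDel Q] :
    IsDel fun v => P v ↔ Q v :=
  (IsDel.and (fun v => P v → Q v) (fun v => Q v → P v)).congr fun _ => iff_def

/-! ### Recursive functions and relations -/

/-- The function `f` has a `Σ⁰₁` graph. -/
class IsRec (f : (ℕ → M.Num) → M.Num) : Prop where
  out : IsSig fun v => v 0 = f fun i => v (i + 1)

class IsRec1 (F : M.Num → M.Num) : Prop where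
  out : IsRec fun v : ℕ → M.Num => F (v 0)

class IsRec2 (F : M.Num → M.Num → M.Num) : Prop where
  out : IsRec fun v : ℕ → M.Num => F (v 0) (v 1)

class IsRec3 (F : M.Num → M.Num → M.Num → M.Num) : Prop where
  out : IsRec fun v : ℕ → M.Num => F (v 0) (v 1) (v 2)

class IsRel1 (R : M.Num → Prop) : Prop where
  out : IsDel fun v : ℕ → M.Num => R (v 0)

class IsRel2 (R : M.Num → M.Num → Prop) : Prop where
  out : IsDel fun v : ℕ → M.Num => R (v 0) (v 1)

class IsRel3 (R : M.Num → M.Num → M.Num → Prop) : Prop where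
  out : IsDel fun v : ℕ → M.Num => R (v 0) (v 1) (v 2)

/-- Substitution of recursive functions for three variables. -/
theorem IsSig.comp₃ {R : M.Num → M.Num → M.Num → Prop} (hR : IsSig fun v => R (v 0) (v 1) (v 2))
    (f g h : (ℕ → M.Num) → M.Num) [hf : IsRec f] [hg : IsRec g] [hh : IsRec h] :
    IsSig fun v => R (f v) (g v) (h v) := by
  have h₁ := hf.out
  have h₂ : IsSig fun v : ℕ → M.Num => v 0 = g fun i => v (i + 2) :=
    hg.out.comp_subst (fun v i => if i = 0 then v 0 else v (i + 1))
      (fun i => .inl (if i = 0 then 0 else i + 1)) fun v i => by split_ifs <;> rfl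
  have h₃ : IsSig fun v : ℕ → M.Num => v 0 = h fun i => v (i + 3) :=
    hh.out.comp_subst (fun v i => if i = 0 then v 0 else v (i + 2))
      (fun i => .inl (if i = 0 then 0 else i + 2)) fun v i => by split_ifs <;> rfl
  have h₄ : IsSig fun v : ℕ → M.Num => R (v 2) (v 1) (v 0) :=
    hR.comp_subst (fun v i => v (2 - i)) (fun i => .inl (2 - i)) fun v i => rfl
  have : IsSig fun v => ∃ x, x = f v ∧ ∃ y, y = g v ∧ ∃ z, z = h v ∧ R x y z := inferInstance
  exact this.congr fun v => by simp

theorem IsDel.comp₃ {R : M.Num → M.Num → M.Num → Prop} (hR : IsDel fun v => R (v 0) (v 1) (v 2))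
    (f g h : (ℕ → M.Num) → M.Num) [hf : IsRec f] [hg : IsRec g] [hh : IsRec h] :
    IsDel fun v => R (f v) (g v) (h v) :=
  ⟨hR.sig.comp₃ f g h, IsSig.comp₃ (R := fun x y z => ¬ R x y z) hR.co f g h⟩

instance IsDel.rel3 (R : M.Num → M.Num → M.Num → Prop) [hR : IsRel3 R]
    (f g h : (ℕ → M.Num) → M.Num) [IsRec f] [IsRec g] [IsRec h] :
    IsDel fun v => R (f v) (g v) (h v) := hR.out.comp₃ f g h

instance IsDel.rel2 (R : M.Num → M.Num → Prop) [hR : IsRel2 R]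
    (f g : (ℕ → M.Num) → M.Num) [IsRec f] [IsRec g] :
    IsDel fun v => R (f v) (g v) := IsDel.comp₃ (R := fun x y _ => R x y) hR.out f g g

instance IsDel.rel1 (R : M.Num → Prop) [hR : IsRel1 R]
    (f : (ℕ → M.Num) → M.Num) [IsRec f] :
    IsDel fun v => R (f v) := IsDel.comp₃ (R := fun x _ _ => R x) hR.out f f f

omit hM in
theorem IsRec.of_graph {f : (ℕ → M.Num) → M.Num} (G : (ℕ → M.Num) → M.Num → Prop)
    [hG : IsSig fun v => G (fun i => v (i + 1)) (v 0)] (h : ∀ v y, y = f v ↔ G v y) : IsRec f :=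
  ⟨hG.congr fun _ => h _ _⟩

/-- The intermediate values of a composite can be quantified existentially, which leaves its graph
Σ⁰₁. Fewer arguments are treated below by dummy ones. -/
instance IsRec.fun3 (F : M.Num → M.Num → M.Num → M.Num) [hF : IsRec3 F]
    (f g h : (ℕ → M.Num) → M.Num) [hf : IsRec f] [hg : IsRec g] [hh : IsRec h] :
    IsRec fun v => F (f v) (g v) (h v) := by
  have h₄ : IsSig fun v : ℕ → M.Num => v 3 = F (v 2) (v 1) (v 0) :=
    hF.out.out.comp_subst (fun v i => v (3 - i)) (fun i => .inl (3 - i)) fun v i => rfl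
  have h₁' : IsSig fun v : ℕ → M.Num => v 0 = f fun i => v (i + 2) :=
    hf.out.comp_subst (fun v i => if i = 0 then v 0 else v (i + 1))
      (fun i => .inl (if i = 0 then 0 else i + 1)) fun v i => by split_ifs <;> rfl
  have h₂' : IsSig fun v : ℕ → M.Num => v 0 = g fun i => v (i + 3) :=
    hg.out.comp_subst (fun v i => if i = 0 then v 0 else v (i + 2))
      (fun i => .inl (if i = 0 then 0 else i + 2)) fun v i => by split_ifs <;> rfl
  have h₃' : IsSig fun v : ℕ → M.Num => v 0 = h fun i => v (i + 4) :=
    hh.out.comp_subst (fun v i => if i = 0 then v 0 else v (i + 3))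
      (fun i => .inl (if i = 0 then 0 else i + 3)) fun v i => by split_ifs <;> rfl
  have : IsSig fun v : ℕ → M.Num => ∃ x, x = f (fun i => v (i + 1)) ∧
      ∃ y, y = g (fun i => v (i + 1)) ∧ ∃ z, z = h (fun i => v (i + 1)) ∧ v 0 = F x y z :=
    inferInstance
  exact ⟨this.congr fun v => by simp⟩

instance IsRec.fun2 (F : M.Num → M.Num → M.Num) [hF : IsRec2 F]
    (f g : (ℕ → M.Num) → M.Num) [IsRec f] [IsRec g] :
    IsRec fun v => F (f v) (g v) :=
  have : IsRec3 fun x y (_ : M.Num) => F x y := ⟨hF.out⟩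
  IsRec.fun3 (fun x y _ => F x y) f g g

instance IsRec.fun1 (F : M.Num → M.Num) [hF : IsRec1 F] (f : (ℕ → M.Num) → M.Num) [IsRec f] :
    IsRec fun v => F (f v) :=
  have : IsRec3 fun x (_ _ : M.Num) => F x := ⟨hF.out⟩
  IsRec.fun3 (fun x _ _ => F x) f f f

instance IsRec.var (i : ℕ) : IsRec fun v : ℕ → M.Num => v i :=
  ⟨IsSig.ofBdd fun v : ℕ → M.Num => v 0 = v (i + 1)⟩

instance (priority := low) IsRec.const (c : M.Num) : IsRec fun _ : ℕ → M.Num => c :=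
  ⟨IsSig.ofBdd fun v : ℕ → M.Num => v 0 = c⟩

instance IsRec2.add : IsRec2 fun x y : M.Num => x + y :=
  ⟨⟨IsSig.ofBdd fun v : ℕ → M.Num => v 0 = v 1 + v 2⟩⟩

instance IsRec2.mul : IsRec2 fun x y : M.Num => x * y :=
  ⟨⟨IsSig.ofBdd fun v : ℕ → M.Num => v 0 = v 1 * v 2⟩⟩

instance IsRel2.eq : IsRel2 fun x y : M.Num => x = y := ⟨.ofBdd _⟩

instance IsRel2.lt : IsRel2 fun x y : M.Num => x < y := ⟨.ofBdd _⟩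

instance IsRel2.le : IsRel2 fun x y : M.Num => x ≤ y := ⟨.ofBdd _⟩

omit hM in
theorem IsRel1.mem {X : Set M.Num} (hX : X ∈ M.sets) : IsRel1 fun x : M.Num => x ∈ X :=
  ⟨.ofBdd fun v : ℕ → M.Num => v 0 ∈ (⟨X, hX⟩ : M.sets).1⟩

instance IsSig.ball (t : (ℕ → M.Num) → M.Num) (P : (ℕ → M.Num) → M.Num → Prop) [ht : IsRec t]
    [hP : IsSig fun v => P (fun i => v (i + 1)) (v 0)] :
    IsSig fun v => ∀ n, n < t v → P v n := by
  have hP' : IsSig fun v : ℕ → M.Num => P (fun i => v (i + 2)) (v 0) :=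
    hP.comp_subst (fun v i => if i = 0 then v 0 else v (i + 1))
      (fun i => .inl (if i = 0 then 0 else i + 1)) fun v i => by split_ifs <;> rfl
  have h₁ := ht.out
  have h₂ : IsSig fun v : ℕ → M.Num => ∀ n, n < v 0 → P (fun i => v (i + 1)) n :=
    IsSig.ballPoly (fun v => v 0) (fun v n => P (fun i => v (i + 1)) n)
  have : IsSig fun v : ℕ → M.Num => ∃ y, y = t v ∧ ∀ n, n < y → P v n := inferInstance
  exact this.congr fun v => by simp

instance IsDel.ball (t : (ℕ → M.Num) → M.Num) (P : (ℕ → M.Num) → M.Num → Prop) [IsRec t]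
    [hP : IsDel fun v => P (fun i => v (i + 1)) (v 0)] :
    IsDel fun v => ∀ n, n < t v → P v n :=
  have := hP.sig
  have := hP.co
  have h₁ := (IsRec.out (f := t))
  have h₂ : IsDel fun v : ℕ → M.Num => v 0 < t fun i => v (i + 1) :=
    have : IsRec fun v : ℕ → M.Num => t fun i => v (i + 1) :=
      ⟨h₁.comp_subst (fun v i => if i = 0 then v 0 else v (i + 1))
      (fun i => .inl (if i = 0 then 0 else i + 1)) fun v i => by split_ifs <;> rfl⟩
    inferInstance
  ⟨inferInstance, IsSig.congr (P := fun v => ∃ n, n < t v ∧ ¬ P v n) inferInstance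
    fun v => by push Not; rfl⟩

instance IsDel.bex (t : (ℕ → M.Num) → M.Num) (P : (ℕ → M.Num) → M.Num → Prop) [IsRec t]
    [hP : IsDel fun v => P (fun i => v (i + 1)) (v 0)] :
    IsDel fun v => ∃ n, n < t v ∧ P v n :=
  IsDel.congr (P := fun v => ¬ ∀ n, n < t v → ¬ P v n) inferInstance fun v => by push Not; rfl

instance IsRec.ite (P : (ℕ → M.Num) → Prop) (f g : (ℕ → M.Num) → M.Num) [hP : IsDel P]
    [hf : IsRec f] [hg : IsRec g] [∀ v, Decidable (P v)] :
    IsRec fun v => if P v then f v else g v := by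
  have h₁ := hf.out
  have h₂ := hg.out
  have h₃ : IsDel fun v : ℕ → M.Num => P fun i => v (i + 1) :=
    hP.comp_subst (fun v i => v (i + 1)) (fun i => .inl (i + 1)) fun v i => rfl
  exact .of_graph (fun v y => (P v ∧ y = f v) ∨ (¬ P v ∧ y = g v)) fun v y => by
    by_cases h : P v <;> simp [h]

/-! ### Induction, the least number principle and minimization -/

theorem del_induction (P : M.Num → Prop) [IsDel fun v => P (v 0)] (zero : P 0)
    (succ : ∀ n, P n → P (n + 1)) (n : M.Num) : P n := sig_induction P zero succ n

theorem exists_least (P : M.Num → Prop) [IsDel fun v => P (v 0)] (h : ∃ n, P n) :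
    ∃ n, P n ∧ ∀ m < n, ¬ P m := by
  by_contra! hc
  obtain ⟨n, hn⟩ := h
  have := del_induction (fun k => ∀ m, m < k → ¬ P m) (fun m hm => (not_lt_zero hm).elim)
    (fun k hk m hm hPm => ?_) (n + 1) n (Num.lt_add_one_iff.2 le_rfl)
  · exact this hn
  · rcases (Num.lt_add_one_iff.1 hm).eq_or_lt with rfl | hm
    · obtain ⟨l, hl, hPl⟩ := hc m hPm
      exact hk l hl hPl
    · exact hk m hm hPm

/-- Minimization: to be the least witness of a Δ⁰₁ relation is a Δ⁰₁ condition, since minimality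
needs only a bounded quantifier. -/
theorem exists_min (R : M.Num → M.Num → Prop) [hR : IsRel2 R] (h : ∀ x, ∃ y, R x y) :
    ∃ F : M.Num → M.Num, IsRec1 F ∧ ∀ x, R x (F x) ∧ ∀ y < F x, ¬ R x y := by
  choose F hF using fun x => exists_least (fun y => R x y) (h x)
  refine ⟨F, ⟨.of_graph (fun v y => R (v 0) y ∧ ∀ z, z < y → ¬ R (v 0) z) fun v y => ?_⟩, hF⟩
  constructor
  · rintro rfl
    exact hF _
  · rintro ⟨h₁, h₂⟩
    exact le_antisymm (not_lt.1 fun hlt => h₂ _ hlt (hF _).1)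
      (not_lt.1 fun hlt => (hF _).2 _ hlt h₁)

/-! ### Pairing -/

instance IsRec2.pair : IsRec2 fun x y : M.Num => pair x y :=
  ⟨inferInstanceAs (IsRec fun v : ℕ → M.Num => (v 0 + v 1) * (v 0 + v 1) + v 0)⟩

theorem le_pair_left (m n : M.Num) : m ≤ pair m n := le_add_self

theorem le_pair_right (m n : M.Num) : n ≤ pair m n := by
  rcases eq_or_ne n 0 with rfl | hn
  · exact zero_le
  · calc n ≤ m + n := le_add_self
      _ = (m + n) * 1 := (mul_one _).symm
      _ ≤ (m + n) * (m + n) := by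
        gcongr
        rw [← zero_add (1 : M.Num), Num.add_one_le_iff]
        exact (Num.pos_of_ne_zero hn).trans_le le_add_self
      _ ≤ _ := le_self_add

/-- `pair m n` lies between `(m + n)²` and `(m + n + 1)²`, so the sum of the components can be
recovered from it. -/
theorem pair_lt_pair {m n m' n' : M.Num} (h : m + n < m' + n') : pair m n < pair m' n' := by
  rw [← Num.add_one_le_iff] at h
  calc (m + n) * (m + n) + m ≤ (m + n) * (m + n) + (m + n) := by gcongr; exact le_self_add
    _ < (m + n + 1) * (m + n + 1) := by
      rw [← Num.add_one_le_iff]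
      calc _ ≤ (m + n) * (m + n) + (m + n) + 1 + (m + n) := le_self_add
        _ = _ := by ring
    _ ≤ (m' + n') * (m' + n') := by gcongr
    _ ≤ _ := le_self_add

theorem pair_inj {m n m' n' : M.Num} : pair m n = pair m' n' ↔ m = m' ∧ n = n' := by
  refine ⟨fun h => ?_, by rintro ⟨rfl, rfl⟩; rfl⟩
  have hs : m + n = m' + n' := by
    rcases lt_trichotomy (m + n) (m' + n') with h' | h' | h'
    exacts [((pair_lt_pair h').ne h).elim, h', ((pair_lt_pair h').ne' h).elim]
  have hm : m = m' := by
    have : (m + n) * (m + n) + m = (m' + n') * (m' + n') + m' := h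
    rw [hs] at this
    exact add_left_cancel this
  subst hm
  exact ⟨rfl, add_left_cancel hs⟩

theorem exists_unpair :
    ∃ f g : M.Num → M.Num, IsRec1 f ∧ IsRec1 g ∧ ∀ m n, f (pair m n) = m ∧ g (pair m n) = n := by
  -- The second disjunct makes the search succeed on numbers that are not pairs.
  obtain ⟨f, hf, hf'⟩ := exists_min
    (fun z y : M.Num => (∃ n, n < z + 1 ∧ z = pair y n) ∨
      ¬ ∃ m, m < z + 1 ∧ ∃ n, n < z + 1 ∧ z = pair m n)
    (hR := ⟨inferInstance⟩) fun z => by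
      by_cases h : ∃ m, m < z + 1 ∧ ∃ n, n < z + 1 ∧ z = pair m n
      · obtain ⟨m, -, n, h, h'⟩ := h
        exact ⟨m, .inl ⟨n, h, h'⟩⟩
      · exact ⟨0, .inr h⟩
  obtain ⟨g, hg, hg'⟩ := exists_min
    (fun z y : M.Num => (∃ m, m < z + 1 ∧ z = pair m y) ∨
      ¬ ∃ m, m < z + 1 ∧ ∃ n, n < z + 1 ∧ z = pair m n)
    (hR := ⟨inferInstance⟩) fun z => by
      by_cases h : ∃ m, m < z + 1 ∧ ∃ n, n < z + 1 ∧ z = pair m n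
      · obtain ⟨m, h, n, -, h'⟩ := h
        exact ⟨n, .inl ⟨m, h, h'⟩⟩
      · exact ⟨0, .inr h⟩
  refine ⟨f, g, hf, hg, fun m n => ?_⟩
  have h : ∃ m', m' < pair m n + 1 ∧ ∃ n', n' < pair m n + 1 ∧ pair m n = pair m' n' :=
    ⟨m, Num.lt_add_one_iff.2 (le_pair_left _ _), n, Num.lt_add_one_iff.2 (le_pair_right _ _), rfl⟩
  refine ⟨?_, ?_⟩
  · rcases (hf' (pair m n)).1 with ⟨k, -, h'⟩ | h'
    exacts [(pair_inj.1 h').1.symm, (h' h).elim]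
  · rcases (hg' (pair m n)).1 with ⟨k, -, h'⟩ | h'
    exacts [(pair_inj.1 h').2.symm, (h' h).elim]

/-- The first component of a pair. -/
noncomputable def fst : M.Num → M.Num := exists_unpair.choose

/-- The second component of a pair. -/
noncomputable def snd : M.Num → M.Num := exists_unpair.choose_spec.choose

instance IsRec1.fst : IsRec1 (fst (M := M)) := exists_unpair.choose_spec.choose_spec.1

instance IsRec1.snd : IsRec1 (snd (M := M)) := exists_unpair.choose_spec.choose_spec.2.1

@[simp] theorem fst_pair (m n : M.Num) : fst (pair m n) = m :=
  (exists_unpair.choose_spec.choose_spec.2.2 m n).1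

@[simp] theorem snd_pair (m n : M.Num) : snd (pair m n) = n :=
  (exists_unpair.choose_spec.choose_spec.2.2 m n).2

/-! ### Coding of finite sets -/

theorem Num.dvd_of_dvd_add {a x y : M.Num} (h : a ∣ x) (h' : a ∣ x + y) : a ∣ y := by
  rcases eq_or_ne a 0 with rfl | ha
  · rw [zero_dvd_iff] at h' ⊢
    exact (add_eq_zero.1 h').2
  · obtain ⟨q, rfl⟩ := h
    obtain ⟨r, hr⟩ := h'
    have hqr : q ≤ r := by
      have : a * q ≤ a * r := hr ▸ le_self_add
      exact le_of_mul_le_mul_left this (pos_of_ne_zero ha)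
    obtain ⟨s, rfl⟩ := exists_add_of_le hqr
    rw [mul_add] at hr
    exact ⟨s, add_left_cancel hr⟩

instance IsRel2.dvd : IsRel2 fun x y : M.Num => x ∣ y := by
  refine ⟨IsDel.congr (P := fun v => ∃ q, q < v 1 + 1 ∧ v 1 = v 0 * q) inferInstance fun v => ?_⟩
  constructor
  · rintro ⟨q, hq⟩
    rcases eq_or_ne (v 0) 0 with h | h
    · exact ⟨0, (zero_le).trans_lt (Num.lt_add_one_iff.2 le_rfl), by rw [hq, h, zero_mul, mul_zero]⟩
    · refine ⟨q, Num.lt_add_one_iff.2 ?_, hq⟩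
      rw [hq]
      refine le_mul_of_one_le_left zero_le ?_
      rw [← zero_add (1 : M.Num), Num.add_one_le_iff]
      exact Num.pos_of_ne_zero h
  · rintro ⟨q, -, hq⟩
    exact ⟨q, hq⟩

/-- `w` belongs to the finite set coded by `b` and `c`. -/
def InCode (b c w : M.Num) : Prop := 1 + (w + 1) * b ∣ c

instance IsRel3.inCode : IsRel3 (InCode (M := M)) :=
  ⟨inferInstanceAs (IsDel fun v : ℕ → M.Num => 1 + (v 2 + 1) * v 0 ∣ v 1)⟩

/-- `b` plays the role of `N!`. Its mere existence follows by Σ⁰₁ induction, before primitive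
recursion is available. -/
theorem exists_common_multiple (N : M.Num) : ∃ b : M.Num, 0 < b ∧ ∀ i < N + 1, i = 0 ∨ i ∣ b := by
  refine sig_induction (fun N => ∃ b : M.Num, 0 < b ∧ ∀ i, i < N + 1 → (i = 0 ∨ i ∣ b))
    ⟨1, one_pos, fun i hi => .inl ?_⟩ (fun N hN => ?_) N
  · exact le_antisymm (Num.lt_add_one_iff.1 hi) zero_le
  · obtain ⟨b, hb, h⟩ := hN
    refine ⟨b * (N + 1), mul_pos hb (by positivity), fun i hi => ?_⟩
    rcases (Num.lt_add_one_iff.1 hi).eq_or_lt with rfl | hi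
    · exact .inr (dvd_mul_left _ _)
    · exact (h i hi).imp id fun h => h.mul_right _

/-- Gödel's coprimality of the moduli. With `e` the distance of `w` and `j`, the products `(w + 1) *
(1 + (j + 1) * b)` and `(j + 1) * (1 + (w + 1) * b)` differ by `e`, so the modulus of `w` divides `c
* e`. As `e` divides `b`, it divides `c * (w + 1) * b`, which differs from `c * (1 + (w + 1) * b)`
by `c`. -/
theorem dvd_of_dvd_mul {N b c w j : M.Num} (hb : ∀ i < N + 1, i = 0 ∨ i ∣ b) (hw : w < N)
    (hj : j < N) (hwj : w ≠ j) (h : 1 + (w + 1) * b ∣ c * (1 + (j + 1) * b)) :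
    1 + (w + 1) * b ∣ c := by
  obtain ⟨e, he, heN, h⟩ : ∃ e : M.Num, e ≠ 0 ∧ e < N + 1 ∧ 1 + (w + 1) * b ∣ c * e := by
    rcases lt_or_gt_of_ne hwj with hlt | hlt
    · obtain ⟨e, rfl⟩ := exists_add_of_le hlt.le
      refine ⟨e, fun h => by simp [h] at hlt,
        Num.lt_add_one_iff.2 ((le_add_self).trans hj.le), ?_⟩
      have h₁ : 1 + (w + 1) * b ∣ c * (1 + (w + e + 1) * b) * (w + 1) := h.mul_right _
      have h₂ : 1 + (w + 1) * b ∣ c * (1 + (w + 1) * b) * (w + e + 1) :=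
        (dvd_mul_left _ _).mul_right _
      refine Num.dvd_of_dvd_add h₁ ?_
      convert! h₂ using 1
      ring
    · obtain ⟨e, rfl⟩ := exists_add_of_le hlt.le
      refine ⟨e, fun h => by simp [h] at hlt,
        Num.lt_add_one_iff.2 ((le_add_self).trans hw.le), ?_⟩
      have h₁ : 1 + (j + e + 1) * b ∣ c * (1 + (j + 1) * b) * (j + e + 1) := h.mul_right _
      have h₂ : 1 + (j + e + 1) * b ∣ c * (1 + (j + e + 1) * b) * (j + 1) :=
        (dvd_mul_left _ _).mul_right _
      refine Num.dvd_of_dvd_add h₂ ?_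
      convert! h₁ using 1
      ring
  obtain ⟨f, rfl⟩ := (hb e heN).resolve_left he
  have h₁ : 1 + (w + 1) * (e * f) ∣ c * e * (f * (w + 1)) := h.mul_right _
  refine Num.dvd_of_dvd_add h₁ ?_
  convert! dvd_mul_left (1 + (w + 1) * (e * f)) c using 1
  ring

/-- Bounded comprehension: a recursive set has a code below each bound. -/
theorem exists_code (P : M.Num → Prop) [IsDel fun v => P (v 0)] (N : M.Num) :
    ∃ b c : M.Num, ∀ w < N, InCode b c w ↔ P w := by
  obtain ⟨b, hb0, hb⟩ := exists_common_multiple N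
  -- At stage `j` the number `c` is the product of the moduli of the elements below `j`; the clause
  -- `N < j` stops the claim after `N`.
  have key := sig_induction (fun j => ∃ c, N < j ∨ ∀ w, w < N → (InCode b c w ↔ w < j ∧ P w))
    ⟨1, .inr fun w _ => ?_⟩ (fun j hj => ?_) N
  · obtain ⟨c, hc⟩ := key
    exact ⟨b, c, fun w hw => by rw [hc.resolve_left (lt_irrefl _) w hw, and_iff_right hw]⟩
  · refine iff_of_false (fun h => ?_) fun h => not_lt_zero h.1
    obtain ⟨q, hq⟩ := h
    have h₁ : 0 < q := Num.pos_of_ne_zero fun h => by simp [h] at hq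
    have h₂ : (1 : M.Num) < 1 + (w + 1) * b := lt_add_of_pos_right _ (by positivity)
    have h₃ : (1 : M.Num) * 1 < (1 + (w + 1) * b) * q := by
      refine mul_lt_mul h₂ ?_ one_pos zero_le
      rwa [← zero_add (1 : M.Num), Num.add_one_le_iff]
    rw [← hq, one_mul] at h₃
    exact lt_irrefl _ h₃
  · obtain ⟨c, hc⟩ := hj
    rcases lt_or_ge j N with hjN | hjN
    · replace hc := hc.resolve_left hjN.not_gt
      by_cases hP : P j
      · refine ⟨c * (1 + (j + 1) * b), .inr fun w hw => ?_⟩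
        rcases eq_or_ne w j with rfl | hwj
        · exact iff_of_true (dvd_mul_left _ _) ⟨Num.lt_add_one_iff.2 le_rfl, hP⟩
        · rw [Num.lt_add_one_iff, hwj.le_iff_lt, ← hc w hw]
          exact ⟨dvd_of_dvd_mul hb hw hjN hwj, fun h => h.mul_right _⟩
      · refine ⟨c, .inr fun w hw => ?_⟩
        rw [hc w hw, Num.lt_add_one_iff]
        refine and_congr_left fun hPw => ?_
        rw [Ne.le_iff_lt]
        rintro rfl
        exact hP hPw
    · exact ⟨c, .inl (Num.lt_add_one_iff.2 hjN)⟩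

/-! ### Primitive recursion -/

/-- The finite set coded by `b` and `c` contains, below `N`, only correct values of the function
defined from `z` and `h` by primitive recursion. -/
def IsDerivation (z : M.Num) (h : M.Num → M.Num → M.Num) (N b c : M.Num) : Prop :=
  ∀ w, w < N → InCode b c w → (w = pair 0 z ∨
    ∃ i, i < N ∧ ∃ y, y < N ∧ pair i y < N ∧ InCode b c (pair i y) ∧ w = pair (i + 1) (h i y))

/-- A coded pair with first component `n + 1` can only come from a coded pair with first component
`n`, so agreement propagates by induction on `n`. -/
theorem IsDerivation.unique {z : M.Num} {h : M.Num → M.Num → M.Num} {N b c N' b' c' : M.Num}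
    (hd : IsDerivation z h N b c) (hd' : IsDerivation z h N' b' c') (n : M.Num) :
    ∀ y, y < N → ∀ y', y' < N' → pair n y < N → InCode b c (pair n y) →
      pair n y' < N' → InCode b' c' (pair n y') → y = y' := by
  -- The bounds `y < N` and `y' < N'` follow from the bounds on the pairs; they are there to keep
  -- the induction formula Δ⁰₁.
  refine del_induction (fun n => ∀ y, y < N → ∀ y', y' < N' → pair n y < N →
    InCode b c (pair n y) → pair n y' < N' → InCode b' c' (pair n y') → y = y') ?_ ?_ n
  · intro y _ y' _ hy hy' hy₂ hy₂'
    rcases hd _ hy hy' with h₁ | ⟨i, -, x, -, -, -, h₁⟩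
    · rcases hd' _ hy₂ hy₂' with h₂ | ⟨i, -, x, -, -, -, h₂⟩
      · rw [(pair_inj.1 h₁).2, (pair_inj.1 h₂).2]
      · exact ((hM.out.succ_ne_zero i) (pair_inj.1 h₂).1.symm).elim
    · exact ((hM.out.succ_ne_zero i) (pair_inj.1 h₁).1.symm).elim
  · intro n ih y _ y' _ hy hy' hy₂ hy₂'
    rcases hd _ hy hy' with h₁ | ⟨i, -, x, hx, hx₁, hx₂, h₁⟩
    · exact ((hM.out.succ_ne_zero n) (pair_inj.1 h₁).1).elim
    · rcases hd' _ hy₂ hy₂' with h₂ | ⟨j, -, x', hx', hx₁', hx₂', h₂⟩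
      · exact ((hM.out.succ_ne_zero n) (pair_inj.1 h₂).1).elim
      · obtain ⟨e₁, rfl⟩ := pair_inj.1 h₁
        obtain ⟨e₂, rfl⟩ := pair_inj.1 h₂
        obtain rfl := hM.out.succ_inj n i e₁
        obtain rfl := hM.out.succ_inj n j e₂
        rw [ih x hx x' hx' hx₁ hx₂ hx₁' hx₂']

/-- Primitive recursion with a parameter. -/
theorem exists_primrec (z : M.Num → M.Num) (h : M.Num → M.Num → M.Num → M.Num) [IsRec1 z]
    [IsRec3 h] : ∃ F : M.Num → M.Num → M.Num, IsRec2 F ∧ (∀ p, F p 0 = z p) ∧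
      ∀ p n, F p (n + 1) = h p n (F p n) := by
  -- `G p n y N b c`: the set coded by `b`, `c` below `N` is a derivation for the parameter `p` that
  -- contains the pair of `n` and `y`.
  let G : M.Num → M.Num → M.Num → M.Num → M.Num → M.Num → Prop := fun p n y N b c =>
    pair n y < N ∧ InCode b c (pair n y) ∧ ∀ w, w < N → InCode b c w → (w = pair 0 (z p) ∨
      ∃ i, i < N ∧ ∃ y, y < N ∧ pair i y < N ∧ InCode b c (pair i y) ∧
        w = pair (i + 1) (h p i y))
  have hG : IsSig fun v : ℕ → M.Num => ∃ N b c, G (v 1) (v 2) (v 0) N b c := by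
    dsimp only [G]
    infer_instance
  have huniq : ∀ {p n y y' N b c N' b' c'}, G p n y N b c → G p n y' N' b' c' → y = y' := by
    rintro p n y y' N b c N' b' c' ⟨h₁, h₂, h₃⟩ ⟨h₁', h₂', h₃'⟩
    exact IsDerivation.unique h₃ h₃' n y ((le_pair_right _ _).trans_lt h₁) y'
      ((le_pair_right _ _).trans_lt h₁') h₁ h₂ h₁' h₂'
  have hnext : ∀ {p n y N b c}, G p n y N b c → ∃ N b c, G p (n + 1) (h p n y) N b c := by
    rintro p n y N b c ⟨h₁, h₂, h₃⟩
    obtain ⟨b', c', hc⟩ := exists_code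
      (fun w => (w < N ∧ InCode b c w) ∨ w = pair (n + 1) (h p n y)) (N + pair (n + 1) (h p n y) + 1)
    have hN : N ≤ N + pair (n + 1) (h p n y) + 1 := le_self_add.trans le_self_add
    refine ⟨N + pair (n + 1) (h p n y) + 1, b', c', Num.lt_add_one_iff.2 le_add_self,
      (hc _ (Num.lt_add_one_iff.2 le_add_self)).2 (.inr rfl), fun w hw hw' => ?_⟩
    rcases (hc w hw).1 hw' with ⟨hw₁, hw₂⟩ | rfl
    · refine (h₃ w hw₁ hw₂).imp id ?_
      rintro ⟨i, hi, x, hx, hx₁, hx₂, hx₃⟩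
      exact ⟨i, hi.trans_le hN, x, hx.trans_le hN, hx₁.trans_le hN,
        (hc _ (hx₁.trans_le hN)).2 (.inl ⟨hx₁, hx₂⟩), hx₃⟩
    · exact .inr ⟨n, ((le_pair_left _ _).trans_lt h₁).trans_le hN, y,
        ((le_pair_right _ _).trans_lt h₁).trans_le hN, h₁.trans_le hN,
        (hc _ (h₁.trans_le hN)).2 (.inl ⟨h₁, h₂⟩), rfl⟩
  have hzero : ∀ p, ∃ N b c, G p 0 (z p) N b c := by
    intro p
    obtain ⟨b, c, hc⟩ := exists_code (fun w => w = pair 0 (z p)) (pair 0 (z p) + 1)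
    exact ⟨pair 0 (z p) + 1, b, c, Num.lt_add_one_iff.2 le_rfl,
      (hc _ (Num.lt_add_one_iff.2 le_rfl)).2 rfl, fun w hw hw' => .inl ((hc w hw).1 hw')⟩
  -- Totality: Σ⁰₁ induction extends a derivation by one pair at a time.
  have hex : ∀ p n, ∃ y N b c, G p n y N b c := by
    intro p n
    have : IsSig fun v : ℕ → M.Num => ∃ y N b c, G p (v 0) y N b c := by
      dsimp only [G]
      infer_instance
    refine sig_induction (fun n => ∃ y N b c, G p n y N b c) ⟨_, hzero p⟩ (fun n hn => ?_) n
    obtain ⟨y, N, b, c, hy⟩ := hn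
    exact ⟨_, hnext hy⟩
  choose F hF using hex
  refine ⟨F, ⟨.of_graph (fun v y => ∃ N b c, G (v 0) (v 1) y N b c) fun v y => ?_⟩,
    fun p => ?_, fun p n => ?_⟩
  · constructor
    · rintro rfl
      exact hF _ _
    · rintro ⟨N, b, c, h₁⟩
      obtain ⟨N', b', c', h₂⟩ := hF (v 0) (v 1)
      exact huniq h₁ h₂
  · obtain ⟨N, b, c, h₁⟩ := hF p 0
    obtain ⟨N', b', c', h₂⟩ := hzero p
    exact huniq h₁ h₂
  · obtain ⟨N, b, c, h₁⟩ := hF p (n + 1)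
    obtain ⟨N', b', c', h₂⟩ := hF p n
    obtain ⟨N'', b'', c'', h₃⟩ := hnext h₂
    exact huniq h₁ h₃

/-! ### The field of rationals of a model -/

variable (M) in
/-- The ordered field of the rational numbers of `M`. -/
abbrev RatField : Type u := FracField M.Num

/-- The embedding of the numbers of `M` into the rationals of `M`. -/
noncomputable abbrev toRat : M.Num →+* M.RatField := FracField.of M.Num

theorem toRat_nonneg (n : M.Num) : 0 ≤ toRat n := by
  rw [← map_zero toRat]
  exact FracField.of_le_of.2 zero_le

theorem toRat_pos {n : M.Num} : 0 < toRat n ↔ 0 < n := by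
  rw [← map_zero toRat]
  exact FracField.of_lt_of

theorem exists_min₂ (R : M.Num → M.Num → M.Num → Prop) [hR : IsRel3 R]
    (h : ∀ x y, ∃ z, R x y z) :
    ∃ F : M.Num → M.Num → M.Num, IsRec2 F ∧ ∀ x y, R x y (F x y) ∧ ∀ z < F x y, ¬ R x y z := by
  obtain ⟨F, hF, hF'⟩ := exists_min (fun x z => R (fst x) (snd x) z) (hR := ⟨inferInstance⟩)
    fun x => h _ _
  exact ⟨fun x y => F (pair x y), ⟨inferInstance⟩, fun x y => by simpa using hF' (pair x y)⟩

theorem exists_sub : ∃ F : M.Num → M.Num → M.Num, IsRec2 F ∧ ∀ m n, n ≤ m → m = n + F m n := by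
  obtain ⟨F, hF, hF'⟩ := exists_min₂ (fun m n z : M.Num => n ≤ m → m = n + z)
    (hR := ⟨inferInstance⟩) fun m n => by
      by_cases h : n ≤ m
      · obtain ⟨z, hz⟩ := exists_add_of_le h
        exact ⟨z, fun _ => hz⟩
      · exact ⟨0, fun h' => (h h').elim⟩
  exact ⟨F, hF, fun m n => (hF' m n).1⟩

/-! ### Sets of the model given by recursive relations and functions -/

theorem setOf_mem_sets (P : M.Num → Prop) [h : IsDel fun v => P (v 0)] : {n | P n} ∈ M.sets :=
  have := h.co
  delta_comprehension P

/-- The graph of a function. -/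
def graph (F : M.Num → M.Num) : Set M.Num := {z | ∃ n, z = pair n (F n)}

omit hM in
theorem mem_graph {F : M.Num → M.Num} {z : M.Num} : z ∈ graph F ↔ ∃ n, z = pair n (F n) := Iff.rfl

theorem pair_mem_graph {F : M.Num → M.Num} {n m : M.Num} : pair n m ∈ graph F ↔ m = F n := by
  rw [mem_graph]
  constructor
  · rintro ⟨k, hk⟩
    obtain ⟨rfl, rfl⟩ := pair_inj.1 hk
    rfl
  · rintro rfl
    exact ⟨n, rfl⟩

theorem graph_mem_sets (F : M.Num → M.Num) [IsRec1 F] : graph F ∈ M.sets := by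
  convert! setOf_mem_sets fun z => ∃ n, n < z + 1 ∧ z = pair n (F n) using 1
  ext z
  refine ⟨?_, fun ⟨n, _, hn⟩ => ⟨n, hn⟩⟩
  rintro ⟨n, rfl⟩
  exact ⟨n, Num.lt_add_one_iff.2 (le_pair_left _ _), rfl⟩

theorem isFun_graph (F : M.Num → M.Num) : IsFun (graph F) :=
  ⟨fun _ ⟨n, h⟩ => ⟨n, F n, h⟩, fun n => ⟨F n, pair_mem_graph.2 rfl, fun _ => pair_mem_graph.1⟩⟩

/-- The functions of the model are recursive. -/
theorem IsFun.exists_rec {f : Set M.Num} (hf : IsFun f) (hfM : f ∈ M.sets) :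
    ∃ F : M.Num → M.Num, IsRec1 F ∧ ∀ n m, pair n m ∈ f ↔ m = F n := by
  choose F hF hF' using hf.2
  have key : ∀ n m, pair n m ∈ f ↔ m = F n := fun n m =>
    ⟨hF' n m, fun h => by rw [h]; exact hF n⟩
  have := IsRel1.mem hfM
  exact ⟨F, ⟨.of_graph (fun v y => pair (v 0) y ∈ f) fun v y => (key _ _).symm⟩, key⟩

/-! ### Powers of two -/

theorem exists_twoPow : ∃ F : M.Num → M.Num, IsRec1 F ∧ F 0 = 1 ∧ ∀ n, F (n + 1) = F n + F n := by
  have h₁ : IsRec1 fun _ : M.Num => (1 : M.Num) := ⟨inferInstance⟩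
  have h₃ : IsRec3 fun _ _ y : M.Num => y + y := ⟨inferInstance⟩
  obtain ⟨F, hF, hF₀, hF₁⟩ := exists_primrec (fun _ : M.Num => 1) (fun _ _ y => y + y)
  exact ⟨F 0, ⟨inferInstance⟩, hF₀ 0, hF₁ 0⟩

/-- Any function witnessing `IsPow2` agrees with `F` by induction, and the graph of `F` is itself
such a witness. -/
theorem isPow2_iff {F : M.Num → M.Num} [IsRec1 F] (h₀ : F 0 = 1)
    (h₁ : ∀ n, F (n + 1) = F n + F n) (k y : M.Num) : IsPow2 k y ↔ y = F k := by
  constructor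
  · rintro ⟨f, hfM, hf, hf₀, hf₁, hk⟩
    have := IsRel1.mem hfM
    have key := del_induction (fun n => pair n (F n) ∈ f) (by simpa only [h₀] using hf₀)
      (fun n hn => by simpa only [h₁] using hf₁ n _ hn) k
    exact (hf.2 k).unique hk key
  · rintro rfl
    refine ⟨graph F, graph_mem_sets F, isFun_graph F, pair_mem_graph.2 h₀.symm, fun n m h => ?_,
      pair_mem_graph.2 rfl⟩
    rw [pair_mem_graph] at h ⊢
    rw [h₁, h]

theorem pow2_eq {F : M.Num → M.Num} [IsRec1 F] (h₀ : F 0 = 1)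
    (h₁ : ∀ n, F (n + 1) = F n + F n) : pow2 = F := by
  funext k
  simp only [pow2, isPow2_iff h₀ h₁]
  exact @Classical.epsilon_spec _ (fun y => y = F k) ⟨F k, rfl⟩

instance IsRec1.pow2 : IsRec1 (pow2 (M := M)) := by
  obtain ⟨F, hF, h₀, h₁⟩ := exists_twoPow (M := M)
  rwa [pow2_eq h₀ h₁]

theorem pow2_zero : pow2 (0 : M.Num) = 1 := by
  obtain ⟨F, hF, h₀, h₁⟩ := exists_twoPow (M := M)
  rwa [pow2_eq h₀ h₁]

theorem pow2_succ (n : M.Num) : pow2 (n + 1) = pow2 n + pow2 n := by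
  obtain ⟨F, hF, h₀, h₁⟩ := exists_twoPow (M := M)
  rw [pow2_eq h₀ h₁, h₁]

theorem succ_le_pow2 (n : M.Num) : n + 1 ≤ pow2 n := by
  refine del_induction (fun n => n + 1 ≤ pow2 n) ?_ (fun n hn => ?_) n
  · rw [pow2_zero, zero_add]
  · show n + 1 + 1 ≤ pow2 (n + 1)
    rw [pow2_succ]
    exact add_le_add hn (le_add_self.trans hn)

theorem pow2_pos (n : M.Num) : 0 < pow2 n :=
  (Num.lt_succ_self' n).trans_le (succ_le_pow2 n) |>.trans_le' zero_le

theorem pow2_add (m n : M.Num) : pow2 (m + n) = pow2 m * pow2 n := by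
  refine del_induction (fun n => pow2 (m + n) = pow2 m * pow2 n) ?_ (fun n hn => ?_) n
  · rw [pow2_zero, add_zero, mul_one]
  · show pow2 (m + (n + 1)) = pow2 m * pow2 (n + 1)
    rw [← add_assoc, pow2_succ, hn, pow2_succ, mul_add]

/-- The rational number `2 ^ (-k)`. -/
noncomputable def eps (k : M.Num) : M.RatField := (toRat (pow2 k))⁻¹

theorem eps_pos (k : M.Num) : 0 < eps k := inv_pos.2 (toRat_pos.2 (pow2_pos k))

theorem eps_zero : eps (0 : M.Num) = 1 := by rw [eps, pow2_zero, map_one, inv_one]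

theorem eps_add (m n : M.Num) : eps (m + n) = eps m * eps n := by
  rw [eps, pow2_add, map_mul, mul_inv, eps, eps]

theorem eps_one : eps (1 : M.Num) = 1 / 2 := by
  rw [eps, ← zero_add (1 : M.Num), pow2_succ, pow2_zero, map_add, map_one, one_add_one_eq_two,
    one_div]

theorem eps_succ (n : M.Num) : eps (n + 1) = eps n / 2 := by
  rw [eps_add, eps_one, mul_one_div]

theorem toRat_mul_eps_le_one (n : M.Num) : toRat n * eps n ≤ 1 := by
  rw [eps, ← div_eq_mul_inv, div_le_one (toRat_pos.2 (pow2_pos n)), FracField.of_le_of]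
  exact le_self_add.trans (succ_le_pow2 n)

theorem eps_le_one (n : M.Num) : eps n ≤ 1 := by
  rw [eps]
  refine inv_le_one_of_one_le₀ ?_
  rw [← map_one toRat, FracField.of_le_of]
  exact le_add_self.trans (succ_le_pow2 n)

theorem eps_anti {m n : M.Num} (h : m ≤ n) : eps n ≤ eps m := by
  obtain ⟨c, rfl⟩ := exists_add_of_le h
  rw [eps_add]
  exact mul_le_of_le_one_right (eps_pos m).le (eps_le_one c)

theorem exists_toRat_ge (x : M.RatField) : ∃ n : M.Num, |x| ≤ toRat n := by
  obtain ⟨p, n, d, hd, rfl⟩ := FracField.exists_eq_div x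
  refine ⟨p + n, ?_⟩
  have hd' : 1 ≤ toRat d := by
    rw [← map_one toRat, FracField.of_le_of, ← zero_add (1 : M.Num), Num.add_one_le_iff]
    exact hd
  have hp := toRat_nonneg p
  have hn := toRat_nonneg n
  rw [abs_div, abs_of_pos (zero_lt_one.trans_le hd'), div_le_iff₀ (zero_lt_one.trans_le hd'),
    map_add]
  calc |toRat p - toRat n| ≤ toRat p + toRat n := by rw [abs_le]; constructor <;> linarith
    _ ≤ _ := le_mul_of_one_le_right (by positivity) hd'

/-- The rationals of `M` are Archimedean with respect to the numbers of `M`, and `2 ^ n` exceeds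
`n`. -/
theorem exists_mul_eps_lt (C : M.RatField) {x : M.RatField} (hx : 0 < x) (m : M.Num) :
    ∃ j, m ≤ j ∧ C * eps j < x := by
  obtain ⟨n, hn⟩ := exists_toRat_ge (C / x)
  have h₁ : C / x < toRat (pow2 (m + n)) := by
    refine ((le_abs_self _).trans hn).trans_lt (FracField.of_lt_of.2 ?_)
    rw [← Num.add_one_le_iff]
    refine le_trans ?_ (succ_le_pow2 _)
    gcongr
    exact le_add_self
  refine ⟨m + n, le_self_add, ?_⟩
  rw [eps, ← div_eq_mul_inv, div_lt_iff₀ (toRat_pos.2 (pow2_pos _))]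
  rwa [div_lt_iff₀' hx] at h₁

/-- A limit of inequalities. -/
theorem le_of_forall_eps {x y C : M.RatField} (m : M.Num) (h : ∀ j, m ≤ j → x ≤ y + C * eps j) :
    x ≤ y := by
  by_contra! hlt
  obtain ⟨j, hmj, hj⟩ := exists_mul_eps_lt C (sub_pos.2 hlt) m
  have := h j hmj
  linarith

/-! ### Recursive functions with rational values -/

/-- The rational-valued function `f` is a quotient of recursive functions. -/
class IsRecQ (f : (ℕ → M.Num) → M.RatField) : Prop where
  out : ∃ p n d : (ℕ → M.Num) → M.Num, IsRec p ∧ IsRec n ∧ IsRec d ∧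
    ∀ v, 0 < d v ∧ f v = (toRat (p v) - toRat (n v)) / toRat (d v)

class IsRecQ1 (F : M.Num → M.RatField) : Prop where
  out : IsRecQ fun v : ℕ → M.Num => F (v 0)

class IsRecQ2 (F : M.Num → M.Num → M.RatField) : Prop where
  out : IsRecQ fun v : ℕ → M.Num => F (v 0) (v 1)

omit hM in
theorem IsRec.comp_subst {f : (ℕ → M.Num) → M.Num} (hf : IsRec f)
    (F : (ℕ → M.Num) → (ℕ → M.Num)) (ρ : ℕ → ℕ ⊕ M.Num)
    (hF : ∀ v i, F v i = Sum.elim v id (ρ i)) : IsRec fun v => f (F v) :=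
  ⟨hf.out.comp_subst (fun v i => match i with
    | 0 => v 0
    | i + 1 => F (fun j => v (j + 1)) i)
    (fun i => match i with
    | 0 => .inl 0
    | i + 1 => Sum.map (· + 1) id (ρ i)) fun v i => by
      rcases i with _ | i
      · rfl
      · dsimp only
        rw [hF]
        rcases ρ i <;> rfl⟩

theorem IsRecQ2.exists_rec (F : M.Num → M.Num → M.RatField) [hF : IsRecQ2 F] :
    ∃ p n d : M.Num → M.Num → M.Num, IsRec2 p ∧ IsRec2 n ∧ IsRec2 d ∧
      ∀ x y, 0 < d x y ∧ F x y = (toRat (p x y) - toRat (n x y)) / toRat (d x y) := by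
  obtain ⟨p, n, d, hp, hn, hd, h⟩ := hF.out.out
  have key : ∀ f : (ℕ → M.Num) → M.Num, IsRec f →
      IsRec2 fun x y => f (assignCons x fun _ => y) := fun f hf =>
    ⟨hf.comp_subst (fun v => assignCons (v 0) fun _ => v 1)
      (fun i => .inl (if i = 0 then 0 else 1)) fun v i => by cases i <;> rfl⟩
  exact ⟨_, _, _, key p hp, key n hn, key d hd, fun x y => h (assignCons x fun _ => y)⟩

instance IsRecQ.fun2 (F : M.Num → M.Num → M.RatField) [IsRecQ2 F] (f g : (ℕ → M.Num) → M.Num)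
    [IsRec f] [IsRec g] : IsRecQ fun v => F (f v) (g v) := by
  obtain ⟨p, n, d, hp, hn, hd, h⟩ := IsRecQ2.exists_rec F
  exact ⟨fun v => p (f v) (g v), fun v => n (f v) (g v), fun v => d (f v) (g v), inferInstance,
    inferInstance, inferInstance, fun v => h _ _⟩

instance IsRecQ.fun1 (F : M.Num → M.RatField) [hF : IsRecQ1 F] (f : (ℕ → M.Num) → M.Num)
    [IsRec f] : IsRecQ fun v => F (f v) :=
  have : IsRecQ2 fun x (_ : M.Num) => F x := ⟨hF.out⟩
  IsRecQ.fun2 (fun x _ => F x) f f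

instance IsRecQ.cast (f : (ℕ → M.Num) → M.Num) [IsRec f] : IsRecQ fun v => toRat (f v) :=
  ⟨f, fun _ => 0, fun _ => 1, inferInstance, inferInstance, inferInstance, fun v =>
    ⟨one_pos, by simp⟩⟩

instance (priority := low) IsRecQ.const (c : M.RatField) : IsRecQ fun _ : ℕ → M.Num => c := by
  obtain ⟨p, n, d, hd, h⟩ := FracField.exists_eq_div c
  exact ⟨fun _ => p, fun _ => n, fun _ => d, inferInstance, inferInstance, inferInstance, fun v =>
    ⟨hd, h⟩⟩

instance IsRecQ.neg (f : (ℕ → M.Num) → M.RatField) [hf : IsRecQ f] : IsRecQ fun v => -f v := by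
  obtain ⟨p, n, d, hp, hn, hd, h⟩ := hf.out
  exact ⟨n, p, d, hn, hp, hd, fun v => ⟨(h v).1, by rw [(h v).2, ← neg_div, neg_sub]⟩⟩

instance IsRecQ.add (f g : (ℕ → M.Num) → M.RatField) [hf : IsRecQ f] [hg : IsRecQ g] :
    IsRecQ fun v => f v + g v := by
  obtain ⟨p, n, d, hp, hn, hd, h⟩ := hf.out
  obtain ⟨p', n', d', hp', hn', hd', h'⟩ := hg.out
  refine ⟨fun v => p v * d' v + p' v * d v, fun v => n v * d' v + n' v * d v,
    fun v => d v * d' v, inferInstance, inferInstance, inferInstance, fun v =>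
    ⟨mul_pos (h v).1 (h' v).1, ?_⟩⟩
  have h₁ := (toRat_pos.2 (h v).1).ne'
  have h₂ := (toRat_pos.2 (h' v).1).ne'
  rw [(h v).2, (h' v).2]
  simp only [map_add, map_mul]
  field_simp
  ring

instance IsRecQ.sub (f g : (ℕ → M.Num) → M.RatField) [hf : IsRecQ f] [hg : IsRecQ g] :
    IsRecQ fun v => f v - g v := by
  simpa only [sub_eq_add_neg] using IsRecQ.add f fun v => -g v

instance IsRecQ.mul (f g : (ℕ → M.Num) → M.RatField) [hf : IsRecQ f] [hg : IsRecQ g] :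
    IsRecQ fun v => f v * g v := by
  obtain ⟨p, n, d, hp, hn, hd, h⟩ := hf.out
  obtain ⟨p', n', d', hp', hn', hd', h'⟩ := hg.out
  refine ⟨fun v => p v * p' v + n v * n' v, fun v => p v * n' v + n v * p' v,
    fun v => d v * d' v, inferInstance, inferInstance, inferInstance, fun v =>
    ⟨mul_pos (h v).1 (h' v).1, ?_⟩⟩
  have h₁ := (toRat_pos.2 (h v).1).ne'
  have h₂ := (toRat_pos.2 (h' v).1).ne'
  rw [(h v).2, (h' v).2]
  simp only [map_add, map_mul]
  field_simp
  ring

instance IsDel.leRat (f g : (ℕ → M.Num) → M.RatField) [hf : IsRecQ f] [hg : IsRecQ g] :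
    IsDel fun v => f v ≤ g v := by
  obtain ⟨p, n, d, hp, hn, hd, h⟩ := hf.out
  obtain ⟨p', n', d', hp', hn', hd', h'⟩ := hg.out
  refine IsDel.congr (P := fun v => p v * d' v + n' v * d v ≤ p' v * d v + n v * d' v)
    inferInstance fun v => ?_
  rw [(h v).2, (h' v).2, div_le_div_iff₀ (toRat_pos.2 (h v).1) (toRat_pos.2 (h' v).1),
    ← FracField.of_le_of (N := M.Num)]
  simp only [map_add, map_mul]
  constructor <;> intro h <;> linarith

instance IsRecQ.ite (P : (ℕ → M.Num) → Prop) (f g : (ℕ → M.Num) → M.RatField) [hP : IsDel P]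
    [hf : IsRecQ f] [hg : IsRecQ g] [∀ v, Decidable (P v)] :
    IsRecQ fun v => if P v then f v else g v := by
  obtain ⟨p, n, d, hp, hn, hd, h⟩ := hf.out
  obtain ⟨p', n', d', hp', hn', hd', h'⟩ := hg.out
  refine ⟨fun v => if P v then p v else p' v, fun v => if P v then n v else n' v,
    fun v => if P v then d v else d' v, inferInstance, inferInstance, inferInstance, fun v => ?_⟩
  by_cases hv : P v <;> simp [hv, h, h']

instance IsRecQ.absRat (f : (ℕ → M.Num) → M.RatField) [hf : IsRecQ f] : IsRecQ fun v => |f v| := by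
  have : IsRecQ fun v => if 0 ≤ f v then f v else -f v := inferInstance
  convert! this using 2 with v
  split_ifs with h
  exacts [abs_of_nonneg h, abs_of_neg (not_le.1 h)]

/-- The sign of a rational is decidable, and `exists_sub` computes the absolute value of the
difference in the numerator, which becomes the new denominator. In the zero case the value is `0 /
1`. -/
instance IsRecQ.inv (f : (ℕ → M.Num) → M.RatField) [hf : IsRecQ f] : IsRecQ fun v => (f v)⁻¹ := by
  obtain ⟨p, n, d, hp, hn, hd, h⟩ := hf.out
  obtain ⟨S, hS, hS'⟩ := exists_sub (M := M)
  refine ⟨fun v => if n v < p v then d v else 0, fun v => if p v < n v then d v else 0,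
    fun v => if n v < p v then S (p v) (n v) else if p v < n v then S (n v) (p v) else 1,
    inferInstance, inferInstance, inferInstance, fun v => ?_⟩
  have hsub : ∀ {a b : M.Num}, a < b → 0 < S b a ∧ toRat b - toRat a = toRat (S b a) :=
    fun {a b} hab => by
      have h₁ := hS' b a hab.le
      refine ⟨Num.pos_of_ne_zero fun h₂ => hab.ne ?_, ?_⟩
      · rw [h₁, h₂, add_zero]
      · nth_rewrite 1 [h₁]
        rw [map_add, add_sub_cancel_left]
  rw [(h v).2]
  dsimp only
  rcases lt_trichotomy (n v) (p v) with hlt | heq | hlt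
  · rw [if_pos hlt, if_pos hlt, if_neg hlt.not_gt]
    refine ⟨(hsub hlt).1, ?_⟩
    rw [map_zero, sub_zero, inv_div, (hsub hlt).2]
  · simp [heq]
  · rw [if_neg hlt.not_gt, if_neg hlt.not_gt, if_pos hlt, if_pos hlt]
    refine ⟨(hsub hlt).1, ?_⟩
    rw [map_zero, zero_sub, inv_div, ← (hsub hlt).2, ← neg_sub (toRat (n v)), div_neg, neg_div]

instance IsRecQ.div (f g : (ℕ → M.Num) → M.RatField) [hf : IsRecQ f] [hg : IsRecQ g] :
    IsRecQ fun v => f v / g v := by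
  simpa only [div_eq_mul_inv] using IsRecQ.mul f fun v => (g v)⁻¹

instance IsRecQ1.instEps : IsRecQ1 (eps (M := M)) :=
  ⟨inferInstanceAs (IsRecQ fun v : ℕ → M.Num => (toRat (pow2 (v 0)))⁻¹)⟩

/-- Finite sums of rationals. -/
theorem exists_sum (F : M.Num → M.Num → M.RatField) [IsRecQ2 F] :
    ∃ S : M.Num → M.Num → M.RatField, IsRecQ2 S ∧ (∀ p, S p 0 = 0) ∧
      ∀ p n, S p (n + 1) = S p n + F p n := by
  obtain ⟨p, n, d, hp, hn, hd, h⟩ := IsRecQ2.exists_rec F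
  have h₁ : IsRec1 fun _ : M.Num => (1 : M.Num) := ⟨inferInstance⟩
  have h₀ : IsRec1 fun _ : M.Num => (0 : M.Num) := ⟨inferInstance⟩
  have h₃ : IsRec3 fun x i y : M.Num => y * d x i := ⟨inferInstance⟩
  -- `D x i` is the product of the first `i` denominators. Over this common denominator both parts
  -- of the numerator are primitive recursive.
  obtain ⟨D, hD, hD₀, hD₁⟩ := exists_primrec (fun _ : M.Num => 1) (fun x i y => y * d x i)
  have h₄ : IsRec3 fun x i y : M.Num => y * d x i + p x i * D x i := ⟨inferInstance⟩
  have h₅ : IsRec3 fun x i y : M.Num => y * d x i + n x i * D x i := ⟨inferInstance⟩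
  obtain ⟨P, hP, hP₀, hP₁⟩ := exists_primrec (fun _ : M.Num => 0)
    (fun x i y => y * d x i + p x i * D x i)
  obtain ⟨N, hN, hN₀, hN₁⟩ := exists_primrec (fun _ : M.Num => 0)
    (fun x i y => y * d x i + n x i * D x i)
  have hDpos : ∀ x i, 0 < D x i := fun x i => del_induction (fun i => 0 < D x i)
    (by rw [hD₀]; exact one_pos) (fun i hi => by rw [hD₁]; exact mul_pos hi (h x i).1) i
  refine ⟨fun x i => (toRat (P x i) - toRat (N x i)) / toRat (D x i), ⟨inferInstance⟩,
    fun x => by simp [hP₀, hN₀], fun x i => ?_⟩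
  have h₁ := (toRat_pos.2 (h x i).1).ne'
  have h₂ := (toRat_pos.2 (hDpos x i)).ne'
  dsimp only
  rw [hP₁, hN₁, hD₁, (h x i).2]
  simp only [map_add, map_mul]
  field_simp
  ring

theorem IsRecQ2.exists_bound (F : M.Num → M.Num → M.RatField) [IsRecQ2 F] :
    ∃ B : M.Num → M.Num → M.Num, IsRec2 B ∧ ∀ x y, |F x y| ≤ toRat (B x y) := by
  obtain ⟨p, n, d, hp, hn, hd, h⟩ := IsRecQ2.exists_rec F
  refine ⟨fun x y => p x y + n x y, ⟨inferInstance⟩, fun x y => ?_⟩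
  have hd' : 1 ≤ toRat (d x y) := by
    rw [← map_one toRat, FracField.of_le_of, ← zero_add (1 : M.Num), Num.add_one_le_iff]
    exact (h x y).1
  have hp := toRat_nonneg (p x y)
  have hn := toRat_nonneg (n x y)
  rw [(h x y).2, abs_div, abs_of_pos (zero_lt_one.trans_le hd'),
    div_le_iff₀ (zero_lt_one.trans_le hd'), map_add]
  calc |toRat (p x y) - toRat (n x y)| ≤ toRat (p x y) + toRat (n x y) := by
        rw [abs_le]; constructor <;> linarith
    _ ≤ _ := le_mul_of_one_le_right (by positivity) hd'

theorem IsRecQ1.exists_bound (F : M.Num → M.RatField) [hF : IsRecQ1 F] :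
    ∃ B : M.Num → M.Num, IsRec1 B ∧ ∀ x, |F x| ≤ toRat (B x) := by
  have : IsRecQ2 fun x (_ : M.Num) => F x := ⟨hF.out⟩
  obtain ⟨B, hB, h⟩ := IsRecQ2.exists_bound fun x (_ : M.Num) => F x
  exact ⟨fun x => B x 0, ⟨inferInstance⟩, fun x => h x 0⟩

/-- The values of a recursive function on a bounded interval are bounded. -/
theorem IsRecQ1.exists_uniform_bound (F : M.Num → M.RatField) [hF : IsRecQ1 F] (N : M.Num) :
    ∃ B : M.RatField, ∀ n ≤ N, |F n| ≤ B := by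
  obtain ⟨C, hC⟩ := sig_induction (fun N => ∃ C, ∀ n, n < N → |F n| ≤ toRat C)
    ⟨0, fun n hn => (not_lt_zero hn).elim⟩ (fun k ⟨C, hC⟩ => by
      obtain ⟨D, hD⟩ := exists_toRat_ge (F k)
      refine ⟨C + D, fun n hn => ?_⟩
      rw [map_add]
      rcases (Num.lt_add_one_iff.1 hn).eq_or_lt with rfl | hn
      · linarith [toRat_nonneg C]
      · linarith [toRat_nonneg D, hC n hn]) (N + 1)
  exact ⟨toRat C, fun n hn => hC n (Num.lt_add_one_iff.2 hn)⟩

/-! ### Fractions -/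

namespace Fraction

/-- The rational number presented by a fraction. -/
noncomputable def val (q : M.Fraction) : M.RatField :=
  (toRat q.pos - toRat q.neg) / toRat q.den

variable {q r : M.Fraction}

theorem IsRat.toRat_pos (hq : q.IsRat) : 0 < toRat q.den := L2Structure.toRat_pos.2 hq

theorem IsRat.add (hq : q.IsRat) (hr : r.IsRat) : (q + r).IsRat := mul_pos (a := q.den) hq hr

theorem IsRat.sub (hq : q.IsRat) (hr : r.IsRat) : (q - r).IsRat := mul_pos (a := q.den) hq hr

theorem IsRat.mul (hq : q.IsRat) (hr : r.IsRat) : (q * r).IsRat := mul_pos (a := q.den) hq hr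

omit hM in
theorem IsRat.abs (hq : q.IsRat) : q.abs.IsRat := by
  rw [Fraction.abs]
  split_ifs
  exacts [hq, hq]

theorem isRat_ofNum (n : M.Num) : (ofNum n).IsRat := one_pos (α := M.Num)

theorem isRat_twoNeg (k : M.Num) : (twoNeg k).IsRat := pow2_pos k

theorem isRat_twoNegSucc (k : M.Num) : (twoNegSucc k).IsRat := pow2_pos k

theorem val_add (hq : q.IsRat) (hr : r.IsRat) : (q + r).val = q.val + r.val := by
  have h₁ := hq.toRat_pos.ne'
  have h₂ := hr.toRat_pos.ne'
  show (toRat (q.pos * r.den + r.pos * q.den) - toRat (q.neg * r.den + r.neg * q.den)) /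
    toRat (q.den * r.den) = _
  simp only [val, map_add, map_mul]
  field_simp
  ring

theorem val_sub (hq : q.IsRat) (hr : r.IsRat) : (q - r).val = q.val - r.val := by
  have h₁ := hq.toRat_pos.ne'
  have h₂ := hr.toRat_pos.ne'
  show (toRat (q.pos * r.den + r.neg * q.den) - toRat (q.neg * r.den + r.pos * q.den)) /
    toRat (q.den * r.den) = _
  simp only [val, map_add, map_mul]
  field_simp
  ring

theorem val_mul (hq : q.IsRat) (hr : r.IsRat) : (q * r).val = q.val * r.val := by
  have h₁ := hq.toRat_pos.ne'
  have h₂ := hr.toRat_pos.ne'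
  show (toRat (q.pos * r.pos + q.neg * r.neg) - toRat (q.pos * r.neg + q.neg * r.pos)) /
    toRat (q.den * r.den) = _
  simp only [val, map_add, map_mul]
  field_simp
  ring

theorem val_abs (hq : q.IsRat) : q.abs.val = |q.val| := by
  have h := hq.toRat_pos
  rw [Fraction.abs]
  split_ifs with h'
  · rw [← FracField.of_lt_of (N := M.Num), ← sub_neg] at h'
    rw [val, val, abs_of_neg (div_neg_of_neg_of_pos h' h), ← neg_div, neg_sub]
  · rw [← FracField.of_lt_of (N := M.Num), ← sub_neg, not_lt] at h'
    rw [val, abs_of_nonneg (div_nonneg h' h.le)]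

theorem val_ofNum (n : M.Num) : (ofNum n).val = toRat n := by simp [val, ofNum]

theorem val_twoNeg (k : M.Num) : (twoNeg k).val = eps k := by simp [val, twoNeg, eps]

theorem val_twoNegSucc (k : M.Num) : (twoNegSucc k).val = 2 * eps k := by
  show (toRat (1 + 1) - toRat 0) / toRat (pow2 k) = 2 * eps k
  rw [map_add, map_one, one_add_one_eq_two, map_zero, sub_zero, div_eq_mul_inv, eps]

theorem le_iff_val (hq : q.IsRat) (hr : r.IsRat) : q ≤ r ↔ q.val ≤ r.val := by
  show q.pos * r.den + r.neg * q.den ≤ r.pos * q.den + q.neg * r.den ↔ _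
  rw [val, val, div_le_div_iff₀ hq.toRat_pos hr.toRat_pos, ← FracField.of_le_of (N := M.Num)]
  simp only [map_add, map_mul]
  constructor <;> intro h <;> linarith

theorem code_inj : q.code = r.code ↔ q = r := by
  rw [code, code, pair_inj, pair_inj, and_assoc, Fraction.ext_iff]

end Fraction

/-! ### Regular sequences of rationals -/

/-- A sequence of rationals that presents a real number. -/
def Regular (f : M.Num → M.RatField) : Prop := ∀ k i, |f k - f (k + i)| ≤ eps k

/-- Two sequences of rationals approximate each other at the rate `2 ^ (-k)`. -/
def Near (f g : M.Num → M.RatField) : Prop := ∃ C, ∀ k, |f k - g k| ≤ C * eps k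

theorem abs_mul_sub_mul_le (a b c d : M.RatField) :
    |a * b - c * d| ≤ |a| * |b - d| + |a - c| * |d| := by
  rw [← abs_mul, ← abs_mul, show a * b - c * d = a * (b - d) + (a - c) * d by ring]
  exact abs_add_le _ _

namespace Regular

variable {f g : M.Num → M.RatField}

theorem abs_sub_le (hf : Regular f) {k j : M.Num} (h : k ≤ j) : |f k - f j| ≤ eps k := by
  obtain ⟨i, rfl⟩ := exists_add_of_le h
  exact hf k i

theorem bound (hf : Regular f) (k : M.Num) : |f k| ≤ |f 0| + 1 := by
  have h := hf.abs_sub_le (zero_le (a := k))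
  rw [eps_zero, abs_sub_comm] at h
  linarith [abs_sub_abs_le_abs_sub (f k) (f 0)]

/-- Pass from `k` to a large `j`, compare there, and return: regularity costs `eps k` twice, while
`C * eps j` vanishes in the limit. This is why the constant in `Near` is irrelevant. -/
theorem le_of_le_add_mul_eps (hf : Regular f) (hg : Regular g) {C : M.RatField} (m : M.Num)
    (h : ∀ k, m ≤ k → f k ≤ g k + C * eps k) (k : M.Num) : f k ≤ g k + 2 * eps k := by
  refine le_of_forall_eps (C := C) (max m k) fun j hj => ?_
  have h₁ := abs_sub_le_iff.1 (hf.abs_sub_le (le_of_max_le_right hj))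
  have h₂ := abs_sub_le_iff.1 (hg.abs_sub_le (le_of_max_le_right hj))
  linarith [h j (le_of_max_le_left hj)]

theorem abs_sub_le_of_near (hf : Regular f) (hg : Regular g) (h : Near f g) (k : M.Num) :
    |f k - g k| ≤ 2 * eps k := by
  obtain ⟨C, hC⟩ := h
  rw [abs_sub_le_iff]
  constructor
  · linarith [hf.le_of_le_add_mul_eps hg 0
      (fun k _ => by linarith [(abs_sub_le_iff.1 (hC k)).1]) k]
  · linarith [hg.le_of_le_add_mul_eps hf 0
      (fun k _ => by linarith [(abs_sub_le_iff.1 (hC k)).2]) k]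

theorem const (c : M.RatField) : Regular fun _ : M.Num => c := fun k _ => by
  rw [sub_self, abs_zero]
  exact (eps_pos k).le

theorem add (hf : Regular f) (hg : Regular g) : Regular fun k => f (k + 1) + g (k + 1) := by
  intro k i
  have h₁ := abs_le.1 (hf.abs_sub_le (show k + 1 ≤ k + i + 1 by gcongr; exact le_self_add))
  have h₂ := abs_le.1 (hg.abs_sub_le (show k + 1 ≤ k + i + 1 by gcongr; exact le_self_add))
  rw [eps_succ] at h₁ h₂
  rw [abs_le]
  constructor <;> linarith

theorem sub (hf : Regular f) (hg : Regular g) : Regular fun k => f (k + 1) - g (k + 1) := by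
  intro k i
  have h₁ := abs_le.1 (hf.abs_sub_le (show k + 1 ≤ k + i + 1 by gcongr; exact le_self_add))
  have h₂ := abs_le.1 (hg.abs_sub_le (show k + 1 ≤ k + i + 1 by gcongr; exact le_self_add))
  rw [eps_succ] at h₁ h₂
  rw [abs_le]
  constructor <;> linarith

theorem abs (hf : Regular f) : Regular fun k => |f k| := fun k i =>
  (abs_abs_sub_abs_le _ _).trans (hf k i)

theorem mul_sub_mul_le (hf : Regular f) (hg : Regular g) {k j : M.Num} (h : k ≤ j) :
    |f k * g k - f j * g j| ≤ (|f 0| + |g 0| + 2) * eps k := by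
  have h₁ := hf.abs_sub_le h
  have h₂ := hg.abs_sub_le h
  have h₃ := hf.bound k
  have h₄ := hg.bound j
  have h₅ := eps_pos k
  have h₆ : 0 ≤ |f 0| + 1 := by positivity
  calc |f k * g k - f j * g j| ≤ |f k| * |g k - g j| + |f k - f j| * |g j| :=
        abs_mul_sub_mul_le _ _ _ _
    _ ≤ (|f 0| + 1) * eps k + eps k * (|g 0| + 1) := by gcongr
    _ = (|f 0| + |g 0| + 2) * eps k := by ring

theorem mul (hf : Regular f) (hg : Regular g) {n : M.Num}
    (hn : |f 0| + |g 0| + 2 ≤ toRat (pow2 n)) : Regular fun k => f (n + k) * g (n + k) := by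
  intro k i
  have h₅ := eps_pos (n + k)
  calc |f (n + k) * g (n + k) - f (n + (k + i)) * g (n + (k + i))|
      ≤ (|f 0| + |g 0| + 2) * eps (n + k) :=
        hf.mul_sub_mul_le hg (by gcongr; exact le_self_add)
    _ ≤ toRat (pow2 n) * eps (n + k) := by gcongr
    _ = eps k := by
      rw [eps_add, ← mul_assoc, eps, mul_inv_cancel₀ (toRat_pos.2 (pow2_pos n)).ne', one_mul]

theorem near_shift (hf : Regular f) (m : M.Num) : Near (fun k => f (m + k)) f :=
  ⟨1, fun k => by
    rw [one_mul, abs_sub_comm]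
    exact hf.abs_sub_le le_add_self⟩

end Regular

namespace Near

variable {f g h f' g' : M.Num → M.RatField}

theorem refl (f : M.Num → M.RatField) : Near f f := ⟨0, fun k => by simp⟩

theorem symm (h : Near f g) : Near g f := by
  obtain ⟨C, hC⟩ := h
  exact ⟨C, fun k => by rw [abs_sub_comm]; exact hC k⟩

theorem trans (h₁ : Near f g) (h₂ : Near g h) : Near f h := by
  obtain ⟨C, hC⟩ := h₁
  obtain ⟨D, hD⟩ := h₂
  exact ⟨C + D, fun k => by
    rw [add_mul]
    exact (abs_sub_le _ _ _).trans (add_le_add (hC k) (hD k))⟩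

theorem add (h₁ : Near f g) (h₂ : Near f' g') :
    Near (fun k => f k + f' k) fun k => g k + g' k := by
  obtain ⟨C, hC⟩ := h₁
  obtain ⟨D, hD⟩ := h₂
  refine ⟨C + D, fun k => ?_⟩
  rw [add_mul, add_sub_add_comm]
  exact (abs_add_le _ _).trans (add_le_add (hC k) (hD k))

theorem mul (h₁ : Near f g) (h₂ : Near f' g') {A B : M.RatField} (hA : ∀ k, |f k| ≤ A)
    (hB : ∀ k, |g' k| ≤ B) : Near (fun k => f k * f' k) fun k => g k * g' k := by
  obtain ⟨C, hC⟩ := h₁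
  obtain ⟨D, hD⟩ := h₂
  refine ⟨A * D + C * B, fun k => ?_⟩
  have h₁ : 0 ≤ A := (abs_nonneg _).trans (hA 0)
  have h₂ : 0 ≤ C * eps k := (abs_nonneg _).trans (hC k)
  calc |f k * f' k - g k * g' k| ≤ |f k| * |f' k - g' k| + |f k - g k| * |g' k| :=
        abs_mul_sub_mul_le _ _ _ _
    _ ≤ A * (D * eps k) + C * eps k * B := by
        gcongr
        exacts [hA k, hD k, hC k, hB k]
    _ = _ := by ring

end Near

/-! ### Presentations of real numbers -/

/-- The presentation `α` is the sequence of fractions with the values `f`, and it presents a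
real number. -/
structure Presents (α : M.Presentation) (f : M.Num → M.RatField) : Prop where
  val : ∀ k, ∃ q : M.Fraction, q.IsRat ∧ q.val = f k ∧ ∀ p, α k p ↔ p = q
  regular : Regular f

namespace Presents

variable {α β : M.Presentation} {f g : M.Num → M.RatField}

theorem const {q : M.Fraction} (hq : q.IsRat) : Presents (.const q) fun _ => q.val :=
  ⟨fun _ => ⟨q, hq, rfl, fun _ => Iff.rfl⟩, .const _⟩

theorem add (hα : Presents α f) (hβ : Presents β g) :
    Presents (α.add β) fun k => f (k + 1) + g (k + 1) := by
  refine ⟨fun k => ?_, hα.regular.add hβ.regular⟩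
  obtain ⟨q, hq, hqf, hq'⟩ := hα.val (k + 1)
  obtain ⟨r, hr, hrg, hr'⟩ := hβ.val (k + 1)
  refine ⟨q + r, hq.add hr, by rw [Fraction.val_add hq hr, hqf, hrg], fun p => ?_⟩
  simp [Presentation.add, hq', hr']

theorem sub (hα : Presents α f) (hβ : Presents β g) :
    Presents (α.sub β) fun k => f (k + 1) - g (k + 1) := by
  refine ⟨fun k => ?_, hα.regular.sub hβ.regular⟩
  obtain ⟨q, hq, hqf, hq'⟩ := hα.val (k + 1)
  obtain ⟨r, hr, hrg, hr'⟩ := hβ.val (k + 1)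
  refine ⟨q - r, hq.sub hr, by rw [Fraction.val_sub hq hr, hqf, hrg], fun p => ?_⟩
  simp [Presentation.sub, hq', hr']

theorem abs (hα : Presents α f) : Presents α.abs fun k => |f k| := by
  refine ⟨fun k => ?_, hα.regular.abs⟩
  obtain ⟨q, hq, hqf, hq'⟩ := hα.val k
  refine ⟨q.abs, hq.abs, by rw [Fraction.val_abs hq, hqf], fun p => ?_⟩
  simp [Presentation.abs, hq']

theorem mul (hα : Presents α f) (hβ : Presents β g) :
    ∃ n, Presents (α.mul β) fun k => f (n + k) * g (n + k) := by
  obtain ⟨q₀, hq₀, hqf₀, hq₀'⟩ := hα.val 0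
  obtain ⟨r₀, hr₀, hrg₀, hr₀'⟩ := hβ.val 0
  have key : ∀ m : M.Num, q₀.abs + r₀.abs + Fraction.ofNum (1 + 1) ≤ Fraction.ofNum (pow2 m) ↔
      |f 0| + |g 0| + 2 ≤ toRat (pow2 m) := fun m => by
    rw [Fraction.le_iff_val ((hq₀.abs.add hr₀.abs).add (Fraction.isRat_ofNum _))
      (Fraction.isRat_ofNum _), Fraction.val_add (hq₀.abs.add hr₀.abs) (Fraction.isRat_ofNum _),
      Fraction.val_add hq₀.abs hr₀.abs, Fraction.val_abs hq₀, Fraction.val_abs hr₀,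
      Fraction.val_ofNum, Fraction.val_ofNum, map_add, map_one, one_add_one_eq_two, hqf₀, hrg₀]
  obtain ⟨n, hn, hn'⟩ := exists_least (fun m => |f 0| + |g 0| + 2 ≤ toRat (pow2 m)) <| by
    obtain ⟨m, hm⟩ := exists_toRat_ge (|f 0| + |g 0| + 2)
    exact ⟨m, (le_abs_self _).trans (hm.trans (FracField.of_le_of.2
      (le_self_add.trans (succ_le_pow2 m))))⟩
  refine ⟨n, fun k => ?_, hα.regular.mul hβ.regular hn⟩
  obtain ⟨q, hq, hqf, hq'⟩ := hα.val (n + k)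
  obtain ⟨r, hr, hrg, hr'⟩ := hβ.val (n + k)
  refine ⟨q * r, hq.mul hr, by rw [Fraction.val_mul hq hr, hqf, hrg], fun p => ?_⟩
  constructor
  · rintro ⟨q₁, r₁, m, hq₁, hr₁, hm, hm', q₂, r₂, hq₂, hr₂, rfl⟩
    obtain rfl := (hq₀' _).1 hq₁
    obtain rfl := (hr₀' _).1 hr₁
    simp only [key] at hm hm'
    obtain rfl : m = n := le_antisymm (not_lt.1 fun h => hm' n h hn) (not_lt.1 fun h => hn' m h hm)
    rw [(hq' _).1 hq₂, (hr' _).1 hr₂]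
  · rintro rfl
    exact ⟨q₀, r₀, n, (hq₀' _).2 rfl, (hr₀' _).2 rfl, (key n).2 hn,
      fun m hm => (key m).not.2 (hn' m hm), q, r, (hq' _).2 rfl, (hr' _).2 rfl, rfl⟩

/-- The index shift in the definition of the product of reals is invisible up to `Near`. -/
theorem exists_near_mul (hα : Presents α f) (hβ : Presents β g) :
    ∃ h, Presents (α.mul β) h ∧ Near h fun k => f k * g k := by
  obtain ⟨n, hn⟩ := hα.mul hβ
  exact ⟨_, hn, (hα.regular.near_shift n).mul (hβ.regular.near_shift n)
    (fun k => hα.regular.bound _) hβ.regular.bound⟩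

theorem near_add (hα : Presents α f) (hβ : Presents β g) :
    Near (fun k => f (k + 1) + g (k + 1)) fun k => f k + g k := by
  simp only [add_comm _ (1 : M.Num)]
  exact (hα.regular.near_shift 1).add (hβ.regular.near_shift 1)

theorem le_iff (hα : Presents α f) (hβ : Presents β g) :
    α.le β ↔ ∀ k, f k ≤ g k + 2 * eps k := by
  refine forall_congr' fun k => ?_
  obtain ⟨q, hq, hqf, hq'⟩ := hα.val k
  obtain ⟨r, hr, hrg, hr'⟩ := hβ.val k
  simp only [hq', hr', forall_eq_apply_imp_iff, forall_eq]
  rw [Fraction.le_iff_val hq (hr.add (Fraction.isRat_twoNegSucc k)),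
    Fraction.val_add hr (Fraction.isRat_twoNegSucc k), Fraction.val_twoNegSucc, hqf, hrg]

/-- Regularity improves any constant in `Near` to `2`, the constant in the definition of the order
of reals. -/
theorem equal_iff (hα : Presents α f) (hβ : Presents β g) : α.equal β ↔ Near f g := by
  rw [Presentation.equal, hα.le_iff hβ, hβ.le_iff hα]
  constructor
  · rintro ⟨h₁, h₂⟩
    exact ⟨2, fun k => abs_sub_le_iff.2 ⟨by linarith [h₁ k], by linarith [h₂ k]⟩⟩
  · intro h
    have := fun k => abs_sub_le_iff.1 (hα.regular.abs_sub_le_of_near hβ.regular h k)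
    exact ⟨fun k => by linarith [(this k).1], fun k => by linarith [(this k).2]⟩

end Presents

/-! ### Sequences of real numbers -/

/-- The values of the approximations to a sequence of real numbers of the model. -/
theorem IsRealSeq.exists_presents {x : Set M.Num} (hx : IsRealSeq x) (hxM : x ∈ M.sets) :
    ∃ X : M.Num → M.Num → M.RatField, IsRecQ2 X ∧ ∀ n, Presents (term x n) (X n) := by
  obtain ⟨hx₁, hx₂, hx₃⟩ := hx
  choose q hq hq' using hx₂
  have key : ∀ n k c, c = (q n k).code ↔ pair (pair n k) c ∈ x := fun n k c => by
    constructor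
    · rintro rfl
      exact (hq n k).2
    · intro h
      obtain ⟨n', k', r, hr, hr'⟩ := hx₁ _ h
      obtain ⟨h₁, rfl⟩ := pair_inj.1 hr'
      obtain ⟨rfl, rfl⟩ := pair_inj.1 h₁
      rw [hq' n k r ⟨hr, h⟩]
  have hrel := IsRel1.mem hxM
  have hcode : IsRec2 fun n k => (q n k).code :=
    ⟨.of_graph (fun v c => pair (pair (v 0) (v 1)) c ∈ x) fun v c => key _ _ c⟩
  refine ⟨fun n k => (q n k).val, ⟨⟨fun v => fst (fst (q (v 0) (v 1)).code),
    fun v => snd (fst (q (v 0) (v 1)).code), fun v => snd (q (v 0) (v 1)).code, ?_, ?_, ?_,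
    fun v => ?_⟩⟩, fun n => ⟨fun k => ⟨q n k, (hq n k).1, rfl, fun p => ?_⟩, fun k i => ?_⟩⟩
  · have := IsRec.fun2 (fun n k => (q n k).code) (fun v => v 0) (fun v => v 1)
    infer_instance
  · have := IsRec.fun2 (fun n k => (q n k).code) (fun v => v 0) (fun v => v 1)
    infer_instance
  · have := IsRec.fun2 (fun n k => (q n k).code) (fun v => v 0) (fun v => v 1)
    infer_instance
  · simp only [Fraction.code, fst_pair, snd_pair]
    exact ⟨(hq _ _).1, rfl⟩
  · exact ⟨hq' n k p, fun h => h ▸ hq n k⟩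
  · have := hx₃ n k i _ _ (hq n k) (hq n (k + i))
    rwa [Fraction.le_iff_val ((hq n k).1.sub (hq n (k + i)).1).abs (Fraction.isRat_twoNeg k),
      Fraction.val_abs ((hq n k).1.sub (hq n (k + i)).1), Fraction.val_sub (hq n k).1
      (hq n (k + i)).1, Fraction.val_twoNeg] at this

/-- A recursive double sequence of fractions with regular rows is a sequence of reals. -/
theorem exists_isRealSeq (p m d : M.Num → M.Num → M.Num) [IsRec2 p] [IsRec2 m] [IsRec2 d]
    (hd : ∀ n k, 0 < d n k)
    (hreg : ∀ n, Regular fun k => Fraction.val ⟨p n k, m n k, d n k⟩) :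
    ∃ x ∈ M.sets, IsRealSeq x ∧ (∀ n k q, term x n k q ↔ q = ⟨p n k, m n k, d n k⟩) ∧
      ∀ n, Presents (term x n) fun k => Fraction.val ⟨p n k, m n k, d n k⟩ := by
  let x : Set M.Num := {z | ∃ n, n < z + 1 ∧ ∃ k, k < z + 1 ∧
    z = pair (pair n k) (pair (pair (p n k) (m n k)) (d n k))}
  have hterm : ∀ n k q, term x n k q ↔ q = ⟨p n k, m n k, d n k⟩ := fun n k q => by
    constructor
    · rintro ⟨-, n', -, k', -, h⟩
      obtain ⟨h₁, h₂⟩ := pair_inj.1 h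
      obtain ⟨rfl, rfl⟩ := pair_inj.1 h₁
      exact Fraction.code_inj.1 h₂
    · rintro rfl
      exact ⟨hd n k, n, Num.lt_add_one_iff.2 ((le_pair_left n k).trans (le_pair_left _ _)), k,
        Num.lt_add_one_iff.2 ((le_pair_right n k).trans (le_pair_left _ _)), rfl⟩
  refine ⟨x, setOf_mem_sets _, ⟨?_, fun n k => ⟨_, (hterm _ _ _).2 rfl, fun q => (hterm _ _ _).1⟩,
    fun n k i q r hq hr => ?_⟩, hterm,
    fun n => ⟨fun k => ⟨⟨p n k, m n k, d n k⟩, hd n k, rfl, hterm n k⟩, hreg n⟩⟩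
  · rintro z ⟨n, -, k, -, rfl⟩
    exact ⟨n, k, ⟨p n k, m n k, d n k⟩, hd n k, rfl⟩
  · have hq' := hq.1
    have hr' := hr.1
    rw [Fraction.le_iff_val (hq'.sub hr').abs (Fraction.isRat_twoNeg k),
      Fraction.val_abs (hq'.sub hr'), Fraction.val_sub hq' hr', Fraction.val_twoNeg,
      (hterm _ _ _).1 hq, (hterm _ _ _).1 hr]
    exact hreg n k i

theorem exists_isRealSeq_of_regular (X : M.Num → M.Num → M.RatField) [IsRecQ2 X]
    (hreg : ∀ n, Regular (X n)) :
    ∃ x ∈ M.sets, IsRealSeq x ∧ ∀ n, Presents (term x n) (X n) := by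
  obtain ⟨p, m, d, hp, hm, hd, h⟩ := IsRecQ2.exists_rec X
  have hX : ∀ n, X n = fun k => Fraction.val ⟨p n k, m n k, d n k⟩ := fun n =>
    funext fun k => (h n k).2
  obtain ⟨x, hxM, hx, -, hx'⟩ := exists_isRealSeq p m d (fun n k => (h n k).1)
    fun n => hX n ▸ hreg n
  exact ⟨x, hxM, hx, fun n => hX n ▸ hx' n⟩

end L2Structure

/-! ### Kronecker's lemma -/

/-- One step of the summation by parts in Kronecker's lemma, with errors of order `δ`. -/
theorem abs_kronecker_step_le {K : Type*} [Field K] [LinearOrder K] [IsStrictOrderedRing K]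
    {a a' s s' s₀ x p p₀ ε δ B R : K} (hδ : 0 ≤ δ) (hε : 0 ≤ ε)
    (hx : |s' - s - x| ≤ 4 * δ) (hs : |s - s₀| ≤ ε + 4 * δ) (ha : a ≤ a' + 2 * δ) (haB : |a| ≤ B)
    (haB' : |a'| ≤ B) (hR : |p - p₀ - a * (s - s₀)| ≤ R) :
    |p + a' * x - p₀ - a' * (s' - s₀)| ≤ R + (a' - a) * ε + (12 * B + 4 * ε) * δ := by
  have h₁ : |a' * (s' - s - x)| ≤ B * (4 * δ) := by
    rw [abs_mul]
    exact mul_le_mul haB' hx (abs_nonneg _) ((abs_nonneg _).trans haB)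
  -- Monotonicity of the weights holds only up to `2 * δ` for approximations; this costs `4 * δ`.
  have h₂ : |a' - a| ≤ a' - a + 4 * δ := by
    rw [abs_le]
    constructor <;> linarith
  have h₃ : |a' - a| ≤ 2 * B := (abs_sub _ _).trans (by linarith)
  have h₄ : |(a' - a) * (s - s₀)| ≤ (a' - a) * ε + 4 * δ * ε + 8 * B * δ := by
    rw [abs_mul]
    calc |a' - a| * |s - s₀| ≤ |a' - a| * (ε + 4 * δ) := by gcongr
      _ = |a' - a| * ε + |a' - a| * (4 * δ) := by ring
      _ ≤ (a' - a + 4 * δ) * ε + 2 * B * (4 * δ) := by gcongr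
      _ = _ := by ring
  -- The quantity to bound equals `(p - p₀ - a * (s - s₀)) - a' * (s' - s - x) - (a' - a) * (s -
  -- s₀)`.
  rw [abs_le] at *
  constructor <;> linarith

namespace L2Structure

variable {M : L2Structure.{u}} [hM : Fact M.ModelsRCA0]

/-! ### Speeding up -/

theorem toRat_mul_eps_add_le (D k : M.Num) : toRat D * eps (D + k) ≤ eps k := by
  rw [eps_add, ← mul_assoc]
  exact mul_le_of_le_one_left (eps_pos k).le (toRat_mul_eps_le_one D)

/-- Starting at index `D` absorbs the factor, since `D * 2 ^ (-D) ≤ 1`. -/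
theorem regular_of_lipschitz {f : M.Num → M.RatField} {D : M.Num}
    (h : ∀ j i, |f j - f (j + i)| ≤ toRat D * eps j) : Regular fun k => f (D + k) := fun k i => by
  have := h (D + k) i
  rw [add_assoc] at this
  exact this.trans (toRat_mul_eps_add_le D k)

theorem near_of_lipschitz {f : M.Num → M.RatField} {D : M.RatField}
    (h : ∀ j i, |f j - f (j + i)| ≤ D * eps j) (m : M.Num) : Near (fun k => f (m + k)) f :=
  ⟨D, fun k => by
    rw [abs_sub_comm]
    show |f k - f (m + k)| ≤ _
    rw [add_comm]
    exact h k m⟩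

/-! ### Weighted means -/

/-- Approximations `A`, `X`, `S` to sequences of reals that satisfy the premise of Kronecker's
lemma. -/
structure KronSystem (A X S : M.Num → M.Num → M.RatField) : Prop where
  regular_weight : ∀ n, Regular (A n)
  regular_term : ∀ n, Regular (X n)
  regular_sum : ∀ n, Regular (S n)
  pos : ∃ c, 2 * eps c < A 0 c
  mono : ∀ n k, A n k ≤ A (n + 1) k + 2 * eps k
  unbounded : ∀ m, ∃ n, ∀ j, toRat m ≤ A n j + 2 * eps j
  succ : ∀ n j, |S (n + 1) j - (S n (j + 1) + X (n + 1) (j + 1))| ≤ 2 * eps j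
  cauchy : ∀ k, ∃ N, ∀ m n, N ≤ m → N ≤ n → ∀ j, |S m (j + 1) - S n (j + 1)| ≤ eps k + 2 * eps j

theorem KronPremise.exists_system {a x : Set M.Num} (h : KronPremise a x)
    {A X : M.Num → M.Num → M.RatField} (hA : ∀ n, Presents (term a n) (A n))
    (hX : ∀ n, Presents (term x n) (X n)) : ∃ S, IsRecQ2 S ∧ KronSystem A X S := by
  obtain ⟨h₁, h₂, s, hsM, hs, hxs, hc⟩ := h
  obtain ⟨S, hSrec, hS⟩ := hs.exists_presents hsM
  refine ⟨S, hSrec, fun n => (hA n).regular, fun n => (hX n).regular, fun n => (hS n).regular,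
    ?_, fun n => ((hA n).le_iff (hA (n + 1))).1 (h₁ n).2, fun m => ?_, fun n j => ?_, fun k => ?_⟩
  · have := (h₁ 0).1
    rw [Presentation.lt, (hA 0).le_iff (.const (Fraction.isRat_ofNum _))] at this
    push Not at this
    simpa [Fraction.val_ofNum] using this
  · obtain ⟨n, hn⟩ := h₂ m
    rw [(Presents.const (Fraction.isRat_ofNum _)).le_iff (hA n)] at hn
    exact ⟨n, fun j => by simpa only [Fraction.val_ofNum] using hn j⟩
  · have hadd := (hS n).add (hX (n + 1))
    exact (hS (n + 1)).regular.abs_sub_le_of_near hadd.regular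
      (((hS (n + 1)).equal_iff hadd).1 (hxs.2 n)) j
  · obtain ⟨N, hN⟩ := hc k
    refine ⟨N, fun m n hm hn j => ?_⟩
    have := hN m n hm hn
    rw [((hS m).sub (hS n)).abs.le_iff (.const (Fraction.isRat_twoNeg k))] at this
    simpa only [Fraction.val_twoNeg] using this j

/-- Partial sums of the products of approximations. -/
theorem exists_weighted_sums (A X : M.Num → M.Num → M.RatField) [IsRecQ2 A] [IsRecQ2 X]
    (hA : ∀ n, Regular (A n)) (hX : ∀ n, Regular (X n)) :
    ∃ (P : M.Num → M.Num → M.RatField) (D : M.Num → M.Num), IsRecQ2 P ∧ IsRec1 D ∧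
      (∀ j, P 0 j = A 0 j * X 0 j) ∧ (∀ n j, P (n + 1) j = P n j + A (n + 1) j * X (n + 1) j) ∧
      ∀ n j i, |P n j - P n (j + i)| ≤ toRat (D n) * eps j := by
  have h₁ : IsRecQ2 fun j n => A n j * X n j := ⟨inferInstance⟩
  obtain ⟨T, hT, hT₀, hT₁⟩ := exists_sum fun j n => A n j * X n j
  -- Each product `A n j * X n j` varies by at most this multiple of `eps j`; the multiples are
  -- summed along with the series.
  have h₂ : IsRecQ2 fun (_ : M.Num) n => |A n 0| + |X n 0| + 2 := ⟨inferInstance⟩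
  obtain ⟨B, hB, hB₀, hB₁⟩ := exists_sum fun (_ : M.Num) n => |A n 0| + |X n 0| + 2
  have h₃ : IsRecQ1 fun n => B 0 (n + 1) := ⟨inferInstance⟩
  obtain ⟨D, hD, hD'⟩ := IsRecQ1.exists_bound fun n => B 0 (n + 1)
  have h₄ : IsRecQ fun v : ℕ → M.Num => T (v 1) (v 0 + 1) := .fun2 T _ _
  refine ⟨fun n j => T j (n + 1), D, ⟨h₄⟩, hD, fun j => ?_, fun n j => hT₁ j (n + 1),
    fun n j i => ?_⟩
  · show T j (0 + 1) = _
    rw [hT₁, hT₀, zero_add]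
  · refine le_trans ?_ (mul_le_mul_of_nonneg_right ((le_abs_self _).trans (hD' n)) (eps_pos j).le)
    refine del_induction (fun n => |T j n - T (j + i) n| ≤ B 0 n * eps j) ?_ (fun n hn => ?_) (n + 1)
    · rw [hT₀, hT₀, hB₀, sub_zero, abs_zero, zero_mul]
    · rw [hT₁, hT₁, hB₁, add_sub_add_comm, add_mul]
      exact (abs_add_le _ _).trans (add_le_add hn ((hA n).mul_sub_mul_le (hX n) le_self_add))

namespace KronSystem

variable {A X S : M.Num → M.Num → M.RatField}

theorem mono_add (h : KronSystem A X S) [IsRecQ2 A] (n i j : M.Num) :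
    A n j ≤ A (n + i) j + 2 * toRat i * eps j := by
  refine del_induction (fun i => A n j ≤ A (n + i) j + 2 * toRat i * eps j) ?_ (fun i hi => ?_) i
  · simp
  · have := h.mono (n + i) j
    rw [map_add, map_one, ← add_assoc]
    linarith

/-- At precision `j` the weights satisfy `a 0 ≤ a n` only up to `2 * n * 2 ^ (-j)`. A precision
beyond `n` makes this loss a small multiple of `2 ^ (-c)`, uniformly in `n`. -/
theorem exists_lower_bound (h : KronSystem A X S) [IsRecQ2 A] :
    ∃ c, ∀ n j, eps c ≤ A n (c + n + j) := by
  obtain ⟨c, hc⟩ := h.pos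
  refine ⟨c + 1 + 1, fun n j => ?_⟩
  have h₁ := abs_sub_le_iff.1 ((h.regular_weight 0).abs_sub_le
    (show c ≤ c + 1 + 1 + n + j by simp only [add_assoc]; exact le_self_add))
  have h₂ := h.mono_add 0 n (c + 1 + 1 + n + j)
  have h₃ : toRat n * eps (c + 1 + 1 + n + j) ≤ eps c / 4 := by
    rw [eps_add, eps_add, eps_succ, eps_succ]
    have h₄ := eps_pos c
    have h₅ := mul_le_mul_of_nonneg_left
      (mul_le_one₀ (toRat_mul_eps_le_one n) (eps_pos j).le (eps_le_one j)) h₄.le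
    linarith
  rw [zero_add] at h₂
  rw [eps_succ, eps_succ]
  linarith

/-- The approximate weighted means. -/
theorem exists_means (h : KronSystem A X S) [IsRecQ2 A] {P : M.Num → M.Num → M.RatField}
    {D : M.Num → M.Num} [IsRecQ2 P] [IsRec1 D]
    (hP : ∀ n j i, |P n j - P n (j + i)| ≤ toRat (D n) * eps j) {c : M.Num}
    (hc : ∀ n j, eps c ≤ A n (c + n + j)) :
    ∃ E : M.Num → M.Num, IsRec1 E ∧
      ∀ n, Regular fun k => P n (c + n + (E n + k)) / A n (c + n + (E n + k)) := by
  -- `E n` bounds the Lipschitz constant of the quotient: the usual estimate for a difference of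
  -- quotients, with both denominators at least `eps c`.
  have h₁ : IsRecQ1 fun n => (toRat (D n) * (|A n 0| + 1) + (|P n 0| + toRat (D n))) /
    (eps c * eps c) := ⟨inferInstance⟩
  obtain ⟨E, hE, hE'⟩ := IsRecQ1.exists_bound fun n =>
    (toRat (D n) * (|A n 0| + 1) + (|P n 0| + toRat (D n))) / (eps c * eps c)
  refine ⟨E, hE, fun n => ?_⟩
  refine regular_of_lipschitz (f := fun k => P n (c + n + k) / A n (c + n + k)) fun j i => ?_
  have hcpos := eps_pos c
  have hj := eps_pos j
  have hA₁ := hc n j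
  have hA₂ := hc n (j + i)
  have hPb : |P n (c + n + (j + i))| ≤ |P n 0| + toRat (D n) := by
    have := hP n 0 (c + n + (j + i))
    rw [zero_add, eps_zero, mul_one, abs_sub_comm] at this
    linarith [abs_sub_abs_le_abs_sub (P n (c + n + (j + i))) (P n 0)]
  have hAb := (h.regular_weight n).bound (c + n + (j + i))
  have hPd := hP n (c + n + j) i
  have hAd := h.regular_weight n (c + n + j) i
  have hej : eps (c + n + j) ≤ eps j := eps_anti le_add_self
  rw [add_assoc (c + n)] at hPd hAd
  rw [abs_sub_comm] at hAd
  have hD := toRat_nonneg (D n)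
  rw [div_sub_div _ _ (hcpos.trans_le hA₁).ne' (hcpos.trans_le hA₂).ne', abs_div,
    abs_of_pos (mul_pos (hcpos.trans_le hA₁) (hcpos.trans_le hA₂)),
    div_le_iff₀ (mul_pos (hcpos.trans_le hA₁) (hcpos.trans_le hA₂))]
  calc |P n (c + n + j) * A n (c + n + (j + i)) - A n (c + n + j) * P n (c + n + (j + i))|
      = |P n (c + n + j) * A n (c + n + (j + i)) - P n (c + n + (j + i)) * A n (c + n + j)| := by
        rw [mul_comm (A n (c + n + j))]
    _ = |(P n (c + n + j) - P n (c + n + (j + i))) * A n (c + n + (j + i)) +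
          P n (c + n + (j + i)) * (A n (c + n + (j + i)) - A n (c + n + j))| := by
        congr 1
        ring
    _ ≤ |P n (c + n + j) - P n (c + n + (j + i))| * |A n (c + n + (j + i))| +
          |P n (c + n + (j + i))| * |A n (c + n + (j + i)) - A n (c + n + j)| := by
        rw [← abs_mul, ← abs_mul]
        exact abs_add_le _ _
    _ ≤ toRat (D n) * eps j * (|A n 0| + 1) + (|P n 0| + toRat (D n)) * eps j := by
        gcongr
        exacts [hPd.trans (by gcongr), hAd.trans hej]
    _ = (toRat (D n) * (|A n 0| + 1) + (|P n 0| + toRat (D n))) / (eps c * eps c) * eps j *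
          (eps c * eps c) := by
        field_simp
    _ ≤ toRat (E n) * eps j * (A n (c + n + j) * A n (c + n + (j + i))) := by
        have h₂ := toRat_nonneg (E n)
        have h₃ := hcpos.le.trans hA₁
        gcongr
        exact (le_abs_self _).trans (hE' n)

variable {P : M.Num → M.Num → M.RatField} {c : M.Num}

theorem abs_succ_sub_le (h : KronSystem A X S) (n j : M.Num) :
    |S (n + 1) j - S n j - X (n + 1) j| ≤ 4 * eps j := by
  have h₁ := abs_le.1 (h.succ n j)
  have h₂ := abs_le.1 (h.regular_sum n j 1)
  have h₃ := abs_le.1 (h.regular_term (n + 1) j 1)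
  rw [abs_le]
  constructor <;> linarith

/-- Summation by parts from `N` to `N + l`. The constant `C` may depend on `l` but not on the
precision `j`, so it disappears on passing to the reals. -/
theorem exists_abs_weighted_sum_le (h : KronSystem A X S) [IsRecQ2 A] [IsRecQ2 S] [IsRecQ2 P]
    (hc : ∀ n j, eps c ≤ A n (c + n + j))
    (hP : ∀ n j, P (n + 1) j = P n j + A (n + 1) j * X (n + 1) j) {k N : M.Num}
    (hN : ∀ m n, N ≤ m → N ≤ n → ∀ j, |S m (j + 1) - S n (j + 1)| ≤ eps k + 2 * eps j)
    (l : M.Num) :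
    ∃ C, ∀ j, c + (N + l) + 1 ≤ j →
      |P (N + l) j| ≤ |P N j| + 2 * eps k * A (N + l) j + C * eps j := by
  have hB₁ : IsRecQ1 fun n => |A n 0| + 1 := ⟨inferInstance⟩
  obtain ⟨B, hB⟩ := IsRecQ1.exists_uniform_bound (fun n => |A n 0| + 1) (N + l)
  replace hB : ∀ n ≤ N + l, ∀ j, |A n j| ≤ B := fun n hn j =>
    ((h.regular_weight n).bound j).trans ((le_abs_self _).trans (hB n hn))
  have hε := eps_pos k
  -- Each of the `l` steps costs `(12 * B + 4 * eps k) * eps j`, and the boundary term `h₄` costs `4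
  -- * B * eps j`.
  refine ⟨toRat l * (12 * B + 4 * eps k) + 4 * B, fun j hj => ?_⟩
  have hδ := eps_pos j
  -- Here `j` is a successor, and twice the `eps` of its predecessor is `4 * eps j`.
  have hS : ∀ i, |S (N + i) j - S N j| ≤ eps k + 4 * eps j := fun i => by
    obtain ⟨j, rfl⟩ := exists_add_of_le ((le_add_self (a := (1 : M.Num))).trans hj)
    have := hN (N + i) N le_self_add le_rfl j
    rw [add_comm 1 j, eps_succ]
    linarith
  -- The increments of the weights telescope to `A (N + i) j - A N j`. With `j` fixed this is an
  -- inequality of rationals, so Δ⁰₁ induction applies.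
  have key : ∀ i, N + i ≤ N + l → |P (N + i) j - P N j - A (N + i) j * (S (N + i) j - S N j)| ≤
      (A (N + i) j - A N j) * eps k + toRat i * ((12 * B + 4 * eps k) * eps j) := by
    refine del_induction (fun i => N + i ≤ N + l →
      |P (N + i) j - P N j - A (N + i) j * (S (N + i) j - S N j)| ≤
      (A (N + i) j - A N j) * eps k + toRat i * ((12 * B + 4 * eps k) * eps j)) ?_ fun i hi hil => ?_
    · intro _
      simp
    · rw [← add_assoc] at hil ⊢
      have hil' : N + i ≤ N + l := le_self_add.trans hil
      have := abs_kronecker_step_le hδ.le hε.le (h.abs_succ_sub_le (N + i) j) (hS i)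
        (h.mono (N + i) j) (hB _ hil' j) (hB _ hil j) (hi hil')
      rw [hP, map_add, map_one]
      linarith
  have h₁ := key l le_rfl
  have h₂ : 0 ≤ A N j := by
    obtain ⟨i, rfl⟩ := exists_add_of_le
      ((show c + N ≤ c + (N + l) + 1 by rw [← add_assoc, add_assoc]; exact le_self_add).trans hj)
    exact (eps_pos c).le.trans (hc N i)
  have h₃ : 0 ≤ A (N + l) j := by
    obtain ⟨i, rfl⟩ := exists_add_of_le ((le_self_add (b := (1 : M.Num))).trans hj)
    exact (eps_pos c).le.trans (hc (N + l) i)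
  have h₄ : |A (N + l) j * (S (N + l) j - S N j)| ≤ A (N + l) j * eps k + B * (4 * eps j) := by
    rw [abs_mul, abs_of_nonneg h₃]
    have := hB (N + l) le_rfl j
    rw [abs_of_nonneg h₃] at this
    calc A (N + l) j * |S (N + l) j - S N j| ≤ A (N + l) j * (eps k + 4 * eps j) := by
          gcongr
          exact hS l
      _ = A (N + l) j * eps k + A (N + l) j * (4 * eps j) := mul_add _ _ _
      _ ≤ _ := by gcongr
  have h₅ := mul_nonneg h₂ hε.le
  have h₆ := abs_sub_abs_le_abs_sub (P (N + l) j) (P N j)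
  have h₇ := abs_sub_abs_le_abs_sub (P (N + l) j - P N j) (A (N + l) j * (S (N + l) j - S N j))
  linarith

/-- The Cauchy condition at precision `k + 2` contributes half of `eps k * A n j`. The fixed number
`|P N₀ j|` contributes a quarter once the weights exceed `|P N₀ j|` divided by `eps k / 4`. -/
theorem exists_forall_abs_weighted_sum_le (h : KronSystem A X S) [IsRecQ2 A] [IsRecQ2 S]
    [IsRecQ2 P] (hc : ∀ n j, eps c ≤ A n (c + n + j)) {D : M.Num → M.Num}
    (hP : ∀ n j, P (n + 1) j = P n j + A (n + 1) j * X (n + 1) j)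
    (hPD : ∀ n j i, |P n j - P n (j + i)| ≤ toRat (D n) * eps j) (k : M.Num) :
    ∃ N, ∀ n, N ≤ n → ∃ C m, ∀ j, m ≤ j → |P n j| ≤ eps k * A n j + C * eps j := by
  obtain ⟨N₀, hN₀⟩ := h.cauchy (k + 1 + 1)
  have hε := eps_pos k
  obtain ⟨m, hm⟩ := exists_toRat_ge ((|P N₀ 0| + toRat (D N₀)) / (eps k / 4))
  obtain ⟨k₁, hk₁⟩ := h.unbounded m
  refine ⟨max N₀ k₁, fun n hn => ?_⟩
  obtain ⟨l, rfl⟩ := exists_add_of_le (le_of_max_le_left hn)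
  obtain ⟨i, hi⟩ := exists_add_of_le (le_of_max_le_right hn)
  obtain ⟨C, hC⟩ := h.exists_abs_weighted_sum_le hc hP hN₀ l
  refine ⟨C + eps k / 4 * (2 + 2 * toRat i), c + (N₀ + l) + 1, fun j hj => ?_⟩
  have h₁ := hC j hj
  rw [eps_succ, eps_succ] at h₁
  have h₂ : |P N₀ j| ≤ |P N₀ 0| + toRat (D N₀) := by
    have := hPD N₀ 0 j
    rw [zero_add, eps_zero, mul_one, abs_sub_comm] at this
    linarith [abs_sub_abs_le_abs_sub (P N₀ j) (P N₀ 0)]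
  have h₃ := (div_le_iff₀ (by positivity)).1 ((le_abs_self _).trans hm)
  have h₄ := h.mono_add k₁ i j
  rw [← hi] at h₄
  have h₅ : toRat m ≤ A (N₀ + l) j + (2 + 2 * toRat i) * eps j := by linarith [hk₁ j]
  have h₆ := mul_le_mul_of_nonneg_right h₅ (show 0 ≤ eps k / 4 by positivity)
  have h₇ : 0 ≤ A (N₀ + l) j := by
    obtain ⟨i, rfl⟩ := exists_add_of_le ((le_self_add (b := (1 : M.Num))).trans hj)
    exact (eps_pos c).le.trans (hc (N₀ + l) i)
  have h₈ := mul_nonneg hε.le h₇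
  linarith

end KronSystem

/-- **Kronecker's lemma** in models of `RCA₀`. -/
theorem KronPremise.exists_means {a x : Set M.Num} (h : KronPremise a x) (ha : IsRealSeq a)
    (haM : a ∈ M.sets) (hx : IsRealSeq x) (hxM : x ∈ M.sets) :
    ∃ u ∈ M.sets, IsRealSeq u ∧ IsWeightedMeans a x u ∧ ConvergesToZero u := by
  obtain ⟨A, hA, haA⟩ := ha.exists_presents haM
  obtain ⟨X, hX, hxX⟩ := hx.exists_presents hxM
  obtain ⟨S, hS, hsys⟩ := h.exists_system haA hxX
  obtain ⟨P, D, hP, hD, hP₀, hP₁, hPD⟩ :=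
    exists_weighted_sums A X hsys.regular_weight hsys.regular_term
  obtain ⟨c, hc⟩ := hsys.exists_lower_bound
  obtain ⟨E, hE, hU⟩ := hsys.exists_means hPD hc
  have h₁ : IsRecQ2 fun n k => P n (D n + k) := ⟨.fun2 P _ _⟩
  have h₂ : IsRecQ2 fun n k => P n (c + n + (E n + k)) / A n (c + n + (E n + k)) := by
    have h₃ : IsRecQ fun v : ℕ → M.Num => P (v 0) (c + v 0 + (E (v 0) + v 1)) := .fun2 P _ _
    have h₄ : IsRecQ fun v : ℕ → M.Num => A (v 0) (c + v 0 + (E (v 0) + v 1)) := .fun2 A _ _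
    exact ⟨inferInstance⟩
  obtain ⟨t, htM, ht, htT⟩ := exists_isRealSeq_of_regular (fun n k => P n (D n + k))
    fun n => regular_of_lipschitz (hPD n)
  obtain ⟨u, huM, hu, huU⟩ := exists_isRealSeq_of_regular
    (fun n k => P n (c + n + (E n + k)) / A n (c + n + (E n + k))) hU
  have hTP : ∀ n, Near (fun k => P n (D n + k)) (P n) := fun n => near_of_lipschitz (hPD n) _
  refine ⟨u, huM, hu, ⟨t, htM, ht, ⟨?_, fun n => ?_⟩, fun n => ?_⟩, fun k => ?_⟩
  · obtain ⟨f, hf, hf'⟩ := (haA 0).exists_near_mul (hxX 0)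
    rw [(htT 0).equal_iff hf]
    refine (hTP 0).trans (.trans ?_ hf'.symm)
    simp only [← hP₀]
    exact .refl _
  · obtain ⟨f, hf, hf'⟩ := (haA (n + 1)).exists_near_mul (hxX (n + 1))
    rw [(htT (n + 1)).equal_iff ((htT n).add hf)]
    refine (hTP (n + 1)).trans (.trans ?_ (((htT n).near_add hf).trans ((hTP n).add hf')).symm)
    simp only [← hP₁]
    exact .refl _
  · obtain ⟨f, hf, hf'⟩ := (haA n).exists_near_mul (huU n)
    rw [hf.equal_iff (htT n)]
    refine hf'.trans (.trans ?_ (hTP n).symm)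
    -- The weight is moved to the index used in the quotient, where it cancels exactly.
    have h₃ := ((haA n).regular.near_shift (c + n + E n)).symm.mul (.refl _)
      (haA n).regular.bound (huU n).regular.bound
    refine h₃.trans (.trans ?_ (near_of_lipschitz (hPD n) (c + n + E n)))
    have h₄ : ∀ k, A n (c + n + E n + k) * (P n (c + n + (E n + k)) / A n (c + n + (E n + k))) =
        P n (c + n + E n + k) := fun k => by
      rw [add_assoc (c + n)]
      exact mul_div_cancel₀ _ ((eps_pos c).trans_le (hc n _)).ne'
    simp only [h₄]
    exact .refl _
  · obtain ⟨N, hN⟩ := hsys.exists_forall_abs_weighted_sum_le hc hP₁ hPD k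
    refine ⟨N, fun n hn => ?_⟩
    obtain ⟨C, m, hC⟩ := hN n hn
    rw [(huU n).abs.le_iff (.const (Fraction.isRat_twoNeg k))]
    -- Dividing by a weight that is at least `eps c` multiplies the error by at most `1 / eps c`.
    refine (huU n).regular.abs.le_of_le_add_mul_eps (.const _) (C := |C| / eps c) m fun j hj => ?_
    have h₃ := hC (c + n + (E n + j)) (hj.trans (le_add_self.trans le_add_self))
    have h₄ := hc n (E n + j)
    have hcpos := eps_pos c
    have h₅ : eps (c + n + (E n + j)) ≤ eps j := eps_anti (le_add_self.trans le_add_self)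
    rw [Fraction.val_twoNeg, abs_div, abs_of_pos (hcpos.trans_le h₄),
      div_le_iff₀ (hcpos.trans_le h₄), add_mul]
    refine h₃.trans (add_le_add le_rfl ?_)
    have h₆ := eps_pos j
    calc C * eps (c + n + (E n + j)) ≤ |C| * eps (c + n + (E n + j)) := by
          gcongr
          exacts [(eps_pos _).le, le_abs_self C]
      _ ≤ |C| * eps j := by gcongr
      _ = |C| / eps c * eps j * eps c := by field_simp
      _ ≤ _ := by gcongr

theorem satKRON : M.SatKRON := fun _ haM _ hxM ha hx h => h.exists_means ha haM hx hxM

end L2Structure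

/-! ### `ACA₀` and Σ⁰₁ comprehension -/

namespace L2Structure

variable {M : L2Structure.{u}}

theorem eta_assignCons {α : Type u} (v : ℕ → α) : assignCons (v 0) (fun i => v (i + 1)) = v := by
  funext i
  cases i <;> rfl

theorem IsBdd.of_sat {θ : L2Formula} (hθ : θ.IsBounded) (V : ℕ → M.sets) :
    IsBdd fun v => M.Sat θ v V := ⟨θ, hθ, .inl, V, fun _ => Iff.rfl⟩

/-- A `Σ⁰₁` relation depends on finitely many variables. -/
theorem IsSig.exists_bound {P : (ℕ → M.Num) → Prop} (hP : IsSig P) :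
    ∃ k, ∀ v w, (∀ i < k, v i = w i) → (P v ↔ P w) := by
  obtain ⟨Q, ⟨θ, -, ρ, V, h₁⟩, h₂⟩ := hP.out
  obtain ⟨k, hk⟩ := sat_exists_bound (M := M) θ
  refine ⟨(Finset.range k).sup fun i => Sum.elim id (fun _ => 0) (ρ i), fun v w h => ?_⟩
  rw [h₂, h₂]
  refine exists_congr fun n => ?_
  rw [h₁, h₁]
  refine hk _ _ V fun i hi => ?_
  rcases hρ : ρ i with (_ | j) | c
  · simp [subst, hρ, assignCons]
  · have hj : j < (Finset.range k).sup fun i => Sum.elim id (fun _ => 0) (ρ i) := by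
      refine lt_of_lt_of_le (Nat.lt_succ_self j) ?_
      have := Finset.le_sup (f := fun i => Sum.elim id (fun _ => 0) (ρ i)) (Finset.mem_range.2 hi)
      simpa [hρ] using this
    simpa [subst, hρ, assignCons] using h j hj
  · simp [subst, hρ]

variable [hM : Fact M.ModelsRCA0]

variable (M) in
/-- The projections of `Δ⁰₁` relations are sets of `M`, that is, `M` satisfies `Σ⁰₁`
comprehension. -/
def SigmaComprehension : Prop :=
  ∀ P : M.Num → M.Num → Prop, IsRel2 P → {m | ∃ i, P m i} ∈ M.sets

omit hM in
theorem ModelsACA0.sigmaComprehension (h : M.ModelsACA0) : M.SigmaComprehension := by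
  intro P hP
  have := hP.out.sig
  have hP' : IsSig fun v : ℕ → M.Num => P (v 1) (v 0) :=
    this.comp_subst (fun v i => v (1 - i)) (fun i => .inl (1 - i)) fun v i => rfl
  have : Fact M.ModelsRCA0 := ⟨h.rca0⟩
  have hex : IsSig fun v : ℕ → M.Num => ∃ i, P (v 0) i := inferInstance
  obtain ⟨Q, ⟨θ, hθ, ρ, V, h₁⟩, h₂⟩ := hex.out
  obtain ⟨f, w, hf⟩ := exists_subst_closed ρ
  obtain ⟨X, hX, h⟩ := h.arithmetical_comprehension (.exNum (θ.rename f id))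
    (hθ.rename f id).isArithmetical w V
  convert! hX
  ext m
  rw [h]
  refine (h₂ (assignCons m fun _ => 0)).trans (exists_congr fun n => ?_)
  rw [h₁, hf, sat_rename]
  rfl

namespace SigmaComprehension

/-- The first two variables are merged into one by pairing until a single variable remains; then the
relation is membership in a set supplied by the hypothesis. -/
theorem isDel_of_bound (h : M.SigmaComprehension) (k : ℕ) : ∀ {P : (ℕ → M.Num) → Prop},
    IsSig P → (∀ v w, (∀ i ≤ k, v i = w i) → (P v ↔ P w)) → IsDel P := by
  induction k with
  | zero =>
    intro P hP hk
    obtain ⟨Q, hQ, h₂⟩ := hP.out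
    have hQ' : IsBdd fun v : ℕ → M.Num => Q (assignCons (v 1) fun _ => v 0) :=
      hQ.comp_subst _ (fun i => match i with
        | 0 => .inl 1
        | i + 1 => .inl 0) fun v i => by rcases i with _ | i <;> rfl
    have := IsRel1.mem (h (fun m n => Q (assignCons n fun _ => m)) ⟨.ofBdd _⟩)
    have hmem : IsDel fun v : ℕ → M.Num =>
      v 0 ∈ {m | ∃ n, Q (assignCons n fun _ => m)} := inferInstance
    refine hmem.congr fun v => (hk v (fun _ => v 0) fun i hi => ?_).trans (h₂ _)
    rw [Nat.le_zero.1 hi]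
  | succ k ih =>
    intro P hP hk
    have h₁ : IsSig fun v : ℕ → M.Num => P (assignCons (v 1) (assignCons (v 0) fun i => v (i + 3))) :=
      hP.comp_subst _ (fun i => match i with
        | 0 => .inl 1
        | 1 => .inl 0
        | i + 2 => .inl (i + 3)) fun v i => by rcases i with _ | _ | i <;> rfl
    have h₂ : IsSig fun v : ℕ → M.Num => ∃ a, a = fst (v 0) ∧ ∃ b, b = snd (v 0) ∧
        P (assignCons a (assignCons b fun i => v (i + 1))) := inferInstance
    simp only [exists_eq_left] at h₂
    have h₃ := ih h₂ fun v w hvw => by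
      rw [hvw 0 (Nat.zero_le k)]
      refine hk _ _ fun i hi => ?_
      rcases i with _ | _ | i
      · rfl
      · rfl
      · exact hvw (i + 1) (Nat.le_of_succ_le_succ hi)
    have h₄ : IsDel fun v : ℕ → M.Num =>
        P (assignCons (fst (v 0)) (assignCons (snd (v 0)) fun i => v (i + 3))) :=
      h₃.comp_subst (fun v i => v (if i = 0 then 0 else i + 2))
        (fun i => .inl (if i = 0 then 0 else i + 2)) fun v i => rfl
    have h₅ : IsDel fun v : ℕ → M.Num => ∃ a, a < pair (v 0) (v 1) + 1 ∧ (a = pair (v 0) (v 1) ∧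
        P (assignCons (fst a) (assignCons (snd a) fun i => v (i + 2)))) := inferInstance
    refine h₅.congr fun v => ?_
    constructor
    · intro hv
      refine ⟨_, Num.lt_succ_self' _, rfl, ?_⟩
      rw [fst_pair, snd_pair]
      convert! hv
      funext i
      rcases i with _ | _ | i <;> rfl
    · rintro ⟨_, -, rfl, hv⟩
      rw [fst_pair, snd_pair] at hv
      convert! hv
      funext i
      rcases i with _ | _ | i <;> rfl

theorem isDel (h : M.SigmaComprehension) {P : (ℕ → M.Num) → Prop} (hP : IsSig P) : IsDel P := by
  obtain ⟨k, hk⟩ := hP.exists_bound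
  exact h.isDel_of_bound k hP fun v w hvw => hk v w fun i hi => hvw i hi.le

theorem ex (h : M.SigmaComprehension) (P : (ℕ → M.Num) → M.Num → Prop)
    [hP : IsDel fun v => P (fun i => v (i + 1)) (v 0)] : IsDel fun v => ∃ n, P v n :=
  h.isDel inferInstance

theorem all (h : M.SigmaComprehension) (P : (ℕ → M.Num) → M.Num → Prop)
    [hP : IsDel fun v => P (fun i => v (i + 1)) (v 0)] : IsDel fun v => ∀ n, P v n :=
  have := h.ex fun v n => ¬ P v n
  IsDel.congr (P := fun v => ¬ ∃ n, ¬ P v n) inferInstance fun v => by push Not; rfl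

/-- Under Σ⁰₁ comprehension unbounded number quantifiers preserve Δ⁰₁, so all arithmetical formulas
are reached by induction on their structure. -/
theorem isDel_sat (h : M.SigmaComprehension) (φ : L2Formula) (hφ : φ.IsArithmetical)
    (V : ℕ → M.sets) : IsDel fun v => M.Sat φ v V := by
  induction φ with
  | eq s t =>
    have := IsBdd.of_sat (.eq s t) V
    exact .ofBdd _
  | lt s t =>
    have := IsBdd.of_sat (.lt s t) V
    exact .ofBdd _
  | mem t X =>
    have := IsBdd.of_sat (.mem t X) V
    exact .ofBdd _
  | neg φ ih =>
    have := ih hφ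
    exact .not _
  | and φ ψ ih₁ ih₂ =>
    have := ih₁ hφ.1
    have := ih₂ hφ.2
    exact .and _ _
  | or φ ψ ih₁ ih₂ =>
    have := ih₁ hφ.1
    have := ih₂ hφ.2
    exact .or _ _
  | imp φ ψ ih₁ ih₂ =>
    have := ih₁ hφ.1
    have := ih₂ hφ.2
    exact .imp _ _
  | allNum φ ih =>
    have : IsDel fun v => M.Sat φ (assignCons (v 0) fun i => v (i + 1)) V := by
      simpa only [eta_assignCons] using ih hφ
    exact h.all fun v n => M.Sat φ (assignCons n v) V
  | exNum φ ih =>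
    have : IsDel fun v => M.Sat φ (assignCons (v 0) fun i => v (i + 1)) V := by
      simpa only [eta_assignCons] using ih hφ
    exact h.ex fun v n => M.Sat φ (assignCons n v) V
  | allSet φ _ => exact hφ.elim
  | exSet φ _ => exact hφ.elim

theorem modelsACA0 (h : M.SigmaComprehension) : M.ModelsACA0 := by
  refine ⟨hM.out, fun φ hφ v V => ?_⟩
  have : IsDel fun w : ℕ → M.Num => M.Sat φ (assignCons (w 0) v) V :=
    (h.isDel_sat φ hφ V).comp_subst _ (fun i => match i with
      | 0 => .inl 0
      | i + 1 => .inr (v i)) fun w i => by rcases i with _ | i <;> rfl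
  exact ⟨_, setOf_mem_sets fun n => M.Sat φ (assignCons n v) V, fun n => Iff.rfl⟩

/-- That `N` works for `k` is a Π⁰₁ condition on approximations, here even Δ⁰₁, so minimization
yields the rate. -/
theorem exists_rate (h : M.SigmaComprehension) {u : Set M.Num} (hu : IsRealSeq u) (huM : u ∈ M.sets)
    (hc : ConvergesToZero u) : ∃ g ∈ M.sets, IsFun g ∧ IsRateToZero g u := by
  obtain ⟨U, hU, huU⟩ := hu.exists_presents huM
  have key : ∀ k n, (term u n).abs.le (.const (Fraction.twoNeg k)) ↔
      ∀ j, |U n j| ≤ eps k + 2 * eps j := fun k n => by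
    rw [(huU n).abs.le_iff (.const (Fraction.isRat_twoNeg k)), Fraction.val_twoNeg]
  have h₂ : IsDel fun v : ℕ → M.Num => ∀ n, v 1 ≤ n → ∀ j, |U n j| ≤ eps (v 0) + 2 * eps j := by
    have : IsDel fun v : ℕ → M.Num => ∀ j, |U (v 0) j| ≤ eps (v 1) + 2 * eps j :=
      h.all fun v j => |U (v 0) j| ≤ eps (v 1) + 2 * eps j
    exact h.all fun v n => v 1 ≤ n → ∀ j, |U n j| ≤ eps (v 0) + 2 * eps j
  have : IsRel2 fun k N : M.Num => ∀ n, N ≤ n → ∀ j, |U n j| ≤ eps k + 2 * eps j := ⟨h₂⟩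
  obtain ⟨G, hG, hG'⟩ := exists_min
    (fun k N : M.Num => ∀ n, N ≤ n → ∀ j, |U n j| ≤ eps k + 2 * eps j) fun k => by
      obtain ⟨N, hN⟩ := hc k
      exact ⟨N, fun n hn => (key k n).1 (hN n hn)⟩
  refine ⟨graph G, graph_mem_sets G, isFun_graph G, fun k m n hkm hmn => (key k n).2 ?_⟩
  obtain rfl := pair_mem_graph.1 hkm
  exact (hG' k).1 n hmn

theorem satRKRON (h : M.SigmaComprehension) : M.SatRKRON := by
  intro a haM x hxM ha hx hax
  obtain ⟨u, huM, hu, hmean, hc⟩ := hax.exists_means ha haM hx hxM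
  exact ⟨u, huM, hu, hmean, h.exists_rate hu huM hc⟩

end SigmaComprehension

/-! ### The reversal: from rates of convergence to Σ⁰₁ comprehension -/

/-- A series of positive rationals with bounded partial sums whose terms are large at the stages at
which new elements of `{m | ∃ i, P m i}` are found. -/
theorem exists_series_of_rel (P : M.Num → M.Num → Prop) [IsRel2 P] :
    ∃ f S : M.Num → M.RatField, IsRecQ1 f ∧ IsRecQ1 S ∧ f 0 = S 0 ∧
      (∀ n, S (n + 1) = S n + f (n + 1)) ∧ (∀ n, 0 < f n) ∧ (∀ n, S n ≤ 2) ∧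
      ∀ m n, m ≤ n → P m (n + 1) → (∀ i < n + 1, ¬ P m i) → eps (m + 1) ≤ f n := by
  classical
  have h₁ : IsRecQ2 fun n l : M.Num => if ∃ i, i < n + 1 ∧ P l i then eps (l + 1) else 0 := by
    have h₂ : IsDel fun v : ℕ → M.Num => ∃ i, i < v 0 + 1 ∧ P (v 1) i := inferInstance
    exact ⟨inferInstance⟩
  -- `σ n l` adds `2 ^ (-i-1)` for each `i < l` enumerated by stage `n`.
  obtain ⟨σ, hσ, hσ₀, hσ₁⟩ :=
    exists_sum fun n l : M.Num => if ∃ i, i < n + 1 ∧ P l i then eps (l + 1) else 0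
  have hle : ∀ n l, σ n l ≤ 1 - eps l := fun n l => by
    refine del_induction (fun l => σ n l ≤ 1 - eps l) ?_ (fun l hl => ?_) l
    · rw [hσ₀, eps_zero, sub_self]
    · have hpos := eps_pos l
      rw [hσ₁, eps_succ]
      split_ifs <;> linarith
  have hmono₂ : ∀ n l, σ n l ≤ σ n (l + 1) := fun n l => by
    have := eps_pos (l + 1)
    rw [hσ₁]
    split_ifs <;> linarith
  have hterm : ∀ n l : M.Num, (if ∃ i, i < n + 1 ∧ P l i then eps (l + 1) else 0) ≤
      if ∃ i, i < n + 1 + 1 ∧ P l i then eps (l + 1) else 0 := fun n l => by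
    have hpos := eps_pos (l + 1)
    split_ifs with h h'
    · rfl
    · exact (h' (h.imp fun i hi => ⟨hi.1.trans (Num.lt_succ_self' _), hi.2⟩)).elim
    · exact hpos.le
    · rfl
  have hmono₁ : ∀ n l, σ n l ≤ σ (n + 1) l := fun n l => by
    refine del_induction (fun l => σ n l ≤ σ (n + 1) l) ?_ (fun l hl => ?_) l
    · rw [hσ₀, hσ₀]
    · rw [hσ₁, hσ₁]
      exact add_le_add hl (hterm n l)
  have hjump : ∀ m n, P m (n + 1) → (∀ i < n + 1, ¬ P m i) → ∀ l, m < l →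
      σ n l + eps (m + 1) ≤ σ (n + 1) l := fun m n hP hn l => by
    refine del_induction (fun l => m < l → σ n l + eps (m + 1) ≤ σ (n + 1) l)
      (fun h => (not_lt_zero h).elim) (fun l hl hml => ?_) l
    rw [hσ₁, hσ₁]
    rcases (Num.lt_add_one_iff.1 hml).eq_or_lt with rfl | h
    · rw [if_neg (by simpa using hn), if_pos ⟨n + 1, Num.lt_succ_self' _, hP⟩]
      have := hmono₁ n m
      linarith
    · have h₁ := hl h
      have h₂ := hterm n l
      linarith
  -- Subtracting `eps` makes every term at least `eps n - eps (n + 1) > 0`, even if nothing is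
  -- enumerated. The `+ 1` cancels the starting value `σ 0 0 - eps 0 = -1`.
  refine ⟨fun n => σ (n + 1) (n + 1) - eps (n + 1) - (σ n n - eps n),
    fun n => σ (n + 1) (n + 1) - eps (n + 1) + 1, ⟨inferInstance⟩, ⟨inferInstance⟩, ?_, fun n => ?_,
    fun n => ?_, fun n => ?_, fun m n hmn hP hn => ?_⟩ <;> dsimp only
  · rw [hσ₀, eps_zero]
    ring
  · abel
  · have h₁ := hmono₁ n n
    have h₂ := hmono₂ (n + 1) n
    have h₃ := eps_pos n
    rw [eps_succ]
    linarith
  · have h₁ := hle (n + 1) (n + 1)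
    have h₂ := eps_pos (n + 1)
    linarith
  · have h₁ := hjump m n hP hn (n + 1) (Num.lt_add_one_iff.2 hmn)
    have h₂ := hmono₂ n n
    have h₃ := eps_pos n
    rw [eps_succ n]
    linarith

/-- Bounded monotone sequences of rationals are Cauchy. -/
theorem exists_forall_abs_sub_le (S : M.Num → M.RatField) [IsRecQ1 S] (hS : ∀ n, S n ≤ S (n + 1))
    {B : M.RatField} (hB : ∀ n, S n ≤ B) (k : M.Num) :
    ∃ N, ∀ m n, N ≤ m → N ≤ n → |S m - S n| ≤ eps k := by
  have hmono : ∀ n i, S n ≤ S (n + i) := fun n i => by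
    refine del_induction (fun i => S n ≤ S (n + i)) ?_ (fun i hi => ?_) i
    · rw [add_zero]
    · rw [← add_assoc]
      exact hi.trans (hS _)
  by_contra! hc
  have hc' : ∀ N, ∃ m, S N + eps k ≤ S m := fun N => by
    obtain ⟨m, n, hm, hn, h⟩ := hc N
    obtain ⟨i, rfl⟩ := exists_add_of_le hm
    obtain ⟨j, rfl⟩ := exists_add_of_le hn
    have h₁ := hmono N i
    have h₂ := hmono N j
    rcases lt_abs.1 h with h | h
    · exact ⟨N + i, by linarith⟩
    · exact ⟨N + j, by linarith⟩
  obtain ⟨i, hi⟩ := exists_toRat_ge ((B - S 0 + 1) / eps k)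
  -- If the Cauchy condition fails, `S` can be raised by `eps k` any number of times, also a
  -- nonstandard one, and so exceeds `B`.
  obtain ⟨N, hN⟩ := sig_induction (fun i => ∃ N, S 0 + toRat i * eps k ≤ S N) ⟨0, by simp⟩
    (fun i ⟨N, hN⟩ => by
      obtain ⟨m, hm⟩ := hc' N
      refine ⟨m, ?_⟩
      rw [map_add, map_one]
      linarith) i
  have h₁ := (div_le_iff₀ (eps_pos k)).1 ((le_abs_self _).trans hi)
  have h₂ := hB N
  linarith

/-- If the terms of a series are nonnegative then the means with the weights `n + 1` are not
smaller than the terms. -/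
theorem IsWeightedMeans.le_eps {a x u : Set M.Num} (h : IsWeightedMeans a x u)
    (hu : IsRealSeq u) (huM : u ∈ M.sets) {f : M.Num → M.RatField} [IsRecQ1 f]
    (ha : ∀ n, Presents (term a n) fun _ => toRat (n + 1))
    (hx : ∀ n, Presents (term x n) fun _ => f n) (hf : ∀ n, 0 ≤ f n) {n k : M.Num}
    (hn : (term u n).abs.le (.const (Fraction.twoNeg k))) : f n ≤ eps k := by
  obtain ⟨t, htM, ht, ⟨h₀, h₁⟩, h₂⟩ := h
  obtain ⟨T, hT, htT⟩ := ht.exists_presents htM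
  obtain ⟨U, hU, huU⟩ := hu.exists_presents huM
  have hT₀ : ∀ j, f 0 ≤ T 0 j + 2 * eps j := fun j => by
    obtain ⟨c, hc⟩ := (ha 0).mul (hx 0)
    have := (abs_le.1 ((htT 0).regular.abs_sub_le_of_near hc.regular
      (((htT 0).equal_iff hc).1 h₀) j)).1
    rw [zero_add, map_one, one_mul] at this
    linarith
  have hT₁ : ∀ n j, T n j + toRat (n + 1 + 1) * f (n + 1) ≤ T (n + 1) j + 3 * eps j :=
    fun n j => by
    obtain ⟨c, hc⟩ := (ha (n + 1)).mul (hx (n + 1))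
    have h₃ := (htT n).add hc
    have h₄ := (abs_le.1 ((htT (n + 1)).regular.abs_sub_le_of_near h₃.regular
      (((htT (n + 1)).equal_iff h₃).1 (h₁ n)) j)).1
    have h₅ := (abs_le.1 ((htT n).regular j 1)).2
    linarith
  -- At a fixed precision `j` this is Δ⁰₁. Each step costs `3 * eps j`, and the earlier summands are
  -- dropped because they are nonnegative.
  have hle : ∀ j, toRat (n + 1) * f n ≤ T n j + 3 * toRat (n + 1) * eps j := fun j => by
    refine del_induction
      (fun n => toRat (n + 1) * f n ≤ T n j + 3 * toRat (n + 1) * eps j) ?_ (fun n hn => ?_) n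
    · have h₃ := hT₀ j
      have h₄ := eps_pos j
      rw [zero_add, map_one]
      linarith
    · have h₃ := hT₁ n j
      have h₄ := mul_nonneg (toRat_nonneg (n + 1)) (hf n)
      rw [map_add _ (n + 1) 1, map_one] at h₃ ⊢
      linarith
  obtain ⟨c, hc⟩ := (ha n).mul (huU n)
  have hpos : 0 < toRat (n + 1) := toRat_pos.2 (Num.pos_of_ne_zero (hM.out.succ_ne_zero n))
  refine le_of_mul_le_mul_left (a := toRat (n + 1)) ?_ hpos
  -- The error is `3 * toRat (n + 1)` from `hle`, `2` from the equality of reals, and `2 * toRat (n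
  -- + 1)` from the bound on `u n`.
  refine le_of_forall_eps (C := 5 * toRat (n + 1) + 2) 0 fun j _ => ?_
  have h₃ := (abs_le.1 (hc.regular.abs_sub_le_of_near (htT n).regular
    ((hc.equal_iff (htT n)).1 (h₂ n)) j)).1
  have h₄ := ((huU n).abs.le_iff (.const (Fraction.isRat_twoNeg k))).1 hn (c + j)
  rw [Fraction.val_twoNeg] at h₄
  have h₅ : eps (c + j) ≤ eps j := eps_anti le_add_self
  have h₆ : U n (c + j) ≤ eps k + 2 * eps j := by linarith [le_abs_self (U n (c + j))]
  have h₇ := mul_le_mul_of_nonneg_left h₆ hpos.le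
  have h₈ := hle j
  linarith

/-- The rate bounds the search for witnesses. If `m` is first enumerated at stage `n + 1` with `n ≥
m` and `n ≥ g (m + 2)`, then `2 ^ (-m-1) ≤ f n ≤ 2 ^ (-m-2)`, which is absurd. -/
theorem sigmaComprehension_of_satRKRONPosRat (h : M.SatRKRONPosRat) : M.SigmaComprehension := by
  intro P hP
  obtain ⟨f, S, hf, hS, hfS, hS₁, hpos, hSle, hjump⟩ := exists_series_of_rel P
  have hf' : IsRecQ2 fun n (_ : M.Num) => f n := ⟨inferInstance⟩
  have hS' : IsRecQ2 fun n (_ : M.Num) => S n := ⟨inferInstance⟩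
  obtain ⟨p, m, d, hp, hm, hd, hpmd⟩ := IsRecQ2.exists_rec fun n (_ : M.Num) => f n
  have hp' : IsRec2 fun n (_ : M.Num) => p n 0 := ⟨inferInstance⟩
  have hm' : IsRec2 fun n (_ : M.Num) => m n 0 := ⟨inferInstance⟩
  have hd' : IsRec2 fun n (_ : M.Num) => d n 0 := ⟨inferInstance⟩
  have hone : IsRec2 fun n (_ : M.Num) => n + 1 := ⟨inferInstance⟩
  have hcst : ∀ c : M.Num, IsRec2 fun _ _ : M.Num => c := fun c => ⟨inferInstance⟩
  have hval : ∀ n, Fraction.val ⟨p n 0, m n 0, d n 0⟩ = f n := fun n => (hpmd n 0).2.symm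
  obtain ⟨x, hxM, hx, hxq, hxf⟩ := exists_isRealSeq (fun n _ => p n 0) (fun n _ => m n 0)
    (fun n _ => d n 0) (fun n _ => (hpmd n 0).1) fun n => .const _
  simp only [hval] at hxf
  have := hcst 0
  have := hcst 1
  obtain ⟨a, haM, ha, haq, haf⟩ := exists_isRealSeq (fun n (_ : M.Num) => n + 1) (fun _ _ => 0)
    (fun _ _ => 1) (fun n _ => one_pos) fun n => .const _
  replace haf : ∀ n, Presents (term a n) fun _ => toRat (n + 1) := fun n => by
    rw [← Fraction.val_ofNum]
    exact haf n
  obtain ⟨s, hsM, hs, hsS⟩ := exists_isRealSeq_of_regular (fun n (_ : M.Num) => S n)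
    fun n => .const _
  have hcode : IsRec1 fun n => Fraction.code ⟨p n 0, m n 0, d n 0⟩ := by
    have : IsRec fun v : ℕ → M.Num => pair (pair (p (v 0) 0) (m (v 0) 0)) (d (v 0) 0) :=
      inferInstance
    exact ⟨this⟩
  have hprem : KronPremise a x := by
    refine ⟨fun n => ⟨?_, ?_⟩, fun n => ⟨n, ?_⟩, s, hsM, hs, ⟨?_, fun n => ?_⟩, fun k => ?_⟩
    · rw [Presentation.lt, (haf n).le_iff (.const (Fraction.isRat_ofNum _))]
      intro hle
      -- At precision `2` the tolerance `2 * 2 ^ (-2)` is below `1`, hence below `n + 1`.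
      have h₁ := hle (1 + 1)
      rw [Fraction.val_ofNum, map_zero, map_add, map_one, eps_succ, eps_one] at h₁
      linarith [toRat_nonneg n]
    · rw [(haf n).le_iff (haf (n + 1))]
      intro k
      rw [map_add _ (n + 1), map_one]
      linarith [eps_pos k]
    · rw [(Presents.const (Fraction.isRat_ofNum _)).le_iff (haf n)]
      intro k
      rw [Fraction.val_ofNum, map_add, map_one]
      linarith [eps_pos k]
    · rw [(hsS 0).equal_iff (hxf 0), hfS]
      exact .refl _
    · rw [(hsS (n + 1)).equal_iff ((hsS n).add (hxf (n + 1))), hS₁]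
      exact .refl _
    · obtain ⟨N, hN⟩ := exists_forall_abs_sub_le S
        (fun n => by rw [hS₁]; linarith [hpos (n + 1)]) hSle k
      refine ⟨N, fun m n hm hn => ?_⟩
      rw [((hsS m).sub (hsS n)).abs.le_iff (.const (Fraction.isRat_twoNeg k)), Fraction.val_twoNeg]
      intro j
      linarith [hN m n hm hn, eps_pos j]
  have hy : IsPosRatSeq (graph fun n => Fraction.code ⟨p n 0, m n 0, d n 0⟩) := by
    refine ⟨isFun_graph _, fun n c hc => ⟨⟨p n 0, m n 0, d n 0⟩, (hpmd n 0).1, ?_,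
      (pair_mem_graph (F := fun n => Fraction.code ⟨p n 0, m n 0, d n 0⟩)).1 hc⟩⟩
    have h₁ := (hpmd n 0).2 ▸ hpos n
    rw [div_pos_iff_of_pos_right (toRat_pos.2 (hpmd n 0).1), sub_pos] at h₁
    exact FracField.of_lt_of.1 h₁
  have hyx : IsRatSeqAsReal (graph fun n => Fraction.code ⟨p n 0, m n 0, d n 0⟩) x := fun n k q => by
    rw [hxq, pair_mem_graph (F := fun n => Fraction.code ⟨p n 0, m n 0, d n 0⟩),
      Fraction.code_inj]
    constructor
    · rintro rfl
      exact ⟨(hpmd n 0).1, rfl⟩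
    · exact fun h => h.2
  obtain ⟨u, huM, hu, hmean, g, hgM, hg, hrate⟩ :=
    h _ (graph_mem_sets _) hy a haM x hxM ha hx haq hyx hprem
  obtain ⟨G, hG, hG'⟩ := hg.exists_rec hgM
  -- The summand `m` in the bound guarantees `m ≤ n` at the critical stage, which `hjump` requires.
  convert! setOf_mem_sets fun m => ∃ i, i < m + G (m + 1 + 1) + 1 ∧ P m i using 1
  ext m
  refine ⟨fun hm => ?_, fun ⟨i, _, hi⟩ => ⟨i, hi⟩⟩
  obtain ⟨i, hi, hi'⟩ := exists_least (fun i => P m i) hm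
  refine ⟨i, Num.lt_add_one_iff.2 (not_lt.1 fun hlt => ?_), hi⟩
  obtain ⟨n, rfl⟩ := exists_add_of_le (Num.add_one_le_iff.2 (le_self_add.trans_lt hlt))
  have hmn : m + 1 + n = m + n + 1 := add_right_comm _ _ _
  rw [hmn] at hlt hi hi'
  have h₁ := hjump m (m + n) le_self_add hi hi'
  have h₂ := hmean.le_eps hu huM haf hxf (fun n => (hpos n).le)
    (hrate (m + 1 + 1) _ (m + n) ((hG' _ _).2 rfl)
      (le_add_self.trans (Num.lt_add_one_iff.1 hlt)))
  have h₃ := eps_pos (m + 1)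
  rw [eps_succ (m + 1)] at h₂
  linarith

end L2Structure

/-! ### The theorem -/

theorem theorem3p6 (M : L2Structure.{u}) (hM : M.ModelsRCA0) :
    M.SatKRON ∧
    (M.ModelsACA0 → M.SatRKRON) ∧
    (M.SatRKRONPosRat → M.ModelsACA0) ∧
    (M.ModelsACA0 ↔ M.SatRKRON) := by
  have : Fact M.ModelsRCA0 := ⟨hM⟩
  have h₁ : M.SatRKRONPosRat → M.ModelsACA0 := fun h =>
    (L2Structure.sigmaComprehension_of_satRKRONPosRat h).modelsACA0
  have h₂ : M.ModelsACA0 → M.SatRKRON := fun h => h.sigmaComprehension.satRKRON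
  exact ⟨L2Structure.satKRON, h₂, h₁, h₂,
    fun h => h₁ fun _ _ _ a ha x hx ha' hx' _ _ => h a ha x hx ha' hx'⟩
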